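/- For a number field $K$ and $c\in K$ let $f_c(z)=z^2+c$, and let $G(f_c,K)$ be the directed graph whose vertices are the points $x\in K$ that are preperiodic for $f_c$ (the fixed point at infinity is left out), with an edge $x\to y$ if and only if $f_c(x)=y$. A point has type $m_n$ if its preperiod is $n$ and its eventual period is $m$. Let $G_6$ be the directed graph with the twelve vertices $v_0,\dots,v_{11}$ and the twelve edges $$v_0\to v_0,\quad v_1\to v_0,\quad v_2\to v_1,\quad v_3\to v_1,\quad v_4\to v_4,\quad v_5\to v_4,$$ $$v_6\to v_7,\quad v_7\to v_6,\quad v_8\to v_7,\quad v_9\to v_6,\quad v_{10}\to v_8,\quad v_{11}\to v_8.$$ (This is the smallest directed graph, with every vertex of out-degree $1$ and in-degree $0$ or $2$, that contains a point $v_2$ of type $1_2$, a fixed point $v_4$ not in the orbit of $v_2$, and a point $v_{10}$ of type $2_2$.) Theorem. (i) Let $K$ be a quadratic field and let $c\in K$. Then $G(f_c,K)$ does not contain a subgraph isomorphic to $G_6$. (ii) The affine curve $Y$ over $\mathbb{Q}$ defined by $$y^2=(5q^2-1)(q^2+3),\qquad z^2=5q^4-8q^3+6q^2+8q+5$$ is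 geometrically integral of geometric genus $5$. Write $Y(\mathbb{Q},2)=\{P\in Y(\overline{\mathbb{Q}}) : [\mathbb{Q}(P):\mathbb{Q}]\le 2\}$, where $\mathbb{Q}(P)$ is the field generated by the coordinates $(q,y,z)$ of $P$. Then $$Y(\mathbb{Q},2)=Y(\mathbb{Q})=\{(\pm1,\pm4,\pm4)\},$$ where the signs are independent (eight points). -/

import Mathlib

/-! ### Preperiodic points of `f_c(z) = z² + c` and their graph -/

/-- The quadratic map `f_c(z) = z² + c`. -/
def quadMap {K : Type*} [Field K] (c : K) (z : K) : K := z ^ 2 + c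

/-- `x` is preperiodic for `f`: there are `m ≥ 1` and `n ≥ 0` with `f^(m+n)(x) = f^n(x)`. -/
def IsPreperiodic {X : Type*} (f : X → X) (x : X) : Prop :=
  ∃ m n : ℕ, 1 ≤ m ∧ f^[m + n] x = f^[n] x

/-- The directed graph `G(f, X)` on the preperiodic points of `f : X → X`, with an edge from `x`
to `y` exactly when `f x = y`. For `f = f_c` on a field `K` the vertices are the `K`-rational
preperiodic points of `f_c`, the fixed point at infinity being left out. -/
def preperiodicGraph {X : Type*} (f : X → X) : Digraph {x : X // IsPreperiodic f x} where
  Adj x y := f x.1 = y.1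

/-- `G` contains a (not necessarily induced) subgraph isomorphic to `H`. -/
def ContainsGraph {V W : Type*} (G : Digraph V) (H : Digraph W) : Prop :=
  ∃ φ : W → V, Function.Injective φ ∧ ∀ u v, H.Adj u v → G.Adj (φ u) (φ v)

/-- The out-neighbour of each of the twelve vertices of the graph `G₆`.

* `0` is a fixed point and `1` is its second preimage; `2` and `3` are the preimages of `1`
  (points of type `1₂`);
* `4` is another fixed point and `5` is its second preimage;
* `6 ⇄ 7` is a 2-cycle, `8` is the second preimage of `7` and `9` that of `6`; `10` and `11` are
  the preimages of `8` (points of type `2₂`).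

This is the smallest directed graph, with every vertex of out-degree `1` and of in-degree `0` or
`2`, that contains a point of type `1₂` (`α = 2`), a fixed point (`α' = 4`) not in its orbit, and a
point of type `2₂` (`β = 10`). -/
def G6next : Fin 12 → Fin 12 := ![0, 0, 1, 1, 4, 4, 7, 6, 7, 6, 8, 8]

/-- The graph `G₆`. -/
def G6 : Digraph (Fin 12) where
  Adj u v := G6next u = v

/-! ### Affine curves over `k` given by equations, and their points of bounded degree -/

/-- The geometric points (with coordinates in an algebraic closure) of the affine algebraic set
over `k` cut out by the polynomials in `S`. -/
noncomputable def geometricPoints {k : Type*} [Field k] {n : ℕ} (S : Set (MvPolynomial (Fin n) k)) :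
    Set (Fin n → AlgebraicClosure k) :=
  {P | ∀ F ∈ S, MvPolynomial.aeval P F = 0}

/-- The field of definition `k(P)` of a point `P`, generated over `k` by its coordinates. -/
noncomputable def fieldOfDefinition {k : Type*} [Field k] {n : ℕ} (P : Fin n → AlgebraicClosure k) :
    IntermediateField k (AlgebraicClosure k) :=
  IntermediateField.adjoin k (Set.range P)

/-- `Y(k)`, as a subset of the set of geometric points. -/
noncomputable def rationalPoints {k : Type*} [Field k] {n : ℕ} (S : Set (MvPolynomial (Fin n) k)) :
    Set (Fin n → AlgebraicClosure k) :=
  {P ∈ geometricPoints S | ∀ i, P i ∈ Set.range (algebraMap k (AlgebraicClosure k))}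

/-- `Y(k, 2)`: the geometric points `P` with `[k(P) : k] ≤ 2`. -/
noncomputable def quadraticPoints {k : Type*} [Field k] {n : ℕ} (S : Set (MvPolynomial (Fin n) k)) :
    Set (Fin n → AlgebraicClosure k) :=
  {P ∈ geometricPoints S | Module.finrank k (fieldOfDefinition P) ≤ 2}

/-! ### The geometric genus -/

/-- The `k`-space of everywhere regular differentials of a field `F` over `k`: those
`ω ∈ Ω[F⁄k]` that, for every valuation ring `A` of `F` containing `k`, lie in the image of
`Ω[A⁄k]`, that is, in the `A`-span of the differentials of elements of `A`. If `F` is a function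
field of one variable over an algebraically closed field `k` of characteristic zero, then the
valuation rings `A ≠ F` are the local rings of the nonsingular projective model `X` of `F`, and
this is `H⁰(X, Ω¹)`. -/
noncomputable def regularDifferentials (k F : Type*) [Field k] [Field F] [Algebra k F] :
    Submodule k (KaehlerDifferential k F) :=
  ⨅ (A : Subalgebra k F) (_ : ∀ x : F, x ∈ A ∨ x⁻¹ ∈ A),
    (Submodule.span A (KaehlerDifferential.D k F '' (A : Set F))).restrictScalars k

/-- The ideal generated by the polynomials in `S` over an algebraic closure of `k`. -/
noncomputable def geometricIdeal {k : Type*} [Field k] {n : ℕ}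
    (S : Set (MvPolynomial (Fin n) k)) : Ideal (MvPolynomial (Fin n) (AlgebraicClosure k)) :=
  Ideal.span (MvPolynomial.map (algebraMap k (AlgebraicClosure k)) '' S)

/-- The equations in `S` (over a field `k` of characteristic zero) define a geometrically
integral affine curve of geometric genus `g`: over an algebraic closure of `k` they generate a prime
ideal, the function field has transcendence degree one, and its nonsingular projective model has
a `g`-dimensional space of regular differentials. -/
def IsAffineCurveOfGenus {k : Type*} [Field k] [CharZero k] {n : ℕ}
    (S : Set (MvPolynomial (Fin n) k)) (g : ℕ) : Prop :=
  ∃ _ : (geometricIdeal S).IsPrime,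
    Algebra.trdeg (AlgebraicClosure k)
      (FractionRing (MvPolynomial (Fin n) (AlgebraicClosure k) ⧸ geometricIdeal S)) = 1 ∧
    Module.rank (AlgebraicClosure k) (regularDifferentials (AlgebraicClosure k)
      (FractionRing (MvPolynomial (Fin n) (AlgebraicClosure k) ⧸ geometricIdeal S))) = g

/-- The equations of the affine curve `Y` in the coordinates `(q, y, z) = (X 0, X 1, X 2)`:
`y² = (5q² - 1)(q² + 3)` and `z² = 5q⁴ - 8q³ + 6q² + 8q + 5`. -/
noncomputable def curveY : Set (MvPolynomial (Fin 3) ℚ) :=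
  {MvPolynomial.X 1 ^ 2
      - (5 * MvPolynomial.X 0 ^ 2 - 1) * (MvPolynomial.X 0 ^ 2 + 3),
    MvPolynomial.X 2 ^ 2
      - (5 * MvPolynomial.X 0 ^ 4 - 8 * MvPolynomial.X 0 ^ 3 + 6 * MvPolynomial.X 0 ^ 2
          + 8 * MvPolynomial.X 0 + 5)}

/-! Write `F = (5q² - 1)(q² + 3)` and `G = 5q⁴ - 8q³ + 6q² + 8q + 5`. A copy of the graph contains a
fixed point `a`, a 2-cycle through `b`, and points `u`, `v` with images `-a`, `-b`. Then `t = a + b`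
satisfies `2at = t² + t + 1`, and `q = (1 - t)/(1 + t)`, together with multiples of `u` and `v`, is
a `K`-point of `Y`. So part (i) follows from `sq_eq_one_of_points`, because `q² = 1` would mean `t =
0`.

The arithmetic input is that the affine rational points of `y² = F`, `z² = G` and `w² = FG` all have
`q = ±1` (`rational_first`, `rational_second`, `rational_product`). Factoring over `ℤ` reduces these
to Fermat descents on the pairs `a² - b²`, `a² + 15b²` and `a² - 5b²`, `a² + 75b²`, and on the
system `mn = x² + w²`, `m² - n² = xw`.

Now take a point of degree at most two. If `q` is rational and `y` is not, then `z` is rational or a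
rational multiple of `y`, which gives a rational point on `z² = G` or on `w² = FG`. If `q` is
irrational with minimal polynomial `x² + Bx + C`, then `y = a + bq`. Adding a multiple of the
minimal polynomial to `a + bx` gives a parabola through `(1, 4)`. Its fourth intersection with `y² =
F` is rational, hence lies over `x = ±1`, and this places `(B, C)` on a line or a conic. The same
holds for `G`, and the two loci have no common point with `1 ± B + C ≠ 0` (`no_common_conic`).

For the genus, `1, y, z, yz` are independent over `k(q)`, so the ideal is prime. The differentials
`dq/yz`, `q dq/yz`, `q² dq/yz`, `dq/y`, `dq/z` are regular by a Bézout identity for separable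
polynomials. Conversely, a regular differential becomes integral under every embedding of the
function field in `k((t))`. Changing the signs of `y` and `z` separates its four components, the
parametrizations `q = α + t²` remove all denominators, and `q = 1/t` bounds the degrees
(`IsBiquadraticField.rank_regularDifferentials`). -/

/-! ### Factorization and congruence tools for the descents. -/

/-- The pivot of every descent below: two factorizations of one integer have a common refinement,
and in terms of the four parts a quadratic relation between the factors separates. -/
theorem exists_fourNumber {a b c d : ℤ} (ha : a ≠ 0) (h : a * b = c * d) :
    ∃ α β γ δ : ℤ, a = α * β ∧ b = γ * δ ∧ c = α * γ ∧ d = β * δ := by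
  obtain ⟨α, β, ⟨γ, rfl⟩, ⟨δ, rfl⟩, rfl⟩ := exists_dvd_and_dvd_of_dvd_mul (Dvd.intro _ h)
  refine ⟨α, β, γ, δ, rfl, ?_, rfl, rfl⟩
  apply mul_left_cancel₀ ha
  linear_combination h

theorem exists_smul_of_mul_eq_mul {x y s t : ℤ} (hx : x ≠ 0) (hxy : IsCoprime x y)
    (h : x * s = y * t) : ∃ k, s = k * y ∧ t = k * x := by
  obtain ⟨k, rfl⟩ := hxy.dvd_of_dvd_mul_left (Dvd.intro _ h)
  refine ⟨k, ?_, mul_comm _ _⟩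
  apply mul_left_cancel₀ hx
  linear_combination h

/-- Positive coprime factors of `d * s²`, for `d` squarefree: each is a divisor of `d` times a
square. -/
theorem exists_eq_mul_sq_of_mul_eq {A B d s : ℤ} (hA : 0 < A) (hB : 0 < B)
    (hAB : IsCoprime A B) (hd : 0 < d) (h : A * B = d * s ^ 2) :
    ∃ d₁ d₂ e f : ℤ, 0 < d₁ ∧ 0 < d₂ ∧ d₁ * d₂ = d ∧ A = d₁ * e ^ 2 ∧ B = d₂ * f ^ 2 ∧ e * f = s := by
  obtain ⟨d₁, d₂, hd₁, hd₂, rfl⟩ := exists_dvd_and_dvd_of_dvd_mul (Dvd.intro _ h.symm)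
  obtain ⟨A', rfl⟩ := hd₁
  obtain ⟨B', rfl⟩ := hd₂
  have hdd : d₁ * d₂ ≠ 0 := hd.ne'
  have h' : A' * B' = s ^ 2 := by
    apply mul_left_cancel₀ hdd
    linear_combination h
  have hc : IsCoprime A' B' := hAB.of_mul_left_right.of_mul_right_right
  obtain ⟨e, he⟩ := Int.sq_of_isCoprime hc h'
  obtain ⟨f, hf⟩ := Int.sq_of_isCoprime hc.symm ((mul_comm _ _).trans h')
  have key : ∀ d₁ A' e : ℤ, 0 < d₁ * A' → (A' = e ^ 2 ∨ A' = -e ^ 2) →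
      ∃ D, 0 < D ∧ (D = d₁ ∨ D = -d₁) ∧ d₁ * A' = D * e ^ 2 := by
    rintro d₁ A' e h0 (rfl | rfl)
    · exact ⟨d₁, pos_of_mul_pos_left h0 (sq_nonneg e), Or.inl rfl, rfl⟩
    · refine ⟨-d₁, ?_, Or.inr rfl, by ring⟩
      by_contra hneg
      nlinarith [sq_nonneg e]
  obtain ⟨D₁, hD₁, hD₁', hAe⟩ := key d₁ A' e hA he
  obtain ⟨D₂, hD₂, hD₂', hBf⟩ := key d₂ B' f hB hf
  have hD : D₁ * D₂ = d₁ * d₂ := by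
    have := mul_pos hD₁ hD₂
    rcases hD₁' with rfl | rfl <;> rcases hD₂' with rfl | rfl <;> nlinarith
  have hs : (e * f) ^ 2 = s ^ 2 := by
    apply mul_left_cancel₀ hdd
    rw [← hD]
    linear_combination h - D₂ * f ^ 2 * hAe - (d₁ * A') * hBf - s ^ 2 * hD
  rcases sq_eq_sq_iff_eq_or_eq_neg.1 hs with hs | hs
  · exact ⟨D₁, D₂, e, f, hD₁, hD₂, hD, hAe, hBf, hs⟩
  · exact ⟨D₁, D₂, -e, f, hD₁, hD₂, hD, by rw [hAe]; ring, hBf, by linear_combination -hs⟩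

theorem IsCoprime.not_common_dvd {a b p : ℤ} (h : IsCoprime a b) (hp : 1 < p) (ha : p ∣ a)
    (hb : p ∣ b) : False := by
  have := Int.isUnit_iff.1 (h.isUnit_of_dvd' ha hb)
  omega

theorem Int.sq_mod_two_cases (x : ℤ) : (x % 2 = 0 ∧ x ^ 2 % 4 = 0) ∨ (x % 2 = 1 ∧ x ^ 2 % 8 = 1) := by
  rcases Int.even_or_odd' x with ⟨m, h | h⟩
  · exact Or.inl ⟨by omega, by rw [h, mul_pow]; omega⟩
  · refine Or.inr ⟨by omega, ?_⟩
    obtain ⟨k, hk⟩ := Int.even_mul_succ_self m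
    rw [h, show (2 * m + 1) ^ 2 = 8 * k + 1 by linear_combination 4 * hk]
    omega

theorem Int.sq_mod_three_cases (x : ℤ) : (3 ∣ x ∧ 9 ∣ x ^ 2) ∨ x ^ 2 % 3 = 1 := by
  obtain ⟨m, h | h | h⟩ : ∃ m, x = 3 * m ∨ x = 3 * m + 1 ∨ x = 3 * m + 2 := ⟨x / 3, by omega⟩
  · exact Or.inl ⟨⟨m, h⟩, m ^ 2, by rw [h]; ring⟩
  · right
    rw [h, show (3 * m + 1) ^ 2 = 3 * (3 * m ^ 2 + 2 * m) + 1 by ring]; omega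
  · right
    rw [h, show (3 * m + 2) ^ 2 = 3 * (3 * m ^ 2 + 4 * m + 1) + 1 by ring]; omega

theorem Int.sq_mod_five_cases (x : ℤ) :
    (5 ∣ x ∧ 25 ∣ x ^ 2) ∨ x ^ 2 % 5 = 1 ∨ x ^ 2 % 5 = 4 := by
  obtain ⟨m, h | h | h | h | h⟩ : ∃ m, x = 5 * m ∨ x = 5 * m + 1 ∨ x = 5 * m + 2 ∨
      x = 5 * m + 3 ∨ x = 5 * m + 4 := ⟨x / 5, by omega⟩
  · exact Or.inl ⟨⟨m, h⟩, m ^ 2, by rw [h]; ring⟩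
  · right; left
    rw [h, show (5 * m + 1) ^ 2 = 5 * (5 * m ^ 2 + 2 * m) + 1 by ring]; omega
  · right; right
    rw [h, show (5 * m + 2) ^ 2 = 5 * (5 * m ^ 2 + 4 * m) + 4 by ring]; omega
  · right; right
    rw [h, show (5 * m + 3) ^ 2 = 5 * (5 * m ^ 2 + 6 * m + 1) + 4 by ring]; omega
  · right; left
    rw [h, show (5 * m + 4) ^ 2 = 5 * (5 * m ^ 2 + 8 * m + 3) + 1 by ring]; omega

theorem IsCoprime.of_add_mul {x y : ℤ} (h : IsCoprime (x + y) (x * y)) : IsCoprime x y := by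
  obtain ⟨m, n, h⟩ := h
  exact ⟨m + n * y, m, by linear_combination h⟩

theorem IsCoprime.of_sub_mul {x y : ℤ} (h : IsCoprime (x - y) (x * y)) : IsCoprime x y := by
  obtain ⟨m, n, h⟩ := h
  exact ⟨m + n * y, -m, by linear_combination h⟩

theorem Int.natAbs_le_of_dvd {a b : ℤ} (hb : b ≠ 0) (h : a ∣ b) : a.natAbs ≤ b.natAbs :=
  Nat.le_of_dvd (Int.natAbs_pos.2 hb) (Int.natAbs_dvd_natAbs.2 h)

/-- A common value of two positive definite or indefinite forms divides their resultant. -/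
theorem dvd_of_dvd_mul_sq {k N α δ : ℤ} (h : IsCoprime α δ) (h₁ : k ∣ N * α ^ 2)
    (h₂ : k ∣ N * δ ^ 2) : k ∣ N := by
  obtain ⟨m, n, hmn⟩ := h.pow (m := 2) (n := 2)
  have := (h₁.mul_left m).add (h₂.mul_left n)
  rwa [show m * (N * α ^ 2) + n * (N * δ ^ 2) = N by linear_combination N * hmn] at this

/-! ### Descent for `a² - b²` and `a² + 15b²`. -/

theorem sq_add_sq_mod_eight {x y : ℤ} (h : x % 2 = 1 ∨ y % 2 = 1) :
    ((x * y) ^ 2 + 1 - x ^ 2 - y ^ 2) % 8 = 0 := by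
  rw [show (x * y) ^ 2 + 1 - x ^ 2 - y ^ 2 = (x ^ 2 - 1) * (y ^ 2 - 1) by ring]
  apply Int.emod_eq_zero_of_dvd
  rcases Int.sq_mod_two_cases x with ⟨h₁, -⟩ | ⟨-, hm⟩
  · rcases Int.sq_mod_two_cases y with ⟨h₂, -⟩ | ⟨-, hm⟩
    · omega
    · exact Dvd.dvd.mul_left (by omega) _
  · exact Dvd.dvd.mul_right (by omega) _

/-- As `rs = ef`, the congruence `(xy)² + 1 ≡ x² + y²` modulo 8 (for `x` or `y` odd) makes `r² + s²`
and `e² + f²` congruent modulo 8. This rules out `D₁ = 5`; the values 3 and 15 fail modulo 4. -/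
theorem fifteen_split {r s e f D₁ D₂ : ℤ} (h₁ : 0 < D₁) (hD : D₁ * D₂ = 15)
    (hrs : (r ^ 2 + s ^ 2) % 2 = 1) (hsum : r ^ 2 + s ^ 2 = D₁ * e ^ 2 - D₂ * f ^ 2)
    (h : r * s = e * f) : D₁ = 1 ∧ D₂ = 15 := by
  have hle : D₁ ≤ 15 := Int.le_of_dvd (by norm_num) (Dvd.intro _ hD)
  have h2 : ∀ x y : ℤ, (x ^ 2 + y ^ 2) % 2 = 1 →
      (x ^ 2 + y ^ 2) % 4 = 1 ∧ ((x * y) ^ 2 + 1 - x ^ 2 - y ^ 2) % 8 = 0 := by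
    intro x y hxy
    have hx := Int.sq_mod_two_cases x
    have hy := Int.sq_mod_two_cases y
    exact ⟨by omega, sq_add_sq_mod_eight (by omega)⟩
  have hrs' := h2 r s hrs
  have hef := h2 e f
  rw [h] at hrs'
  obtain rfl | rfl | rfl | rfl : D₁ = 1 ∨ D₁ = 3 ∨ D₁ = 5 ∨ D₁ = 15 := by
    interval_cases D₁ <;> omega
  · omega
  · obtain rfl : D₂ = 5 := by omega
    omega
  · obtain rfl : D₂ = 3 := by omega
    have := hef (by omega)
    omega
  · obtain rfl : D₂ = 1 := by omega
    omega

theorem IsCoprime.odd_or_odd {x y : ℤ} (h : IsCoprime x y) : x % 2 = 1 ∨ y % 2 = 1 := by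
  by_contra! h'
  exact h.not_common_dvd (p := 2) (by norm_num) (by omega) (by omega)

/-- The nonsquare divisors 2 and 8 are excluded by parity. The bound `j ≤ 4` later controls the size
of the descended solution. -/
theorem sixteen_split {α β γ δ k : ℤ} (hβγ : IsCoprime β γ) (hαδ : IsCoprime α δ) (hk0 : 0 < k)
    (hk16 : k ∣ 16) (h₁ : α ^ 2 - δ ^ 2 = k * β ^ 2) (h₂ : α ^ 2 + 15 * δ ^ 2 = k * γ ^ 2) :
    ∃ j, k = j ^ 2 ∧ 0 < j ∧ j ≤ 4 := by
  have hle : k ≤ 16 := Int.le_of_dvd (by norm_num) hk16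
  have hodd := hβγ.odd_or_odd
  have hodd' := hαδ.odd_or_odd
  have hα := Int.sq_mod_two_cases α
  have hβ := Int.sq_mod_two_cases β
  have hγ := Int.sq_mod_two_cases γ
  have hδ := Int.sq_mod_two_cases δ
  obtain rfl | rfl | rfl | rfl | rfl : k = 1 ∨ k = 2 ∨ k = 4 ∨ k = 8 ∨ k = 16 := by
    interval_cases k <;> omega
  · exact ⟨1, by norm_num⟩
  · omega
  · exact ⟨2, by norm_num⟩
  · omega
  · exact ⟨4, by norm_num⟩

/-- Elimination gives `v² - u² = 16b²` and `v² + 15u² = 16a²`, so `(v/4, u/4)` is again a solution,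
with `a` and `b` now in the role of the square roots. It trades an odd second entry for an even one.
-/
theorem concordant_fifteen_swap {a b u v : ℤ} (hab : IsCoprime a b) (hb : b % 2 = 1)
    (h₁ : a ^ 2 - b ^ 2 = u ^ 2) (h₂ : a ^ 2 + 15 * b ^ 2 = v ^ 2) :
    ∃ x y : ℤ, u = 4 * x ∧ IsCoprime y x ∧ Even x ∧ y ^ 2 - x ^ 2 = b ^ 2 ∧
      y ^ 2 + 15 * x ^ 2 = a ^ 2 := by
  have ha2 := Int.sq_mod_two_cases a
  have hb2 := Int.sq_mod_two_cases b
  have hu2 := Int.sq_mod_two_cases u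
  have hv2 := Int.sq_mod_two_cases v
  obtain ⟨x, rfl⟩ : 4 ∣ u := by
    obtain ⟨x, rfl⟩ : 2 ∣ u := by omega
    have := Int.sq_mod_two_cases x
    rw [mul_pow] at h₁
    omega
  obtain ⟨y, rfl⟩ : 4 ∣ v := by
    obtain ⟨y, rfl⟩ : 2 ∣ v := by omega
    have := Int.sq_mod_two_cases y
    rw [mul_pow] at h₂
    omega
  have e₃ : y ^ 2 - x ^ 2 = b ^ 2 := by linarith
  have e₄ : y ^ 2 + 15 * x ^ 2 = a ^ 2 := by linarith
  refine ⟨x, y, rfl, ?_, ?_, e₃, e₄⟩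
  · obtain ⟨m, n, hmn⟩ := hab.pow (m := 2) (n := 2)
    refine (IsCoprime.pow_iff two_pos two_pos).1 ⟨m + n, 15 * m - n, ?_⟩
    linear_combination hmn + m * e₄ + n * e₃
  · rw [Int.even_iff]
    have := Int.sq_mod_two_cases x
    have := Int.sq_mod_two_cases y
    omega

/-- The coprime pair `(a ± u)/2` has product `c²` and sum `a`; the coprime pair `(v ± a)/2` has
product `15c²` and difference `a`. Both are therefore squares up to divisors of 1 and 15, and the
two expressions for `a` are equated. -/
theorem concordant_fifteen_descent {a c u v : ℤ} (hab : IsCoprime a (2 * c)) (hc0 : c ≠ 0)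
    (h₁ : a ^ 2 - (2 * c) ^ 2 = u ^ 2) (h₂ : a ^ 2 + 15 * (2 * c) ^ 2 = v ^ 2) :
    ∃ r s e f : ℤ, r * s = c ∧ e * f = c ∧ IsCoprime r s ∧
      r ^ 2 + s ^ 2 = e ^ 2 - 15 * f ^ 2 := by
  wlog ha : 0 < a generalizing a
  · refine this (a := -a) hab.neg_left (by linear_combination h₁) (by linear_combination h₂) ?_
    rcases lt_trichotomy a 0 with h | h | h
    · omega
    · subst h; nlinarith [sq_nonneg u, sq_nonneg c, sq_pos_of_ne_zero hc0]
    · exact absurd h ha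
  wlog hv : 0 < v generalizing v
  · refine this (v := -v) (by linear_combination h₂) ?_
    rcases lt_trichotomy v 0 with h | h | h
    · omega
    · subst h; nlinarith [sq_pos_of_ne_zero hc0]
    · exact absurd h hv
  have hac : IsCoprime a c := hab.of_mul_right_right
  have ha2 : a % 2 = 1 := by
    by_contra h
    exact hab.not_common_dvd (p := 2) (by norm_num) (by omega) (Dvd.intro _ rfl)
  have h₁' : a ^ 2 - 4 * c ^ 2 = u ^ 2 := by linear_combination h₁
  have h₂' : a ^ 2 + 60 * c ^ 2 = v ^ 2 := by linear_combination h₂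
  have hsa := Int.sq_mod_two_cases a
  have hparity : u % 2 = 1 ∧ v % 2 = 1 := by
    have := Int.sq_mod_two_cases u
    have := Int.sq_mod_two_cases v
    omega
  have ha15 : IsCoprime a 15 := by
    have h3 : IsCoprime a 3 := by
      refine (Int.prime_three.coprime_iff_not_dvd.2 fun h => ?_).symm
      refine hac.not_common_dvd (p := 3) (by norm_num) h ?_
      obtain ⟨m, hm⟩ := h
      have : a ^ 2 = 9 * m ^ 2 := by rw [hm]; ring
      rcases Int.sq_mod_three_cases c with h' | h' <;>
      rcases Int.sq_mod_three_cases u with h'' | h'' <;> omega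
    have h5 : IsCoprime a 5 := by
      have p5 : Prime (5 : ℤ) := Nat.prime_iff_prime_int.1 Nat.prime_five
      refine (p5.coprime_iff_not_dvd.2 fun h => ?_).symm
      refine hac.not_common_dvd (p := 5) (by norm_num) h ?_
      obtain ⟨m, hm⟩ := h
      have : a ^ 2 = 25 * m ^ 2 := by rw [hm]; ring
      rcases Int.sq_mod_five_cases c with h' | h' | h' <;>
      rcases Int.sq_mod_five_cases v with h'' | h'' | h'' <;> omega
    exact h3.mul_right h5
  obtain ⟨A, hA⟩ : ∃ A, a + u = 2 * A := ⟨(a + u) / 2, by omega⟩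
  obtain ⟨B, hB⟩ : ∃ B, v + a = 2 * B := ⟨(v + a) / 2, by omega⟩
  obtain rfl : u = 2 * A - a := by linarith
  obtain rfl : v = 2 * B - a := by linarith
  have hAA : A * (a - A) = 1 * c ^ 2 := by linarith
  have hBB : B * (B - a) = 15 * c ^ 2 := by linarith
  have hc2 := sq_pos_of_ne_zero hc0
  have hA0 : 0 < A := by nlinarith
  have hA1 : 0 < a - A := by nlinarith
  have hB1 : 0 < B - a := by nlinarith
  have hcopA : IsCoprime A (a - A) := by
    apply IsCoprime.of_add_mul
    rw [hAA, add_sub_cancel, one_mul]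
    exact hac.pow_right
  have hcopB : IsCoprime B (B - a) := by
    apply IsCoprime.of_sub_mul
    rw [hBB, sub_sub_cancel]
    exact ha15.mul_right hac.pow_right
  obtain ⟨d₁, d₂, r, s, hd₁, hd₂, hd, hAr, hAs, hrs⟩ :=
    exists_eq_mul_sq_of_mul_eq hA0 hA1 hcopA one_pos hAA
  obtain rfl : d₁ = 1 := by nlinarith
  obtain rfl : d₂ = 1 := by linarith
  obtain ⟨D₁, D₂, e, f, hD₁, hD₂, hD, hBe, hBf, hef⟩ :=
    exists_eq_mul_sq_of_mul_eq (by linarith) hB1 hcopB (by norm_num) hBB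
  have hsum : r ^ 2 + s ^ 2 = D₁ * e ^ 2 - D₂ * f ^ 2 := by linarith
  have hars : a = r ^ 2 + s ^ 2 := by linarith
  have hcop : IsCoprime r s := by
    rw [hAs, hAr, one_mul, one_mul] at hcopA
    exact (IsCoprime.pow_iff two_pos two_pos).1 hcopA
  obtain ⟨rfl, rfl⟩ : D₁ = 1 ∧ D₂ = 15 := by
    refine fifteen_split hD₁ hD ?_ hsum (hrs.trans hef.symm)
    rw [← hars]
    omega
  exact ⟨r, s, e, f, hrs, hef, hcop, by linear_combination hsum⟩

theorem concordant_fifteen_of_even {a b u v : ℤ} (hab : IsCoprime a b) (hb : Even b)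
    (h₁ : a ^ 2 - b ^ 2 = u ^ 2) (h₂ : a ^ 2 + 15 * b ^ 2 = v ^ 2) : b = 0 := by
  induction hn : b.natAbs using Nat.strong_induction_on generalizing a b u v with
  | _ n ih =>
  by_contra hb0
  obtain ⟨c, rfl⟩ := hb.two_dvd
  have hc0 : c ≠ 0 := by rintro rfl; simp at hb0
  obtain ⟨r, s, e, f, hrs, hef, hcop, hsum⟩ := concordant_fifteen_descent hab hc0 h₁ h₂
  have hr0 : r ≠ 0 := by rintro rfl; simp at hrs; exact hc0 hrs.symm
  -- With `r = αβ`, `s = γδ`, `e = αγ`, `f = βδ` the relation becomes `γ²(α² - δ²) = β²(α² + 15δ²)`.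
  -- Coprimality makes `(α, δ)` a solution up to a common factor `k`, which must divide 16.
  obtain ⟨α, β, γ, δ, rfl, rfl, rfl, rfl⟩ := exists_fourNumber hr0 (hrs.trans hef.symm)
  obtain ⟨hα, hβ⟩ := mul_ne_zero_iff.1 hr0
  have hγδ : γ * δ ≠ 0 := by intro h; rw [h] at hrs; simp at hrs; exact hc0 hrs.symm
  obtain ⟨hγ, hδ⟩ := mul_ne_zero_iff.1 hγδ
  have hαδ : IsCoprime α δ := hcop.of_mul_left_left.of_mul_right_right
  have hβγ : IsCoprime β γ := hcop.of_mul_left_right.of_mul_right_left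
  obtain ⟨k, hk₁, hk₂⟩ := exists_smul_of_mul_eq_mul (s := α ^ 2 - δ ^ 2) (t := α ^ 2 + 15 * δ ^ 2)
    (pow_ne_zero 2 hγ) (hβγ.symm.pow (m := 2) (n := 2)) (by linear_combination -hsum)
  have hk16 : k ∣ 16 := dvd_of_dvd_mul_sq hαδ
    ⟨15 * β ^ 2 + γ ^ 2, by linear_combination 15 * hk₁ + hk₂⟩
    ⟨γ ^ 2 - β ^ 2, by linear_combination hk₂ - hk₁⟩
  have hk0 : 0 < k := by
    have : 0 < k * γ ^ 2 := by rw [← hk₂]; positivity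
    exact pos_of_mul_pos_left this (sq_nonneg _)
  obtain ⟨j, rfl, hj0, hj⟩ : ∃ j, k = j ^ 2 ∧ 0 < j ∧ j ≤ 4 :=
    sixteen_split hβγ hαδ hk0 hk16 (by linear_combination hk₁) (by linear_combination hk₂)
  have hβc : β ∣ c := ⟨α * (γ * δ), by rw [← hrs]; ring⟩
  have hδc : δ ∣ c := ⟨α * β * γ, by rw [← hrs]; ring⟩
  have hβc' := Int.natAbs_le_of_dvd hc0 hβc
  have hδc' := Int.natAbs_le_of_dvd hc0 hδc
  -- An even `δ` is a smaller solution at once. For odd `δ` the swapped solution has even second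
  -- entry `x = jβ/4`, and `j ≤ 4` gives `|x| ≤ |β| ≤ |c| < |b|`.
  by_cases hδ2 : Even δ
  · exact hδ (ih δ.natAbs (by omega) hαδ hδ2 (u := j * β) (v := j * γ)
      (by linear_combination hk₁) (by linear_combination hk₂) rfl)
  · rw [Int.not_even_iff] at hδ2
    obtain ⟨x, y, hx, hxy, hx2, e₃, e₄⟩ := concordant_fifteen_swap hαδ hδ2 (u := j * β)
      (v := j * γ) (by linear_combination hk₁) (by linear_combination hk₂)
    have hxβ : x.natAbs ≤ β.natAbs := by
      have : j.natAbs * β.natAbs = 4 * x.natAbs := by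
        rw [← Int.natAbs_mul, hx, Int.natAbs_mul]; rfl
      have := Nat.mul_le_mul_right β.natAbs (show j.natAbs ≤ 4 by omega)
      omega
    have := ih x.natAbs (by omega) hxy hx2 (u := δ) (v := α) e₃ e₄ rfl
    rw [this, mul_zero] at hx
    exact mul_ne_zero hj0.ne' hβ hx

/-- `a² - b²` and `a² + 15 b²` are both squares only for `b = 0` or `a² = b²`. -/
theorem concordant_fifteen_of_isCoprime {a b u v : ℤ} (hab : IsCoprime a b)
    (h₁ : a ^ 2 - b ^ 2 = u ^ 2) (h₂ : a ^ 2 + 15 * b ^ 2 = v ^ 2) : b = 0 ∨ a ^ 2 = b ^ 2 := by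
  by_cases hb : Even b
  · exact Or.inl (concordant_fifteen_of_even hab hb h₁ h₂)
  rw [Int.not_even_iff] at hb
  obtain ⟨x, y, hx, hxy, hx2, e₃, e₄⟩ := concordant_fifteen_swap hab hb h₁ h₂
  have := concordant_fifteen_of_even hxy hx2 e₃ e₄
  right
  linear_combination h₁ + (u + 4 * x) * hx + 16 * x * this

theorem concordant_fifteen {a b u v : ℤ}
    (h₁ : a ^ 2 - b ^ 2 = u ^ 2) (h₂ : a ^ 2 + 15 * b ^ 2 = v ^ 2) : b = 0 ∨ a ^ 2 = b ^ 2 := by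
  by_cases hb : b = 0
  · exact Or.inl hb
  right
  obtain ⟨g, x, y, hg, hxy, rfl, rfl⟩ : ∃ g x y : ℤ, g ≠ 0 ∧ IsCoprime x y ∧ a = g * x ∧
      b = g * y := by
    have hg : 0 < Int.gcd a b := Int.gcd_pos_of_ne_zero_right _ hb
    obtain ⟨x, y, hxy, hx, hy⟩ := Int.exists_gcd_one hg
    exact ⟨Int.gcd a b, x, y, by exact_mod_cast hg.ne', Int.isCoprime_iff_gcd_eq_one.2 hxy,
      by rw [mul_comm]; exact hx, by rw [mul_comm]; exact hy⟩
  obtain ⟨u, rfl⟩ : g ∣ u := (Int.pow_dvd_pow_iff two_ne_zero).1 ⟨x ^ 2 - y ^ 2, by linarith⟩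
  obtain ⟨v, rfl⟩ : g ∣ v := (Int.pow_dvd_pow_iff two_ne_zero).1 ⟨x ^ 2 + 15 * y ^ 2, by linarith⟩
  have hg2 := pow_ne_zero 2 hg
  have := concordant_fifteen_of_isCoprime hxy (u := u) (v := v)
    (mul_left_cancel₀ hg2 (by linarith)) (mul_left_cancel₀ hg2 (by linarith))
  rcases this with rfl | h
  · simp at hb
  · linear_combination g ^ 2 * h

/-- `5a² - b²` and `a² + 3b²` are both squares only for `a² = b²`. -/
theorem sq_eq_sq_of_forms {a b u v : ℤ} (h₁ : 5 * a ^ 2 - b ^ 2 = u ^ 2)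
    (h₂ : a ^ 2 + 3 * b ^ 2 = v ^ 2) : a ^ 2 = b ^ 2 := by
  -- A polynomial map from the present intersection of two quadrics to the concordant one: `X = uv -
  -- 4ab`, `Y = a² - b²` satisfy `X² - Y² = 4(av - bu)²` and `X² + 15Y² = 4(au - bv)²`.
  have := concordant_fifteen (a := u * v - 4 * a * b) (b := a ^ 2 - b ^ 2)
    (u := 2 * (a * v - b * u)) (v := 2 * (a * u - b * v))
    (by linear_combination (-v ^ 2 + 4 * b ^ 2) * h₁ + (4 * a ^ 2 - 5 * a ^ 2 + b ^ 2) * h₂)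
    (by linear_combination (-v ^ 2 + 4 * a ^ 2) * h₁ + (4 * b ^ 2 - 5 * a ^ 2 + b ^ 2) * h₂)
  rcases this with h | h
  · linarith
  -- `X² = Y²` forces `av = bu`, and `(av)² - (bu)²` equals `(a² - b²)²`.
  · have h0 : a * v - b * u = 0 := by
      have h4 : 4 * (a * v - b * u) ^ 2 = 0 := by
        linear_combination h - ((-v ^ 2 + 4 * b ^ 2) * h₁ + (4 * a ^ 2 - 5 * a ^ 2 + b ^ 2) * h₂)
      have : (a * v - b * u) ^ 2 = 0 := by linarith
      exact pow_eq_zero_iff two_ne_zero |>.1 this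
    have : (a ^ 2 - b ^ 2) ^ 2 = 0 := by
      linear_combination (a * v + b * u) * h0 + a ^ 2 * h₂ - b ^ 2 * h₁
    linarith [pow_eq_zero_iff two_ne_zero |>.1 this]

/-! ### Descent for `a² - 5b²` and `a² + 75b²`. -/

/-- `D₁ = 5` and `15` would give `5 ∣ m`; `D₁ = 25` fails because 2 is not a square modulo 5; `D₁ =
3` and `75` fail modulo 4 for odd `m`, and modulo 8 when `c` is odd, as then all four variables are
odd. -/
theorem seventyFive_split {r s e f D₁ D₂ m c : ℤ} (h₁ : 0 < D₁) (hD : D₁ * D₂ = 75)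
    (hm : m % 2 = 1 ∨ (m % 4 = 2 ∧ c % 2 = 1)) (hm5 : ¬ 5 ∣ m)
    (hrs : r ^ 2 + 5 * s ^ 2 = m) (hef : D₁ * e ^ 2 - D₂ * f ^ 2 = m)
    (hc : r * s = c) (hc' : e * f = c) : D₁ = 1 ∧ D₂ = 75 := by
  have hle : D₁ ≤ 75 := Int.le_of_dvd (by norm_num) (Dvd.intro _ hD)
  have hr := Int.sq_mod_two_cases r
  have hs := Int.sq_mod_two_cases s
  have he := Int.sq_mod_two_cases e
  have hf := Int.sq_mod_two_cases f
  have hodd : c % 2 = 1 → r % 2 = 1 ∧ s % 2 = 1 ∧ e % 2 = 1 ∧ f % 2 = 1 := by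
    intro h
    have h1 := hc ▸ h
    have h2 := hc' ▸ h
    rw [← Int.odd_iff, Int.odd_mul] at h1 h2
    simp only [Int.odd_iff] at h1 h2
    exact ⟨h1.1, h1.2, h2.1, h2.2⟩
  obtain rfl | rfl | rfl | rfl | rfl | rfl :
      D₁ = 1 ∨ D₁ = 3 ∨ D₁ = 5 ∨ D₁ = 15 ∨ D₁ = 25 ∨ D₁ = 75 := by
    clear hef hodd hm hr hs he hf
    have := Int.emod_emod_of_dvd 75 (Dvd.intro _ hD)
    interval_cases D₁ <;> omega
  · omega
  · obtain rfl : D₂ = 25 := by omega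
    omega
  · obtain rfl : D₂ = 15 := by omega
    omega
  · obtain rfl : D₂ = 5 := by omega
    omega
  · obtain rfl : D₂ = 3 := by omega
    have := Int.sq_mod_five_cases r
    have := Int.sq_mod_five_cases f
    omega
  · obtain rfl : D₂ = 1 := by omega
    omega

/-- The common core of the two parity cases of `seventyFive_start`: `A, A'` come from `a ± u` and
`B, B'` from `v ± a`, halved when `b` is even. -/
theorem seventyFive_descent {m c A A' B B' : ℤ} (hA : 0 < A) (hA' : 0 < A')
    (hB : 0 < B) (hB' : 0 < B') (hA1 : A + A' = m) (hA2 : A * A' = 5 * c ^ 2)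
    (hB1 : B - B' = m) (hB2 : B * B' = 75 * c ^ 2)
    (hm : m % 2 = 1 ∨ (m % 4 = 2 ∧ c % 2 = 1)) (hm3 : ¬ 3 ∣ m) (hm5 : ¬ 5 ∣ m)
    (hmc : IsCoprime m c) :
    ∃ r s e f : ℤ, r * s = c ∧ e * f = c ∧ IsCoprime r s ∧
      r ^ 2 + 5 * s ^ 2 = e ^ 2 - 75 * f ^ 2 := by
  have p5 : Prime (5 : ℤ) := Nat.prime_iff_prime_int.1 Nat.prime_five
  have h3 : IsCoprime m 3 := (Int.prime_three.coprime_iff_not_dvd.2 hm3).symm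
  have h5 : IsCoprime m 5 := (p5.coprime_iff_not_dvd.2 hm5).symm
  have hcopA : IsCoprime A A' := .of_add_mul (by rw [hA1, hA2]; exact h5.mul_right hmc.pow_right)
  have hcopB : IsCoprime B B' := .of_sub_mul (by
    rw [hB1, hB2, show (75 : ℤ) = 3 * (5 * 5) by norm_num]
    exact (h3.mul_right (h5.mul_right h5)).mul_right hmc.pow_right)
  wlog hAr : ∃ r s, A = r ^ 2 ∧ A' = 5 * s ^ 2 ∧ r * s = c generalizing A A'
  · refine this hA' hA (by linarith) (by linarith) hcopA.symm ?_
    obtain ⟨d₁, d₂, r, s, hd₁, hd₂, hd, hr, hs, hrs⟩ :=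
      exists_eq_mul_sq_of_mul_eq hA hA' hcopA (by norm_num) hA2
    have hle : d₁ ≤ 5 := Int.le_of_dvd (by norm_num) (Dvd.intro _ hd)
    obtain ⟨rfl, rfl⟩ | ⟨rfl, rfl⟩ : (d₁ = 1 ∧ d₂ = 5) ∨ (d₁ = 5 ∧ d₂ = 1) := by
      clear hAr
      interval_cases d₁ <;> omega
    · exact absurd ⟨r, s, by linarith, hs, hrs⟩ hAr
    · exact ⟨s, r, by linarith, hr, by linarith⟩
  obtain ⟨r, s, rfl, rfl, hrs⟩ := hAr
  obtain ⟨D₁, D₂, e, f, hD₁, hD₂, hD, rfl, rfl, hef⟩ :=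
    exists_eq_mul_sq_of_mul_eq hB hB' hcopB (by norm_num) hB2
  obtain ⟨rfl, rfl⟩ := seventyFive_split hD₁ hD hm hm5 hA1 hB1 hrs hef
  refine ⟨r, s, e, f, hrs, hef, ?_, by linarith⟩
  exact (IsCoprime.pow_iff two_pos two_pos).1 hcopA.of_mul_right_right

/-- Among the nonsquare divisors of 80, the values 2, 8, 10, 40 are excluded modulo powers of 5 by
the first equation, and 5, 20, 80 modulo powers of 3 by the second. -/
theorem eighty_split {α β γ δ k : ℤ} (hαδ : IsCoprime α δ) (hk0 : 0 < k)
    (hk16 : k ∣ 80) (h₁ : α ^ 2 - 5 * δ ^ 2 = k * β ^ 2) (h₂ : α ^ 2 + 75 * δ ^ 2 = k * γ ^ 2) :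
    ∃ j, k = j ^ 2 := by
  have hle : k ≤ 80 := Int.le_of_dvd (by norm_num) hk16
  have h5 : ¬ (5 ∣ α ∧ 5 ∣ δ) := fun h => hαδ.not_common_dvd (by norm_num) h.1 h.2
  have h3 : ¬ (3 ∣ α ∧ 3 ∣ δ) := fun h => hαδ.not_common_dvd (by norm_num) h.1 h.2
  obtain rfl | rfl | rfl | h : k = 1 ∨ k = 4 ∨ k = 16 ∨
      (k = 2 ∨ k = 8 ∨ k = 10 ∨ k = 40 ∨ k = 5 ∨ k = 20 ∨ k = 80) := by
    clear h₁ h₂ h5 h3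
    interval_cases k <;> omega
  · exact ⟨1, by norm_num⟩
  · exact ⟨2, by norm_num⟩
  · exact ⟨4, by norm_num⟩
  exfalso
  have a5 := Int.sq_mod_five_cases α
  have b5 := Int.sq_mod_five_cases β
  have d5 := Int.sq_mod_five_cases δ
  have a3 := Int.sq_mod_three_cases α
  have c3 := Int.sq_mod_three_cases γ
  have d3 := Int.sq_mod_three_cases δ
  obtain rfl | rfl | rfl | rfl | rfl | rfl | rfl := h
  · clear a3 c3 d3 h3; omega
  · clear a3 c3 d3 h3; omega
  · clear a3 c3 d3 h3; omega
  · clear a3 c3 d3 h3; omega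
  · clear a5 b5 d5 h5; omega
  · clear a5 b5 d5 h5; omega
  · clear a5 b5 d5 h5; omega

/-- For even `b` the descent runs with `m = a`, `c = b/2`; for odd `b` with `m = 2a`, `c = b`. -/
theorem seventyFive_start {a b u v : ℤ} (hab : IsCoprime a b) (hb0 : b ≠ 0)
    (h₁ : a ^ 2 - 5 * b ^ 2 = u ^ 2) (h₂ : a ^ 2 + 75 * b ^ 2 = v ^ 2) :
    ∃ c r s e f : ℤ, c ≠ 0 ∧ c ∣ b ∧
      r * s = c ∧ e * f = c ∧ IsCoprime r s ∧ r ^ 2 + 5 * s ^ 2 = e ^ 2 - 75 * f ^ 2 := by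
  have hb2 := sq_pos_of_ne_zero hb0
  wlog ha : 0 < a generalizing a
  · refine this (a := -a) hab.neg_left (by linear_combination h₁) (by linear_combination h₂) ?_
    rcases lt_trichotomy a 0 with h | h | h
    · omega
    · subst h; nlinarith [sq_nonneg u]
    · exact absurd h ha
  wlog hv : 0 < v generalizing v
  · refine this (v := -v) (by linear_combination h₂) ?_
    rcases lt_trichotomy v 0 with h | h | h
    · omega
    · subst h; nlinarith
    · exact absurd h hv
  have h3 : ¬ 3 ∣ a := by
    intro h
    refine hab.not_common_dvd (p := 3) (by norm_num) h ?_
    have : 9 ∣ a ^ 2 := by obtain ⟨m, rfl⟩ := h; exact ⟨m ^ 2, by ring⟩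
    have := Int.sq_mod_three_cases v
    have := Int.sq_mod_three_cases b
    omega
  have h5 : ¬ 5 ∣ a := by
    intro h
    refine hab.not_common_dvd (p := 5) (by norm_num) h ?_
    have : 25 ∣ a ^ 2 := by obtain ⟨m, rfl⟩ := h; exact ⟨m ^ 2, by ring⟩
    have := Int.sq_mod_five_cases u
    have := Int.sq_mod_five_cases b
    omega
  have hodd := hab.odd_or_odd
  have ha4 := Int.sq_mod_two_cases a
  have hb4 := Int.sq_mod_two_cases b
  have hu4 := Int.sq_mod_two_cases u
  have hv4 := Int.sq_mod_two_cases v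
  have hpos : 0 < a + u ∧ 0 < a - u := by
    have := abs_lt_of_sq_lt_sq (show u ^ 2 < a ^ 2 by linarith) ha.le
    rw [abs_lt] at this
    omega
  have hpos' : 0 < v - a := by
    have := lt_of_pow_lt_pow_left₀ 2 hv.le (show a ^ 2 < v ^ 2 by linarith)
    omega
  rcases Int.even_or_odd b with hb | hb
  · obtain ⟨c, rfl⟩ := hb.two_dvd
    obtain ⟨A, hA⟩ : ∃ A, a + u = 2 * A := ⟨(a + u) / 2, by omega⟩
    obtain ⟨B, hB⟩ : ∃ B, v + a = 2 * B := ⟨(v + a) / 2, by omega⟩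
    obtain rfl : u = 2 * A - a := by linarith
    obtain rfl : v = 2 * B - a := by linarith
    obtain ⟨r, s, e, f, h⟩ := seventyFive_descent (m := a) (c := c) (A := A) (A' := a - A)
      (B := B) (B' := B - a) (by omega) (by omega) (by omega) (by omega) (by omega) (by linarith)
      (by omega) (by linarith) (by omega) h3 h5 hab.of_mul_right_right
    exact ⟨c, r, s, e, f, right_ne_zero_of_mul hb0, Dvd.intro_left _ rfl, h⟩
  · rw [Int.odd_iff] at hb
    have hcop : IsCoprime (2 * a) b := by
      refine IsCoprime.mul_left ?_ hab
      exact (Int.prime_two.coprime_iff_not_dvd.2 (by omega))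
    obtain ⟨r, s, e, f, h⟩ := seventyFive_descent (m := 2 * a) (c := b) (A := a + u) (A' := a - u)
      (B := v + a) (B' := v - a) (by omega) (by omega) (by omega) (by omega) (by omega)
      (by linarith) (by omega) (by linarith) (by omega) (by omega) (by omega) hcop
    exact ⟨b, r, s, e, f, hb0, dvd_rfl, h⟩

/-- `a² - 5b²` and `a² + 75b²` are both squares only for `b = 0`. -/
theorem concordant_seventyFive {a b u v : ℤ} (hab : IsCoprime a b)
    (h₁ : a ^ 2 - 5 * b ^ 2 = u ^ 2) (h₂ : a ^ 2 + 75 * b ^ 2 = v ^ 2) : b = 0 := by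
  induction hn : b.natAbs using Nat.strong_induction_on generalizing a b u v with
  | _ n ih =>
  by_contra hb0
  obtain ⟨c, r, s, e, f, hc0, hcb, hrs, hef, hcop, hsum⟩ : ∃ c r s e f : ℤ, c ≠ 0 ∧ c ∣ b ∧
      r * s = c ∧ e * f = c ∧ IsCoprime r s ∧ r ^ 2 + 5 * s ^ 2 = e ^ 2 - 75 * f ^ 2 := by
    clear ih
    exact seventyFive_start hab hb0 h₁ h₂
  have hr0 : r ≠ 0 := by rintro rfl; simp at hrs; exact hc0 hrs.symm
  obtain ⟨α, β, γ, δ, rfl, rfl, rfl, rfl⟩ := exists_fourNumber hr0 (hrs.trans hef.symm)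
  obtain ⟨hα, hβ⟩ := mul_ne_zero_iff.1 hr0
  have hγδ : γ * δ ≠ 0 := by intro h; rw [h] at hrs; simp at hrs; exact hc0 hrs.symm
  obtain ⟨hγ, hδ⟩ := mul_ne_zero_iff.1 hγδ
  have hαδ : IsCoprime α δ := hcop.of_mul_left_left.of_mul_right_right
  have hβγ : IsCoprime β γ := hcop.of_mul_left_right.of_mul_right_left
  obtain ⟨k, hk₁, hk₂⟩ := exists_smul_of_mul_eq_mul (s := α ^ 2 - 5 * δ ^ 2)
    (t := α ^ 2 + 75 * δ ^ 2)
    (pow_ne_zero 2 hγ) (hβγ.symm.pow (m := 2) (n := 2)) (by linear_combination -hsum)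
  have hk80 : k ∣ 80 := dvd_of_dvd_mul_sq hαδ
    ⟨75 * β ^ 2 + 5 * γ ^ 2, by linear_combination 75 * hk₁ + 5 * hk₂⟩
    ⟨γ ^ 2 - β ^ 2, by linear_combination hk₂ - hk₁⟩
  have hk0 : 0 < k := by
    have : 0 < k * γ ^ 2 := by rw [← hk₂]; positivity
    exact pos_of_mul_pos_left this (sq_nonneg _)
  obtain ⟨j, rfl⟩ := eighty_split hαδ hk0 hk80 hk₁ hk₂
  -- `α² ≥ 5δ²` gives `|δ| < |α|`, so `|αδ| ≤ |b|` yields `|δ| < |b|`.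
  have hlt : δ.natAbs < α.natAbs := by
    rw [Int.natAbs_lt_iff_sq_lt]
    nlinarith [mul_nonneg hk0.le (sq_nonneg β), sq_pos_of_ne_zero hδ]
  have hle : (α * δ).natAbs ≤ b.natAbs :=
    Int.natAbs_le_of_dvd hb0 (dvd_trans ⟨β * γ, by rw [← hrs]; ring⟩ hcb)
  rw [Int.natAbs_mul] at hle
  have hδ1 := Int.natAbs_pos.2 hδ
  exact hδ (ih δ.natAbs (by nlinarith) hαδ (u := j * β) (v := j * γ)
    (by linear_combination hk₁) (by linear_combination hk₂) rfl)

/-! ### Descent for `mn = x² + w²`, `m² - n² = xw`. -/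

theorem eq_one_or_seventeen {α β δ k A B : ℤ} (hk : k ∣ 17) (hα : α ≠ 0)
    (h : A * α ^ 2 + B * δ ^ 2 = k * β ^ 2) (hA : 0 < A) (hB : 0 < B) : k = 1 ∨ k = 17 := by
  have hk0 : 0 < k := by
    have : 0 < k * β ^ 2 := by rw [← h]; positivity
    exact pos_of_mul_pos_left this (sq_nonneg _)
  have hle : k ≤ 17 := Int.le_of_dvd (by norm_num) hk
  clear h
  interval_cases k <;> omega

theorem isCoprime_sq_add_sq_mul {x w : ℤ} (h : IsCoprime x w) :
    IsCoprime (x ^ 2 + w ^ 2) (x * w) := by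
  refine IsCoprime.mul_right ?_ ?_
  · rw [show x ^ 2 + w ^ 2 = w ^ 2 + x * x by ring]
    exact IsCoprime.add_mul_right_left_iff.2 h.symm.pow_left
  · rw [show x ^ 2 + w ^ 2 = x ^ 2 + w * w by ring]
    exact IsCoprime.add_mul_right_left_iff.2 h.pow_left

theorem isCoprime_mul_sq_sub_sq {x w : ℤ} (h : IsCoprime x w) :
    IsCoprime (x * w) (x ^ 2 - w ^ 2) := by
  refine IsCoprime.symm (IsCoprime.mul_right ?_ ?_)
  · rw [show x ^ 2 - w ^ 2 = -w ^ 2 + x * x by ring]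
    exact IsCoprime.add_mul_right_left_iff.2 h.symm.pow_left.neg_left
  · rw [show x ^ 2 - w ^ 2 = x ^ 2 + (-w) * w by ring]
    exact IsCoprime.add_mul_right_left_iff.2 h.pow_left

/-- Refining `xw = (m - n)(m + n)` gives `δ² - 4α² = kγ²` and `α² + 4δ² = kβ²` with `k ∣ 17`. With
`α, β, δ` odd the second reads `5 ≡ k` modulo 8, while 1 and 17 are both `1`. -/
theorem seventeen_odd {x w m n : ℤ} (hxw : IsCoprime x w) (hx : x % 2 = 1) (hw : w % 2 = 1)
    (h₁ : m * n = x ^ 2 + w ^ 2) (h₂ : m ^ 2 - n ^ 2 = x * w) : False := by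
  have hx0 : x ≠ 0 := by omega
  obtain ⟨α, β, γ, δ, rfl, rfl, e₁, e₂⟩ := exists_fourNumber (a := x) (b := w) (c := m - n)
    (d := m + n) hx0 (by linear_combination -h₂)
  obtain ⟨hα, hβ⟩ := mul_ne_zero_iff.1 hx0
  have hβγ : IsCoprime β γ := hxw.of_mul_left_right.of_mul_right_left
  have hαδ : IsCoprime α δ := hxw.of_mul_left_left.of_mul_right_right
  obtain ⟨k, hk₁, hk₂⟩ := exists_smul_of_mul_eq_mul (s := δ ^ 2 - 4 * α ^ 2)
    (t := α ^ 2 + 4 * δ ^ 2) (pow_ne_zero 2 hβ) (hβγ.pow (m := 2) (n := 2))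
    (by linear_combination 4 * h₁ + (m - n + α * γ) * e₁ - (m + n + β * δ) * e₂)
  have hk17 : k ∣ 17 := dvd_of_dvd_mul_sq hαδ
    ⟨β ^ 2 - 4 * γ ^ 2, by linear_combination hk₂ - 4 * hk₁⟩
    ⟨γ ^ 2 + 4 * β ^ 2, by linear_combination hk₁ + 4 * hk₂⟩
  have hk := eq_one_or_seventeen hk17 hα (A := 1) (B := 4) (by rw [one_mul]; exact hk₂)
    one_pos (by norm_num)
  rw [← Int.odd_iff, Int.odd_mul, Int.odd_iff, Int.odd_iff] at hx hw
  have := Int.sq_mod_two_cases α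
  have := Int.sq_mod_two_cases β
  have := Int.sq_mod_two_cases δ
  obtain rfl | rfl := hk <;> omega

/-- Both equations are Pythagorean. The first gives `α = c² - d²`, `|δ| = c² + d²`; with `X = c +
d`, `W = c - d` the second has legs `XW` and `2(X² + W²)`, and parametrizing it yields a solution of
the original system with `X`, `W` odd. -/
theorem seventeen_unramified {α β γ δ : ℤ} (hαδ : IsCoprime α δ) (hα : α % 2 = 1)
    (h₁ : δ ^ 2 - α ^ 2 = γ ^ 2) (h₂ : α ^ 2 + 16 * δ ^ 2 = β ^ 2) : False := by
  have hα2 : 0 < α ^ 2 := sq_pos_of_ne_zero (by omega)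
  have hδ : δ ≠ 0 := by rintro rfl; nlinarith [sq_nonneg γ]
  have hβ : β ≠ 0 := by rintro rfl; nlinarith [sq_nonneg δ]
  have hαγ : IsCoprime α γ := by
    refine (IsCoprime.pow_right_iff (m := 2) two_pos).1 ?_
    rw [← h₁, show δ ^ 2 - α ^ 2 = δ ^ 2 + (-α) * α by ring]
    exact (IsCoprime.add_mul_right_right_iff).2 hαδ.pow_right
  obtain ⟨c, d, hc, hd, hcd, hgcd, hpar⟩ := PythagoreanTriple.coprime_classification'
    (x := α) (y := γ) (z := |δ|) (by
      rw [PythagoreanTriple, abs_mul_abs_self]; linear_combination -h₁)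
    (Int.isCoprime_iff_gcd_eq_one.1 hαγ) hα (abs_pos.2 hδ)
  have hδ2 : δ ^ 2 = (c ^ 2 + d ^ 2) ^ 2 := by rw [← hcd, sq_abs]
  have hodd : (c + d) % 2 = 1 ∧ (c - d) % 2 = 1 := by omega
  have hcop : IsCoprime (c + d) (c - d) := by
    have hcd : IsCoprime c d := Int.isCoprime_iff_gcd_eq_one.2 hgcd
    have h2 : IsCoprime (c + d) 2 := (Int.prime_two.coprime_iff_not_dvd.2 (by omega)).symm
    have : IsCoprime (c + d) ((c + d) * 1 + -(2 * d)) := by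
      rw [IsCoprime.mul_add_left_right_iff]
      refine (IsCoprime.mul_right h2 ?_).neg_right
      simpa using (IsCoprime.add_mul_left_left_iff (z := 1)).2 hcd
    convert this using 1; ring
  have hcop2 : IsCoprime ((c + d) * (c - d)) (2 * ((c + d) ^ 2 + (c - d) ^ 2)) := by
    refine IsCoprime.mul_right ?_ (isCoprime_sq_add_sq_mul hcop).symm
    refine (Int.prime_two.coprime_iff_not_dvd.2 fun h => ?_).symm
    rcases Int.prime_two.dvd_or_dvd h with h | h <;> omega
  obtain ⟨m, n, hm, hn, -⟩ := PythagoreanTriple.coprime_classification'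
    (x := (c + d) * (c - d)) (y := 2 * ((c + d) ^ 2 + (c - d) ^ 2)) (z := |β|) (by
      rw [PythagoreanTriple, abs_mul_abs_self]
      linear_combination h₂ - 16 * hδ2 - (α + (c ^ 2 - d ^ 2)) * hc)
    (Int.isCoprime_iff_gcd_eq_one.1 hcop2)
    (by rw [← Int.odd_iff, Int.odd_mul, Int.odd_iff, Int.odd_iff]; exact hodd) (abs_pos.2 hβ)
  exact seventeen_odd hcop hodd.1 hodd.2 (m := m) (n := n) (by linarith) hm.symm

/-- Here `|β|` is a leg of one Pythagorean triple and the hypotenuse of another: `|β| = c² - d² = p²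
+ q²`, with `γ = 2cd` and `4γ = 2pq`. Hence `M = c + d`, `N = c - d` solve the original system for
`(p, q)`. -/
theorem seventeen_ramified {α β γ δ : ℤ} (hβγ : IsCoprime β γ) (hβ : β % 2 = 1)
    (h₁ : δ ^ 2 = β ^ 2 + γ ^ 2) (h₂ : β ^ 2 = α ^ 2 + 16 * γ ^ 2) :
    ∃ p q M N : ℤ, IsCoprime p q ∧ p % 2 = 1 ∧ M * N = p ^ 2 + q ^ 2 ∧ M ^ 2 - N ^ 2 = p * q ∧
      p * q = 2 * γ := by
  have hβ0 : β ≠ 0 := by omega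
  have hβ2 := sq_pos_of_ne_zero hβ0
  have hδ : δ ≠ 0 := by rintro rfl; nlinarith [sq_nonneg γ]
  obtain ⟨c, d, hc, hd, -⟩ := PythagoreanTriple.coprime_classification'
    (x := |β|) (y := γ) (z := |δ|) (by
      rw [PythagoreanTriple, abs_mul_abs_self, abs_mul_abs_self]; linear_combination -h₁)
    (by rw [Int.gcd, Int.natAbs_abs]; exact Int.isCoprime_iff_gcd_eq_one.1 hβγ)
    (by rcases abs_choice β with h | h <;> omega) (abs_pos.2 hδ)
  have hα : α % 2 = 1 := by
    have := Int.sq_mod_two_cases α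
    have := Int.sq_mod_two_cases β
    omega
  have hcop : IsCoprime α (4 * γ) := by
    refine IsCoprime.mul_right ?_ ?_
    · rw [show (4 : ℤ) = 2 * 2 by norm_num]
      have : IsCoprime α 2 := (Int.prime_two.coprime_iff_not_dvd.2 (by omega)).symm
      exact this.mul_right this
    · refine (IsCoprime.pow_left_iff (m := 2) two_pos).1 ?_
      rw [show α ^ 2 = β ^ 2 + (-16 * γ) * γ by linear_combination -h₂]
      exact (IsCoprime.add_mul_right_left_iff).2 hβγ.pow_left
  obtain ⟨p, q, hp, hq, hpq, hgcd, hpar⟩ := PythagoreanTriple.coprime_classification'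
    (x := α) (y := 4 * γ) (z := |β|) (by
      rw [PythagoreanTriple, abs_mul_abs_self]; linear_combination -h₂)
    (Int.isCoprime_iff_gcd_eq_one.1 hcop) hα (abs_pos.2 hβ0)
  have key : ∀ p q : ℤ, IsCoprime p q → p % 2 = 1 → 4 * γ = 2 * p * q → |β| = p ^ 2 + q ^ 2 →
      ∃ p q M N : ℤ, IsCoprime p q ∧ p % 2 = 1 ∧ M * N = p ^ 2 + q ^ 2 ∧ M ^ 2 - N ^ 2 = p * q ∧
      p * q = 2 * γ := fun p q hcop hodd hq hpq =>
    ⟨p, q, c + d, c - d, hcop, hodd, by linear_combination hpq - hc, by linarith, by linarith⟩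
  rcases hpar with h | h
  · exact key q p (Int.isCoprime_iff_gcd_eq_one.2 hgcd).symm h.2 (by linarith) (by linarith)
  · exact key p q (Int.isCoprime_iff_gcd_eq_one.2 hgcd) h.1 hq hpq

/-- For `w = 4t`, refining `xt = ((m - n)/2)((m + n)/2)` gives `δ² - α² = kγ²`, `α² + 16δ² = kβ²`
with `k ∣ 17`. The case `k = 1` is impossible and `k = 17` produces a solution with the smaller
product `2γ`. -/
theorem seventeen_step {x w m n : ℤ} (hxw : IsCoprime x w) (hx : x % 2 = 1)
    (h₁ : m * n = x ^ 2 + w ^ 2) (h₂ : m ^ 2 - n ^ 2 = x * w) (hw : w ≠ 0) :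
    ∃ p q M N : ℤ, IsCoprime p q ∧ p % 2 = 1 ∧ M * N = p ^ 2 + q ^ 2 ∧ M ^ 2 - N ^ 2 = p * q ∧
      (p * q).natAbs < (x * w).natAbs ∧ q ≠ 0 := by
  have hw2 : w % 2 = 0 := by
    by_contra h
    exact seventeen_odd hxw hx (by omega) h₁ h₂
  have hx0 : x ≠ 0 := by omega
  have hmn : m % 2 = 1 ∧ n % 2 = 1 := by
    rw [← Int.odd_iff, ← Int.odd_iff, ← Int.odd_mul, h₁, Int.odd_iff]
    have := Int.sq_mod_two_cases x
    have := Int.sq_mod_two_cases w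
    omega
  obtain ⟨t, rfl⟩ : 4 ∣ w := by
    have hm := Int.sq_mod_two_cases m
    have hn := Int.sq_mod_two_cases n
    have h2 : IsCoprime (4 : ℤ) x := by
      rw [show (4 : ℤ) = 2 * 2 by norm_num]
      have : IsCoprime 2 x := Int.prime_two.coprime_iff_not_dvd.2 (by omega)
      exact this.mul_left this
    exact h2.dvd_of_dvd_mul_left (by omega)
  have ht : t ≠ 0 := right_ne_zero_of_mul hw
  obtain ⟨M, hM⟩ : ∃ M, m + n = 2 * M := ⟨(m + n) / 2, by omega⟩
  obtain rfl : n = 2 * M - m := by linarith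
  obtain ⟨α, β, γ, δ, rfl, rfl, e₁, e₂⟩ := exists_fourNumber (a := x) (b := t) (c := m - M)
    (d := M) hx0 (by linarith)
  obtain rfl : m = α * γ + M := by linarith
  subst e₂
  obtain ⟨hα, hβ⟩ := mul_ne_zero_iff.1 hx0
  obtain ⟨hγ, hδ⟩ := mul_ne_zero_iff.1 ht
  have hxt : IsCoprime (α * β) (γ * δ) := hxw.of_mul_right_right
  have hβγ : IsCoprime β γ := hxt.of_mul_left_right.of_mul_right_left
  have hαδ : IsCoprime α δ := hxt.of_mul_left_left.of_mul_right_right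
  obtain ⟨k, hk₁, hk₂⟩ := exists_smul_of_mul_eq_mul (s := δ ^ 2 - α ^ 2)
    (t := α ^ 2 + 16 * δ ^ 2) (pow_ne_zero 2 hβ) (hβγ.pow (m := 2) (n := 2))
    (by linear_combination h₁)
  have hk17 : k ∣ 17 := dvd_of_dvd_mul_sq hαδ
    ⟨β ^ 2 - 16 * γ ^ 2, by linear_combination hk₂ - 16 * hk₁⟩
    ⟨γ ^ 2 + β ^ 2, by linear_combination hk₁ + hk₂⟩
  rw [← Int.odd_iff, Int.odd_mul, Int.odd_iff, Int.odd_iff] at hx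
  obtain rfl | rfl := eq_one_or_seventeen hk17 hα (A := 1) (B := 16)
    (by rw [one_mul]; exact hk₂) one_pos (by norm_num)
  · exact (seventeen_unramified (β := β) (γ := γ) hαδ hx.1 (by linarith) (by linarith)).elim
  · obtain ⟨p, q, M, N, hpq, hp, h₃, h₄, h₅⟩ := seventeen_ramified (α := α) (δ := δ) hβγ hx.2
      (by linarith) (by linarith)
    refine ⟨p, q, M, N, hpq, hp, h₃, h₄, ?_, ?_⟩
    · have hle : γ.natAbs ≤ (α * β * (γ * δ)).natAbs :=
        Int.natAbs_le_of_dvd (mul_ne_zero hx0 ht) ⟨α * β * δ, by ring⟩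
      rw [h₅, show α * β * (4 * (γ * δ)) = 4 * (α * β * (γ * δ)) by ring]
      omega
    · rintro rfl
      rw [mul_zero] at h₅
      omega

theorem seventeen_curve {x w m n : ℤ} (hxw : IsCoprime x w)
    (h₁ : m * n = x ^ 2 + w ^ 2) (h₂ : m ^ 2 - n ^ 2 = x * w) : x * w = 0 := by
  have key : ∀ N : ℕ, ∀ x w m n : ℤ, (x * w).natAbs = N → IsCoprime x w → x % 2 = 1 →
      m * n = x ^ 2 + w ^ 2 → m ^ 2 - n ^ 2 = x * w → w = 0 := by
    intro N
    induction N using Nat.strong_induction_on with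
    | _ N ih =>
    intro x w m n hN hxw hx h₁ h₂
    by_contra hw
    obtain ⟨p, q, M, N', hpq, hp, h₃, h₄, hlt, hq⟩ := seventeen_step hxw hx h₁ h₂ hw
    exact hq (ih _ (hN ▸ hlt) p q M N' rfl hpq hp h₃ h₄)
  rcases hxw.odd_or_odd with h | h
  · rw [key _ x w m n rfl hxw h h₁ h₂, mul_zero]
  · rw [key _ w x m n rfl hxw.symm h (by linarith) (by linarith), zero_mul]

/-! ### Square values of the second quartic. -/

/-- The integral form of `z² = 5q⁴ - 8q³ + 6q² + 8q + 5`. -/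
def quarticForm (a b : ℤ) : ℤ :=
  5 * a ^ 4 - 8 * a ^ 3 * b + 6 * a ^ 2 * b ^ 2 + 8 * a * b ^ 3 + 5 * b ^ 4

theorem quarticForm_eq (a b : ℤ) :
    quarticForm a b = (a ^ 2 - 4 * a * b - b ^ 2) ^ 2 + (2 * (a ^ 2 - b ^ 2)) ^ 2 := by
  rw [quarticForm]; ring

/-- The form is a sum of two coprime squares whose even leg is `2(a² - b²) = 2mn`. The Pythagorean
parameters `m, n` have opposite parity, yet `a² - b²` is odd. -/
theorem quarticForm_ne_sq_of_odd {a b z : ℤ} (hab : IsCoprime a b) (hodd : (a + b) % 2 = 1)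
    (h : quarticForm a b = z ^ 2) : False := by
  rw [quarticForm_eq] at h
  have hodd' : (a ^ 2 - b ^ 2) % 2 = 1 := by
    have := Int.sq_mod_two_cases a
    have := Int.sq_mod_two_cases b
    omega
  have hA : (a ^ 2 - 4 * a * b - b ^ 2) % 2 = 1 := by
    rw [show a ^ 2 - 4 * a * b - b ^ 2 = (a ^ 2 - b ^ 2) + 2 * (-2 * (a * b)) by ring]; omega
  have hz : z ≠ 0 := by
    rintro rfl
    have : a ^ 2 - 4 * a * b - b ^ 2 = 0 := by
      rw [← pow_eq_zero_iff two_ne_zero]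
      linarith [sq_nonneg (2 * (a ^ 2 - b ^ 2)), sq_nonneg (a ^ 2 - 4 * a * b - b ^ 2)]
    omega
  have h2 : ∀ x : ℤ, x % 2 = 1 → IsCoprime x 2 := fun x hx =>
    (Int.prime_two.coprime_iff_not_dvd.2 (by omega)).symm
  have hcop : IsCoprime (a ^ 2 - 4 * a * b - b ^ 2) (2 * (a ^ 2 - b ^ 2)) := by
    refine IsCoprime.mul_right (h2 _ hA) ?_
    rw [show a ^ 2 - 4 * a * b - b ^ 2 = -(2 * 2 * (a * b)) + 1 * (a ^ 2 - b ^ 2) by ring]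
    refine (IsCoprime.add_mul_right_left_iff).2 (IsCoprime.mul_left ?_ ?_).neg_left
    · exact (h2 _ hodd').symm.mul_left (h2 _ hodd').symm
    · exact isCoprime_mul_sq_sub_sq hab
  obtain ⟨m, n, hm, hn, -, -, hpar⟩ := PythagoreanTriple.coprime_classification'
    (x := a ^ 2 - 4 * a * b - b ^ 2) (y := 2 * (a ^ 2 - b ^ 2)) (z := |z|) (by
      rw [PythagoreanTriple, abs_mul_abs_self]; linear_combination h)
    (Int.isCoprime_iff_gcd_eq_one.1 hcop) hA (abs_pos.2 hz)
  have : (m * n) % 2 = 1 := by rw [show m * n = a ^ 2 - b ^ 2 by linarith]; exact hodd'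
  rw [← Int.odd_iff, Int.odd_mul, Int.odd_iff, Int.odd_iff] at this
  omega

/-- The quartic form takes square values at coprime integers only for `a² = b²`. -/
theorem sq_eq_sq_of_quarticForm {a b z : ℤ} (hab : IsCoprime a b)
    (h : quarticForm a b = z ^ 2) : a ^ 2 = b ^ 2 := by
  by_cases hodd : (a + b) % 2 = 1
  · exact (quarticForm_ne_sq_of_odd hab hodd h).elim
  -- For `a = c + d`, `b = c - d` the form is 16 times a sum of two coprime squares, with even leg
  -- `2cd`.
  obtain ⟨c, hc⟩ : ∃ c, a + b = 2 * c := ⟨(a + b) / 2, by omega⟩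
  obtain ⟨d, rfl⟩ : ∃ d, a = c + d := ⟨a - c, by ring⟩
  obtain rfl : b = c - d := by linarith
  suffices c * d = 0 by linear_combination 4 * this
  by_contra hcd0
  have hcd : IsCoprime c d := by
    obtain ⟨m, n, hmn⟩ := hab
    exact ⟨m + n, m - n, by linear_combination hmn⟩
  have hcd2 : (c + d) % 2 = 1 := by
    rcases hab.odd_or_odd with h | h <;> omega
  have hc2 := Int.sq_mod_two_cases c
  have hd2 := Int.sq_mod_two_cases d
  have hcdeven : c * d % 2 = 0 := by
    rw [← Int.even_iff, Int.even_mul, Int.even_iff, Int.even_iff]; omega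
  have hX : (c * d - (c ^ 2 - d ^ 2)) % 2 = 1 := by omega
  have hsq : (4 : ℤ) ^ 2 ∣ z ^ 2 := by
    rw [← h, quarticForm_eq]
    exact ⟨(c * d - (c ^ 2 - d ^ 2)) ^ 2 + (2 * (c * d)) ^ 2, by ring⟩
  obtain ⟨z, rfl⟩ := (Int.pow_dvd_pow_iff two_ne_zero).1 hsq
  have hz : (c * d - (c ^ 2 - d ^ 2)) ^ 2 + (2 * (c * d)) ^ 2 = z ^ 2 := by
    rw [quarticForm_eq] at h; linarith
  have hz0 : z ≠ 0 := by
    rintro rfl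
    have : 0 < (2 * (c * d)) ^ 2 := by positivity
    nlinarith [sq_nonneg (c * d - (c ^ 2 - d ^ 2))]
  have hcop : IsCoprime (c * d - (c ^ 2 - d ^ 2)) (2 * (c * d)) := by
    refine IsCoprime.mul_right (Int.prime_two.coprime_iff_not_dvd.2 (by omega)).symm ?_
    rw [show c * d - (c ^ 2 - d ^ 2) = -(c ^ 2 - d ^ 2) + 1 * (c * d) by ring]
    exact (IsCoprime.add_mul_right_left_iff).2 (isCoprime_mul_sq_sub_sq hcd).symm.neg_left
  obtain ⟨m, n, hm, hn, -, hgcd, -⟩ := PythagoreanTriple.coprime_classification'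
    (x := c * d - (c ^ 2 - d ^ 2)) (y := 2 * (c * d)) (z := |z|) (by
      rw [PythagoreanTriple, abs_mul_abs_self]; linear_combination hz)
    (Int.isCoprime_iff_gcd_eq_one.1 hcop) hX (abs_pos.2 hz0)
  -- Refining `cd = mn` turns the odd leg into `(β² + γ²)(α² - δ²) = αδ · βγ`. Both sides are
  -- products of coprime factors, so up to a sign `αδ = β² + γ²` and `α² - δ² = βγ`.
  obtain ⟨α, β, γ, δ, rfl, rfl, rfl, rfl⟩ := exists_fourNumber (left_ne_zero_of_mul hcd0)
    (show c * d = m * n by linarith)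
  have hβγ : IsCoprime β γ := hcd.of_mul_left_right.of_mul_right_left
  have hαδ : IsCoprime α δ := hcd.of_mul_left_left.of_mul_right_right
  have hβ : β ≠ 0 := by rintro rfl; simp at hcd0
  have hγ : γ ≠ 0 := by rintro rfl; simp at hcd0
  have hS : β ^ 2 + γ ^ 2 ≠ 0 := by positivity
  obtain ⟨k, hk₁, hk₂⟩ := exists_smul_of_mul_eq_mul hS (isCoprime_sq_add_sq_mul hβγ)
    (s := α ^ 2 - δ ^ 2) (t := α * δ) (by linear_combination -hm)
  have hk : IsUnit k := (isCoprime_mul_sq_sub_sq hαδ).isUnit_of_dvd' ⟨_, hk₂⟩ ⟨_, hk₁⟩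
  refine mul_ne_zero hβ hγ ?_
  obtain rfl | rfl := Int.isUnit_iff.1 hk
  · exact seventeen_curve hβγ (m := α) (n := δ) (by linarith) (by linarith)
  · exact seventeen_curve hβγ (m := -δ) (n := α) (by linarith) (by linarith)

/-! ### Rational points on `y² = F`, `z² = G` and `w² = FG`. -/

theorem exists_squarefree_mul_sq {P Q w : ℤ} (hP : 0 < P) (h : P * Q = w ^ 2) :
    ∃ d u v : ℤ, 0 < d ∧ Squarefree d ∧ P = d * u ^ 2 ∧ Q = d * v ^ 2 := by
  obtain ⟨d, u, hd, hu, hP', hsq⟩ := Nat.sq_mul_squarefree_of_pos (n := P.toNat) (by omega)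
  have hP2 : P = d * (u : ℤ) ^ 2 := by
    have : (P.toNat : ℤ) = P := Int.toNat_of_nonneg hP.le
    rw [← this, ← hP']; push_cast; ring
  have hsq' : Squarefree (d : ℤ) := Int.squarefree_natCast.2 hsq
  have hu0 : (u : ℤ) ≠ 0 := by exact_mod_cast hu.ne'
  have hd0 : (d : ℤ) ≠ 0 := by exact_mod_cast hd.ne'
  obtain ⟨w, rfl⟩ : (u : ℤ) ∣ w :=
    (Int.pow_dvd_pow_iff two_ne_zero).1 ⟨d * Q, by rw [← h, hP2]; ring⟩
  have h' : d * Q = w ^ 2 := by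
    apply mul_left_cancel₀ (pow_ne_zero 2 hu0)
    rw [hP2] at h
    linear_combination h
  obtain ⟨v, rfl⟩ : (d : ℤ) ∣ w := (hsq'.dvd_pow_iff_dvd two_ne_zero).1 ⟨Q, h'.symm⟩
  refine ⟨d, u, v, by exact_mod_cast hd, hsq', hP2, mul_left_cancel₀ hd0 ?_⟩
  linear_combination h'

theorem eq_one_or_two_of_squarefree {d : ℤ} (hd : 0 < d) (hsq : Squarefree d) {n : ℕ}
    (hn : n ≠ 0) (h : d ∣ 2 ^ n) : d = 1 ∨ d = 2 := by
  have := Int.le_of_dvd two_pos ((hsq.dvd_pow_iff_dvd hn).1 h)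
  omega

theorem not_forms_two {a b u : ℤ} (hab : IsCoprime a b) : a ^ 2 + 3 * b ^ 2 ≠ 2 * u ^ 2 := by
  intro h
  have : ¬ (3 ∣ a ∧ 3 ∣ b) := fun h => hab.not_common_dvd (by norm_num) h.1 h.2
  have := Int.sq_mod_three_cases a
  have := Int.sq_mod_three_cases b
  have := Int.sq_mod_three_cases u
  omega

theorem first_form_split {a b u d : ℤ} (hab : IsCoprime a b) (hd : 0 < d) (hd10 : d ∣ 10)
    (h : 5 * a ^ 2 - b ^ 2 = d * u ^ 2) : d = 1 ∨ d = 5 := by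
  have hle : d ≤ 10 := Int.le_of_dvd (by norm_num) hd10
  have : ¬ (5 ∣ a ∧ 5 ∣ b) := fun h => hab.not_common_dvd (by norm_num) h.1 h.2
  have := Int.sq_mod_five_cases a
  have := Int.sq_mod_five_cases b
  have := Int.sq_mod_five_cases u
  obtain rfl | rfl | rfl | rfl : d = 1 ∨ d = 2 ∨ d = 5 ∨ d = 10 := by
    clear h this
    interval_cases d <;> omega
  all_goals omega

theorem five_mul_sq_ne {a b : ℤ} (hab : IsCoprime a b) : 5 * a ^ 2 - b ^ 2 ≠ 0 := by
  intro h
  have : ¬ (5 ∣ a ∧ 5 ∣ b) := fun h => hab.not_common_dvd (by norm_num) h.1 h.2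
  have := Int.sq_mod_five_cases a
  have := Int.sq_mod_five_cases b
  omega

theorem quarticForm_pos {a b : ℤ} (hb : b ≠ 0) : 0 < quarticForm a b := by
  rw [quarticForm_eq]
  have h₁ := sq_nonneg (a ^ 2 - 4 * a * b - b ^ 2)
  have h₂ := sq_nonneg (2 * (a ^ 2 - b ^ 2))
  by_contra! hneg
  have e₁ : a ^ 2 - 4 * a * b - b ^ 2 = 0 := by rw [← pow_eq_zero_iff two_ne_zero]; linarith
  have e₂ : 2 * (a ^ 2 - b ^ 2) = 0 := by rw [← pow_eq_zero_iff two_ne_zero]; linarith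
  have e₃ : a * b = 0 := by linarith
  obtain rfl : a = 0 := (mul_eq_zero.1 e₃).resolve_right hb
  have := sq_pos_of_ne_zero hb
  omega

theorem sq_eq_sq_of_quarticE {a b w : ℤ} (hab : IsCoprime a b) (hb : b ≠ 0)
    (h : (5 * a ^ 2 - b ^ 2) * (a ^ 2 + 3 * b ^ 2) = w ^ 2) : a ^ 2 = b ^ 2 := by
  have hQ : 0 < a ^ 2 + 3 * b ^ 2 := by positivity
  obtain ⟨d, v, u, hd, hsq, hv, hu⟩ := exists_squarefree_mul_sq hQ ((mul_comm _ _).trans h)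
  -- Eliminating `b²` or `a²` from the two quadratic factors leaves `16a²` or `16b²`.
  have hd16 : d ∣ 2 ^ 4 := dvd_of_dvd_mul_sq hab
    ⟨3 * u ^ 2 + v ^ 2, by linear_combination 3 * hu + hv⟩
    ⟨5 * v ^ 2 - u ^ 2, by linear_combination 5 * hv - hu⟩
  obtain rfl | rfl := eq_one_or_two_of_squarefree hd hsq (by norm_num) hd16
  · exact sq_eq_sq_of_forms (by linarith) (by linarith : _ = v ^ 2)
  · exact (not_forms_two hab hv).elim

theorem sq_eq_sq_of_product {a b w : ℤ} (hab : IsCoprime a b) (hb : b ≠ 0)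
    (h : (5 * a ^ 2 - b ^ 2) * (a ^ 2 + 3 * b ^ 2) * quarticForm a b = w ^ 2) :
    a ^ 2 = b ^ 2 := by
  have hQ : 0 < a ^ 2 + 3 * b ^ 2 := by positivity
  have hG : 0 < quarticForm a b := quarticForm_pos hb
  obtain ⟨d, v, t, hd, hsq, hv, ht⟩ := exists_squarefree_mul_sq hQ
    (show (a ^ 2 + 3 * b ^ 2) * ((5 * a ^ 2 - b ^ 2) * quarticForm a b) = w ^ 2 by
      rw [← h]; ring)
  have hdb : IsCoprime d b := by
    have : IsCoprime (a ^ 2 + 3 * b ^ 2) b := by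
      rw [show a ^ 2 + 3 * b ^ 2 = a ^ 2 + (3 * b) * b by ring]
      exact (IsCoprime.add_mul_right_left_iff).2 hab.pow_left
    rw [hv] at this
    exact this.of_mul_left_left
  -- Modulo `a² + 3b²` one has `5a² - b² ≡ -16b²` and `quarticForm a b ≡ 32b³(a + b)`; multiplying
  -- by `a - b` replaces `a² - b²` by `-4b²`.
  have hd11 : d ∣ 2 ^ 11 * b ^ 7 := by
    have h₁ : d ∣ a ^ 2 + 3 * b ^ 2 := ⟨_, hv⟩
    have h₂ : d ∣ (5 * a ^ 2 - b ^ 2) * quarticForm a b := ⟨_, ht⟩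
    have h₃ := (h₂.mul_right (a - b)).sub (h₁.mul_right (25 * a ^ 5 - 65 * a ^ 4 * b
      - 10 * a ^ 3 * b ^ 2 + 218 * a ^ 2 * b ^ 3 + a * b ^ 4 - 681 * b ^ 5))
    unfold quarticForm at h₃
    ring_nf at h₃ ⊢
    exact h₃
  obtain rfl | rfl := eq_one_or_two_of_squarefree hd hsq (by norm_num)
    (hdb.pow_right.dvd_of_dvd_mul_right hd11)
  swap
  · exact (not_forms_two hab hv).elim
  have hP : 0 < 5 * a ^ 2 - b ^ 2 := by
    refine lt_of_le_of_ne ?_ (five_mul_sq_ne hab).symm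
    by_contra hneg
    nlinarith [sq_nonneg t]
  obtain ⟨d, x, y, hd, hsq, hx, hy⟩ := exists_squarefree_mul_sq hP (ht.trans (one_mul _))
  have hda : IsCoprime d a := by
    have : IsCoprime (5 * a ^ 2 - b ^ 2) a := by
      rw [show 5 * a ^ 2 - b ^ 2 = -b ^ 2 + (5 * a) * a by ring]
      exact (IsCoprime.add_mul_right_left_iff).2 hab.symm.pow_left.neg_left
    rw [hx] at this
    exact this.of_mul_left_left
  -- Modulo `5a² - b²` the quartic form is `32a³(5a + b)`, and `(5a + b)(5a - b) ≡ 20a²`.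
  have hd640 : d ∣ 640 * a ^ 5 := by
    have h₁ : d ∣ 5 * a ^ 2 - b ^ 2 := ⟨_, hx⟩
    have h₂ : d ∣ quarticForm a b := ⟨_, hy⟩
    have h₃ := (h₂.mul_right (5 * a - b)).sub (h₁.mul_right (5 * b ^ 3 - 17 * b ^ 2 * a
      - 9 * b * a ^ 2 - 123 * a ^ 3))
    unfold quarticForm at h₃
    ring_nf at h₃ ⊢
    exact h₃
  have hd10 : d ∣ 10 := by
    refine (hsq.dvd_pow_iff_dvd (n := 7) (by norm_num)).1 ?_
    exact (hda.pow_right.dvd_of_dvd_mul_right hd640).trans (by norm_num)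
  obtain rfl | rfl := first_form_split hab hd hd10 hx
  · exact sq_eq_sq_of_forms (by linarith : _ = x ^ 2) (by linarith : _ = v ^ 2)
  · exfalso
    -- In the remaining case `d = 5`, setting `b = 5c` gives `a² - 5c² = x²` and `a² + 75c² = v²`.
    obtain ⟨c, rfl⟩ : 5 ∣ b := by
      have := Int.sq_mod_five_cases b
      omega
    have := concordant_seventyFive (a := a) (b := c) hab.of_mul_right_right (u := x) (v := v)
      (by linarith) (by linarith)
    simp [this] at hb

theorem exists_int_sq {n : ℤ} {y : ℚ} (h : (n : ℚ) = y ^ 2) : ∃ w : ℤ, n = w ^ 2 := by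
  obtain ⟨w, hw⟩ := Rat.isSquare_intCast_iff.1 ⟨y, by rw [h, sq]⟩
  exact ⟨w, by rw [hw, sq]⟩

theorem rat_sq_eq_one {q : ℚ} (h : q.num ^ 2 = (q.den : ℤ) ^ 2) : q ^ 2 = 1 := by
  have hd : (q.den : ℚ) ≠ 0 := by exact_mod_cast q.den_nz
  have h' : (q.num : ℚ) ^ 2 = (q.den : ℚ) ^ 2 := by exact_mod_cast h
  rw [← Rat.num_div_den q, div_pow, h', div_self (pow_ne_zero 2 hd)]

theorem rat_isCoprime (q : ℚ) : IsCoprime q.num (q.den : ℤ) :=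
  Int.isCoprime_iff_gcd_eq_one.2 q.reduced

theorem rat_den_ne (q : ℚ) : (q.den : ℤ) ≠ 0 := by exact_mod_cast q.den_nz

theorem rat_mul_den (q : ℚ) : q * q.den = q.num := Rat.mul_den_eq_num q

/-- Rational points on `y² = (5q² - 1)(q² + 3)`. -/
theorem rational_first {q y : ℚ} (h : y ^ 2 = (5 * q ^ 2 - 1) * (q ^ 2 + 3)) : q ^ 2 = 1 := by
  apply rat_sq_eq_one
  obtain ⟨w, hw⟩ := exists_int_sq (n := (5 * q.num ^ 2 - q.den ^ 2) * (q.num ^ 2 + 3 * q.den ^ 2))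
    (y := y * q.den ^ 2) (by
      push_cast
      rw [← rat_mul_den, mul_pow, mul_pow, h]; ring)
  exact sq_eq_sq_of_quarticE (rat_isCoprime q) (rat_den_ne q) hw

/-- Rational points on `z² = 5q⁴ - 8q³ + 6q² + 8q + 5`. -/
theorem rational_second {q z : ℚ}
    (h : z ^ 2 = 5 * q ^ 4 - 8 * q ^ 3 + 6 * q ^ 2 + 8 * q + 5) : q ^ 2 = 1 := by
  apply rat_sq_eq_one
  obtain ⟨w, hw⟩ := exists_int_sq (n := quarticForm q.num q.den)
    (y := z * q.den ^ 2) (by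
      rw [quarticForm]
      push_cast
      rw [← rat_mul_den]; linear_combination -(q.den : ℚ) ^ 4 * h)
  exact sq_eq_sq_of_quarticForm (rat_isCoprime q) hw

/-- Affine rational points on `w² = (5q² - 1)(q² + 3)(5q⁴ - 8q³ + 6q² + 8q + 5)`. -/
theorem rational_product {q w : ℚ} (h : w ^ 2 = (5 * q ^ 2 - 1) * (q ^ 2 + 3) *
    (5 * q ^ 4 - 8 * q ^ 3 + 6 * q ^ 2 + 8 * q + 5)) : q ^ 2 = 1 := by
  apply rat_sq_eq_one
  obtain ⟨w, hw⟩ := exists_int_sq (n := (5 * q.num ^ 2 - q.den ^ 2) *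
      (q.num ^ 2 + 3 * q.den ^ 2) * quarticForm q.num q.den)
    (y := w * q.den ^ 4) (by
      rw [quarticForm]
      push_cast
      rw [← rat_mul_den]; linear_combination -(q.den : ℚ) ^ 8 * h)
  exact sq_eq_sq_of_product (rat_isCoprime q) (rat_den_ne q) hw

/-! ### Parabolas through a rational point of a quartic curve. -/

/-- The points at infinity of both quartic curves are irrational, so a rational parabola meets them
in four affine points. -/
theorem five_sub_sq_ne (l : ℚ) : 5 - l ^ 2 ≠ 0 := by
  intro h
  obtain ⟨w, hw⟩ := exists_int_sq (n := 5) (y := l) (by push_cast; linarith)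
  have := Int.sq_mod_three_cases w
  omega

/-- If the line `y = a + bx` cuts the curve `y² = H(x)`, `H` a quartic with leading coefficient `5`
and `H(1) = 16`, in the zeros of `x² + Bx + C`, then so does a parabola through the point `(1, 4)`,
and the fourth point of intersection of the parabola with the curve is rational. -/
theorem exists_parabola {h₃ h₂ h₁ h₀ a b B C n₁ n₀ : ℚ} (hm : 1 + B + C ≠ 0)
    (hR : 5 + h₃ + h₂ + h₁ + h₀ = 16)
    (hrat : ∀ x y : ℚ, y ^ 2 = 5 * x ^ 4 + h₃ * x ^ 3 + h₂ * x ^ 2 + h₁ * x + h₀ → x ^ 2 = 1)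
    (hn : ∀ x : ℚ, 5 * x ^ 4 + h₃ * x ^ 3 + h₂ * x ^ 2 + h₁ * x + h₀ - (a + b * x) ^ 2 =
      (x ^ 2 + B * x + C) * (5 * x ^ 2 + n₁ * x + n₀)) :
    ∃ l P x₀ : ℚ, (x₀ = 1 ∨ x₀ = -1) ∧
      ∀ x : ℚ, 5 * x ^ 4 + h₃ * x ^ 3 + h₂ * x ^ 2 + h₁ * x + h₀ -
        (4 + P * (x - 1) + l * (x - 1) ^ 2) ^ 2 =
        (5 - l ^ 2) * (x - 1) * (x - x₀) * (x ^ 2 + B * x + C) := by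
  -- The parabola is `y = a + bx + l(x² + Bx + C)`, which agrees with the line at the roots of the
  -- minimal polynomial; `l` makes it pass through `(1, 4)`.
  obtain ⟨l, hl⟩ : ∃ l : ℚ, a + b + l * (1 + B + C) = 4 :=
    ⟨(4 - a - b) / (1 + B + C), by field_simp; ring⟩
  have hu := five_sub_sq_ne l
  obtain ⟨x₀, hx₀⟩ : ∃ x₀ : ℚ, (5 - l ^ 2) * x₀ = n₀ - 2 * l * a - l ^ 2 * C :=
    ⟨(n₀ - 2 * l * a - l ^ 2 * C) / (5 - l ^ 2), by field_simp⟩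
  -- The complementary quadratic factor vanishes at `1`; the other root, by the product of roots, is
  -- `x₀`.
  have hr : (5 - l ^ 2) + (n₁ - 2 * l * b - l ^ 2 * B) + (n₀ - 2 * l * a - l ^ 2 * C) = 0 := by
    apply mul_left_cancel₀ hm
    linear_combination -hn 1 + hR - (4 + (a + b + l * (1 + B + C))) * hl
  have key : ∀ x : ℚ, 5 * x ^ 4 + h₃ * x ^ 3 + h₂ * x ^ 2 + h₁ * x + h₀ -
      (4 + (b + l * (2 + B)) * (x - 1) + l * (x - 1) ^ 2) ^ 2 =
      (5 - l ^ 2) * (x - 1) * (x - x₀) * (x ^ 2 + B * x + C) := by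
    intro x
    have hp : 4 + (b + l * (2 + B)) * (x - 1) + l * (x - 1) ^ 2 =
        a + b * x + l * (x ^ 2 + B * x + C) := by linear_combination -hl
    rw [hp]
    linear_combination hn x + (x ^ 2 + B * x + C) * x * hr +
      (x ^ 2 + B * x + C) * (x - 1) * hx₀
  refine ⟨l, _, x₀, ?_, key⟩
  have hx : x₀ ^ 2 = 1 ^ 2 := by
    rw [one_pow]
    exact hrat x₀ (4 + (b + l * (2 + B)) * (x₀ - 1) + l * (x₀ - 1) ^ 2)
      (by linear_combination -key x₀)
  exact sq_eq_sq_iff_eq_or_eq_neg.1 hx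

theorem first_conic {a b B C n₁ n₀ : ℚ} (hm : 1 + B + C ≠ 0)
    (hn : ∀ x : ℚ, 5 * x ^ 4 + 0 * x ^ 3 + 14 * x ^ 2 + 0 * x + -3 - (a + b * x) ^ 2 =
      (x ^ 2 + B * x + C) * (5 * x ^ 2 + n₁ * x + n₀)) :
    B = 0 ∨ 8 * (1 + C) = 5 * (1 + C) ^ 2 - B ^ 2 := by
  obtain ⟨l, P, x₀, hx₀, h⟩ := exists_parabola hm (by norm_num)
    (fun x y h => rational_first (h.trans (by ring))) hn
  have hu := five_sub_sq_ne l
  have e₀ := h 0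
  have e₁ := h (-1)
  have e₂ := h 2
  -- For `x₀ = 1` the parabola is tangent to the curve at `(1, 4)`, which fixes its slope `P`. For
  -- `x₀ = -1` it passes through `(-1, 4)` or `(-1, -4)`, that is `P = 2l` or `P = 2l + 4`. The
  -- coefficients `B`, `C` are then rational functions of `l`, and `l` is eliminated.
  obtain rfl | rfl := hx₀
  · obtain rfl : P = 6 := by linarith
    right
    apply mul_left_cancel₀ (pow_ne_zero 2 hu)
    have hC : (5 - l ^ 2) * C = -7 + 4 * l - l ^ 2 := by linarith
    have hB : (5 - l ^ 2) * B = 10 - 12 * l + 2 * l ^ 2 := by linarith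
    linear_combination (8 * (5 - l ^ 2) - 5 * (2 * (5 - l ^ 2) + (5 - l ^ 2) * C + (-7 + 4 * l - l ^ 2))) * hC +
      ((5 - l ^ 2) * B + (10 - 12 * l + 2 * l ^ 2)) * hB
  · have hP : (P - 2 * l) * (P - 2 * l - 4) = 0 := by linarith
    rcases mul_eq_zero.1 hP with hP | hP
    · left
      obtain rfl : P = 2 * l := by linarith
      have hB : (5 - l ^ 2) * B = 0 := by linarith
      exact (mul_eq_zero.1 hB).resolve_left hu
    · right
      obtain rfl : P = 2 * l + 4 := by linarith
      have hC : (5 - l ^ 2) * C = 3 + l ^ 2 := by linarith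
      have hB : (5 - l ^ 2) * B = -8 * l := by linarith
      apply mul_left_cancel₀ (pow_ne_zero 2 hu)
      linear_combination (8 * (5 - l ^ 2) - 5 * (2 * (5 - l ^ 2) + (5 - l ^ 2) * C + (3 + l ^ 2))) * hC +
      ((5 - l ^ 2) * B + (-8 * l)) * hB

theorem second_conic {a b B C n₁ n₀ : ℚ} (hm : 1 + B + C ≠ 0)
    (hn : ∀ x : ℚ, 5 * x ^ 4 + -8 * x ^ 3 + 6 * x ^ 2 + 8 * x + 5 - (a + b * x) ^ 2 =
      (x ^ 2 + B * x + C) * (5 * x ^ 2 + n₁ * x + n₀)) :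
    1 + C = 0 ∨ (1 + C) ^ 2 + 4 * (1 + C) * B - B ^ 2 - 8 * B = 0 := by
  obtain ⟨l, P, x₀, hx₀, h⟩ := exists_parabola hm (by norm_num)
    (fun x y h => rational_second (h.trans (by ring))) hn
  have hu := five_sub_sq_ne l
  have e₀ := h 0
  have e₁ := h (-1)
  have e₂ := h 2
  -- Tangency at `(1, 4)`, or passage through `(-1, 4)` or `(-1, -4)`.
  obtain rfl | rfl := hx₀
  · obtain rfl : P = 2 := by linarith
    right
    apply mul_left_cancel₀ (pow_ne_zero 2 hu)
    have hC : (5 - l ^ 2) * C = 1 - 4 * l - l ^ 2 := by linarith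
    have hB : (5 - l ^ 2) * B = 2 - 4 * l + 2 * l ^ 2 := by linarith
    linear_combination (2 * (5 - l ^ 2) + (5 - l ^ 2) * C + (1 - 4 * l - l ^ 2) + 4 * (2 - 4 * l + 2 * l ^ 2)) * hC +
      (4 * ((5 - l ^ 2) + (5 - l ^ 2) * C) - ((5 - l ^ 2) * B + (2 - 4 * l + 2 * l ^ 2)) - 8 * (5 - l ^ 2)) * hB
  · have hP : (P - 2 * l) * (P - 2 * l - 4) = 0 := by linarith
    rcases mul_eq_zero.1 hP with hP | hP
    · right
      obtain rfl : P = 2 * l := by linarith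
      have hC : (5 - l ^ 2) * C = 11 - 8 * l + l ^ 2 := by linarith
      have hB : (5 - l ^ 2) * B = -8 := by linarith
      apply mul_left_cancel₀ (pow_ne_zero 2 hu)
      linear_combination (2 * (5 - l ^ 2) + (5 - l ^ 2) * C + (11 - 8 * l + l ^ 2) + 4 * (-8)) * hC +
      (4 * ((5 - l ^ 2) + (5 - l ^ 2) * C) - ((5 - l ^ 2) * B + (-8)) - 8 * (5 - l ^ 2)) * hB
    · left
      obtain rfl : P = 2 * l + 4 := by linarith
      have hC : (5 - l ^ 2) * (1 + C) = 0 := by linarith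
      exact (mul_eq_zero.1 hC).resolve_left hu

theorem no_common_conic {B C : ℚ} (h₁ : 1 + B + C ≠ 0) (h₂ : 1 - B + C ≠ 0)
    (hf : B = 0 ∨ 8 * (1 + C) = 5 * (1 + C) ^ 2 - B ^ 2)
    (hg : 1 + C = 0 ∨ (1 + C) ^ 2 + 4 * (1 + C) * B - B ^ 2 - 8 * B = 0) : False := by
  have hB : B ≠ 0 ∨ 1 + C ≠ 0 := by
    by_contra! h
    exact h₁ (by linarith)
  rcases hf with rfl | hf
  · rcases hg with hg | hg
    · exact h₁ (by linarith)
    · exact h₁ (by nlinarith [pow_eq_zero_iff (two_ne_zero (α := ℕ)) |>.1 (show (1 + C) ^ 2 = 0 by linarith)])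
  · rcases hg with hg | hg
    · rw [hg] at hf
      have : B = 0 := pow_eq_zero_iff (two_ne_zero (α := ℕ)) |>.1 (by linarith)
      exact h₁ (by linarith)
    -- The two conics meet only where `x² + Bx + C` has the root `1` or `-1`.
    · have : (1 + B + C) * (1 - B + C) ^ 2 = 0 := by
        linear_combination (1 + C) * hg + B * hf
      rcases mul_eq_zero.1 this with h | h
      · exact h₁ h
      · exact h₂ (pow_eq_zero_iff (two_ne_zero (α := ℕ)) |>.1 h)

/-! ### Points over fields of degree at most two. -/

theorem quartic_remainder {R : Type*} [CommRing R] {q a b B C h₃ h₂ h₁ h₀ : R}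
    (hm : q ^ 2 + B * q + C = 0)
    (hy : (a + b * q) ^ 2 = 5 * q ^ 4 + h₃ * q ^ 3 + h₂ * q ^ 2 + h₁ * q + h₀) :
    h₀ - a ^ 2 - C * (h₂ - b ^ 2 - 5 * C - B * (h₃ - 5 * B)) +
      (h₁ - 2 * a * b - C * (h₃ - 5 * B) - B * (h₂ - b ^ 2 - 5 * C - B * (h₃ - 5 * B))) * q = 0 := by
  linear_combination -hy - (5 * q ^ 2 + (h₃ - 5 * B) * q +
    (h₂ - b ^ 2 - 5 * C - B * (h₃ - 5 * B))) * hm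

section QuadraticField

variable {L : Type*} [Field L] [Algebra ℚ L]

theorem coeff_eq_zero {q : L} (hq : q ∉ Set.range (algebraMap ℚ L)) {s t : ℚ}
    (h : algebraMap ℚ L s + algebraMap ℚ L t * q = 0) : s = 0 ∧ t = 0 := by
  have ht : t = 0 := by
    by_contra ht
    refine hq ⟨-s / t, ?_⟩
    have : algebraMap ℚ L t ≠ 0 := (map_ne_zero _).2 ht
    rw [map_div₀, map_neg]
    field_simp
    linear_combination -h
  refine ⟨?_, ht⟩
  rw [ht, map_zero, zero_mul, add_zero] at h
  exact (map_eq_zero _).1 h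

theorem linearIndependent_one_self {q : L} (hq : q ∉ Set.range (algebraMap ℚ L)) :
    LinearIndependent ℚ ![1, q] := by
  rw [LinearIndependent.pair_iff]
  intro s t h
  rw [Algebra.smul_def, Algebra.smul_def, mul_one] at h
  exact coeff_eq_zero hq h

theorem exists_coordinates [FiniteDimensional ℚ L] (hL : Module.finrank ℚ L ≤ 2) {q : L}
    (hq : q ∉ Set.range (algebraMap ℚ L)) (y : L) :
    ∃ a b : ℚ, y = algebraMap ℚ L a + algebraMap ℚ L b * q := by
  have hli := linearIndependent_one_self hq
  have hcard : Fintype.card (Fin 2) = Module.finrank ℚ L :=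
    le_antisymm hli.fintype_card_le_finrank (by simpa using hL)
  have htop := hli.span_eq_top_of_card_eq_finrank' hcard
  have hy : y ∈ Submodule.span ℚ (Set.range ![1, q]) := by rw [htop]; trivial
  simp only [Matrix.range_cons, Matrix.range_empty, Set.union_empty, Set.singleton_union,
    Submodule.mem_span_pair] at hy
  obtain ⟨a, b, rfl⟩ := hy
  exact ⟨a, b, by rw [Algebra.smul_def, Algebra.smul_def, mul_one]⟩

/-- Write `y = a + bq`. The remainder of the quartic minus `(a + bx)²` on division by `x² + Bx + C`
vanishes at `q`, and `1, q` are independent over `ℚ`, so it is zero. -/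
theorem exists_factorization [FiniteDimensional ℚ L] (hL : Module.finrank ℚ L ≤ 2) {q y : L}
    (hq : q ∉ Set.range (algebraMap ℚ L)) {B C : ℚ}
    (hm : q ^ 2 + algebraMap ℚ L B * q + algebraMap ℚ L C = 0) {h₃ h₂ h₁ h₀ : ℚ}
    (hy : y ^ 2 = 5 * q ^ 4 + algebraMap ℚ L h₃ * q ^ 3 + algebraMap ℚ L h₂ * q ^ 2 +
      algebraMap ℚ L h₁ * q + algebraMap ℚ L h₀) :
    ∃ a b n₁ n₀ : ℚ, ∀ x : ℚ,
      5 * x ^ 4 + h₃ * x ^ 3 + h₂ * x ^ 2 + h₁ * x + h₀ - (a + b * x) ^ 2 =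
      (x ^ 2 + B * x + C) * (5 * x ^ 2 + n₁ * x + n₀) := by
  obtain ⟨a, b, rfl⟩ := exists_coordinates hL hq y
  have key := coeff_eq_zero hq
    (s := h₀ - a ^ 2 - C * (h₂ - b ^ 2 - 5 * C - B * (h₃ - 5 * B)))
    (t := h₁ - 2 * a * b - C * (h₃ - 5 * B) - B * (h₂ - b ^ 2 - 5 * C - B * (h₃ - 5 * B))) (by
      simp only [map_sub, map_mul, map_pow, map_ofNat]
      exact quartic_remainder hm hy)
  refine ⟨a, b, h₃ - 5 * B, h₂ - b ^ 2 - 5 * C - B * (h₃ - 5 * B), fun x => ?_⟩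
  linear_combination key.1 + x * key.2

theorem mem_range_of_points [FiniteDimensional ℚ L] (hL : Module.finrank ℚ L ≤ 2) {q y z : L}
    (hy : y ^ 2 = (5 * q ^ 2 - 1) * (q ^ 2 + 3))
    (hz : z ^ 2 = 5 * q ^ 4 - 8 * q ^ 3 + 6 * q ^ 2 + 8 * q + 5) :
    q ∈ Set.range (algebraMap ℚ L) := by
  by_contra hq
  obtain ⟨C, B, hm⟩ := exists_coordinates hL hq (-q ^ 2)
  obtain ⟨a, b, n₁, n₀, hf⟩ := exists_factorization hL hq (y := y) (B := B) (C := C)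
    (h₃ := 0) (h₂ := 14) (h₁ := 0) (h₀ := -3) (by linear_combination -hm) (by
      simp only [map_zero, map_neg, map_ofNat]; linear_combination hy)
  obtain ⟨a', b', n₁', n₀', hg⟩ := exists_factorization hL hq (y := z) (B := B) (C := C)
    (h₃ := -8) (h₂ := 6) (h₁ := 8) (h₀ := 5) (by linear_combination -hm) (by
      simp only [map_neg, map_ofNat]; linear_combination hz)
  -- A rational root `±1` of `x² + Bx + C` would make its other root rational too, and `q` is one of
  -- the two.
  have hroot : ∀ r : ℚ, r ^ 2 = 1 → 1 + B * r + C ≠ 0 := by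
    intro r hr h
    have h' := congrArg (algebraMap ℚ L) h
    have hr' := congrArg (algebraMap ℚ L) hr
    simp only [map_add, map_mul, map_one, map_zero, map_pow] at h' hr'
    have : (q - algebraMap ℚ L r) * (q + algebraMap ℚ L r + algebraMap ℚ L B) = 0 := by
      linear_combination -hm - h' - hr'
    rcases mul_eq_zero.1 this with h | h
    · exact hq ⟨r, by linear_combination -h⟩
    · exact hq ⟨-r - B, by rw [map_sub, map_neg]; linear_combination -h⟩
  have h₁ : 1 + B + C ≠ 0 := by have := hroot 1 (by norm_num); rwa [mul_one] at this
  have h₂ : 1 - B + C ≠ 0 := by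
    have := hroot (-1) (by norm_num); rwa [mul_neg_one, ← sub_eq_add_neg] at this
  exact no_common_conic h₁ h₂ (first_conic h₁ hf) (second_conic h₁ hg)

/-- Points of degree at most two on the curve `Y`. -/
theorem sq_eq_one_of_points [FiniteDimensional ℚ L] (hL : Module.finrank ℚ L ≤ 2) {q y z : L}
    (hy : y ^ 2 = (5 * q ^ 2 - 1) * (q ^ 2 + 3))
    (hz : z ^ 2 = 5 * q ^ 4 - 8 * q ^ 3 + 6 * q ^ 2 + 8 * q + 5) : q ^ 2 = 1 := by
  obtain ⟨q, rfl⟩ := mem_range_of_points hL hy hz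
  have hinj := (algebraMap ℚ L).injective
  suffices h : q ^ 2 = 1 by rw [← map_pow, h, map_one]
  by_cases hyq : y ∈ Set.range (algebraMap ℚ L)
  · obtain ⟨y, rfl⟩ := hyq
    refine rational_first (y := y) (hinj ?_)
    simpa only [map_sub, map_add, map_mul, map_pow, map_ofNat, map_one] using hy
  obtain ⟨a, b, rfl⟩ := exists_coordinates hL hyq z
  have key := coeff_eq_zero hyq
    (s := a ^ 2 + b ^ 2 * ((5 * q ^ 2 - 1) * (q ^ 2 + 3)) -
      (5 * q ^ 4 - 8 * q ^ 3 + 6 * q ^ 2 + 8 * q + 5)) (t := 2 * a * b) (by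
      simp only [map_sub, map_add, map_mul, map_pow, map_ofNat, map_one]
      linear_combination hz - algebraMap ℚ L b ^ 2 * hy)
  -- With `q` rational, `z² = (a + by)²` has no `y`-component. Either `z = by`, so that `bF` is a
  -- square root of `FG`, or `z = a` is rational.
  have hab : a * b = 0 := by linarith [key.2]
  rcases mul_eq_zero.1 hab with rfl | rfl
  · refine rational_product (w := b * ((5 * q ^ 2 - 1) * (q ^ 2 + 3))) ?_
    linear_combination ((5 * q ^ 2 - 1) * (q ^ 2 + 3)) * key.1
  · exact rational_second (z := a) (by linear_combination key.1)

end QuadraticField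

/-! ### The rational and quadratic points of `Y`. -/

theorem mem_geometricPoints_curveY {P : Fin 3 → AlgebraicClosure ℚ} :
    P ∈ geometricPoints curveY ↔ P 1 ^ 2 = (5 * P 0 ^ 2 - 1) * (P 0 ^ 2 + 3) ∧
      P 2 ^ 2 = 5 * P 0 ^ 4 - 8 * P 0 ^ 3 + 6 * P 0 ^ 2 + 8 * P 0 + 5 := by
  simp [geometricPoints, curveY, sub_eq_zero]

theorem coordinates_of_mem_quadraticPoints {P : Fin 3 → AlgebraicClosure ℚ}
    (hP : P ∈ quadraticPoints curveY) :
    (P 0 = 1 ∨ P 0 = -1) ∧ (P 1 = 4 ∨ P 1 = -4) ∧ (P 2 = 4 ∨ P 2 = -4) := by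
  obtain ⟨hP, hdeg⟩ := hP
  obtain ⟨h₁, h₂⟩ := mem_geometricPoints_curveY.1 hP
  have hfin : FiniteDimensional ℚ (fieldOfDefinition P) :=
    IntermediateField.finiteDimensional_adjoin fun x _ => (Algebra.IsAlgebraic.isAlgebraic x).isIntegral
  have hmem : ∀ i, P i ∈ fieldOfDefinition P := fun i =>
    IntermediateField.subset_adjoin ℚ _ (Set.mem_range_self i)
  have hq : P 0 ^ 2 = 1 := by
    have := sq_eq_one_of_points (L := fieldOfDefinition P) hdeg (q := ⟨P 0, hmem 0⟩)
      (y := ⟨P 1, hmem 1⟩) (z := ⟨P 2, hmem 2⟩) (Subtype.ext h₁) (Subtype.ext h₂)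
    exact congrArg Subtype.val this
  have hpm : ∀ x : AlgebraicClosure ℚ, x ^ 2 = 16 → x = 4 ∨ x = -4 := fun x hx =>
    sq_eq_sq_iff_eq_or_eq_neg.1 (hx.trans (by norm_num))
  refine ⟨sq_eq_sq_iff_eq_or_eq_neg.1 (hq.trans (one_pow 2).symm), hpm _ ?_, hpm _ ?_⟩
  · rw [h₁, hq]; norm_num
  · rw [h₂]; linear_combination (5 * P 0 ^ 2 - 8 * P 0 + 11) * hq

theorem mem_rationalPoints_of_coordinates {P : Fin 3 → AlgebraicClosure ℚ}
    (h : (P 0 = 1 ∨ P 0 = -1) ∧ (P 1 = 4 ∨ P 1 = -4) ∧ (P 2 = 4 ∨ P 2 = -4)) :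
    P ∈ rationalPoints curveY := by
  obtain ⟨h₀, h₁, h₂⟩ := h
  refine ⟨mem_geometricPoints_curveY.2 ⟨?_, ?_⟩, ?_⟩
  · rcases h₀ with h₀ | h₀ <;> rcases h₁ with h₁ | h₁ <;> rw [h₀, h₁] <;> norm_num
  · rcases h₀ with h₀ | h₀ <;> rcases h₂ with h₂ | h₂ <;> rw [h₀, h₂] <;> norm_num
  · intro i
    fin_cases i
    · rcases h₀ with h | h
      exacts [⟨1, by simp [h]⟩, ⟨-1, by simp [h]⟩]
    · rcases h₁ with h | h
      exacts [⟨4, by simp [h]⟩, ⟨-4, by simp [h]⟩]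
    · rcases h₂ with h | h
      exacts [⟨4, by simp [h]⟩, ⟨-4, by simp [h]⟩]

theorem rationalPoints_subset_quadraticPoints {k : Type*} [Field k] {n : ℕ}
    (S : Set (MvPolynomial (Fin n) k)) : rationalPoints S ⊆ quadraticPoints S := by
  rintro P ⟨hP, hrat⟩
  refine ⟨hP, ?_⟩
  have : fieldOfDefinition P = ⊥ := by
    rw [fieldOfDefinition, IntermediateField.adjoin_eq_bot_iff]
    rintro _ ⟨i, rfl⟩
    exact IntermediateField.mem_bot.2 (hrat i)
  rw [this, IntermediateField.finrank_bot]
  norm_num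

theorem rationalPoints_curveY : rationalPoints curveY =
    {P | (P 0 = 1 ∨ P 0 = -1) ∧ (P 1 = 4 ∨ P 1 = -4) ∧ (P 2 = 4 ∨ P 2 = -4)} :=
  Set.Subset.antisymm
    (fun _ hP => coordinates_of_mem_quadraticPoints (rationalPoints_subset_quadraticPoints _ hP))
    fun _ hP => mem_rationalPoints_of_coordinates hP

theorem quadraticPoints_curveY : quadraticPoints curveY = rationalPoints curveY :=
  Set.Subset.antisymm
    (fun _ hP => mem_rationalPoints_of_coordinates (coordinates_of_mem_quadraticPoints hP))
    (rationalPoints_subset_quadraticPoints _)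

/-! ### From the graph to a point of `Y`. -/

theorem not_containsGraph_G6 (K : Type*) [Field K] [NumberField K]
    (hK : Module.finrank ℚ K = 2) (c : K) :
    ¬ ContainsGraph (preperiodicGraph (quadMap c)) G6 := by
  rintro ⟨φ, hφ, hadj⟩
  have hne : ∀ {i j : Fin 12}, i ≠ j → (φ i).1 ≠ (φ j).1 := fun h h' =>
    h (hφ (Subtype.ext h'))
  have hedge : ∀ i : Fin 12, (φ i).1 ^ 2 + c = (φ (G6next i)).1 := fun i => hadj i _ rfl
  have hneg : ∀ {i j : Fin 12}, i ≠ j → G6next i = G6next j → (φ i).1 = -(φ j).1 := by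
    intro i j hij h
    have h' := (hedge i).trans ((congrArg (fun k => (φ k).1) h).trans (hedge j).symm)
    exact (sq_eq_sq_iff_eq_or_eq_neg.1 (add_right_cancel h')).resolve_left (hne hij)
  have e0 : (φ 0).1 ^ 2 + c = (φ 0).1 := hedge 0
  have e2 : (φ 2).1 ^ 2 + c = (φ 1).1 := hedge 2
  have e6 : (φ 6).1 ^ 2 + c = (φ 7).1 := hedge 6
  have e7 : (φ 7).1 ^ 2 + c = (φ 6).1 := hedge 7
  have e10 : (φ 10).1 ^ 2 + c = (φ 8).1 := hedge 10
  have e1 : (φ 1).1 = -(φ 0).1 := hneg (by decide) rfl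
  have e8 : (φ 8).1 = -(φ 6).1 := hneg (by decide) rfl
  have h67 : (φ 6).1 - (φ 7).1 ≠ 0 := sub_ne_zero.2 (hne (by decide))
  generalize (φ 0).1 = a at *
  generalize (φ 6).1 = b at *
  generalize (φ 7).1 = b' at *
  generalize (φ 2).1 = u at *
  generalize (φ 10).1 = v at *
  rw [e1] at e2
  rw [e8] at e10
  -- Subtracting the two equations of the 2-cycle and dividing by `b - b'`.
  have hsum : b + b' + 1 = 0 := by
    apply mul_left_cancel₀ h67
    linear_combination e6 - e7
  obtain rfl : b' = -1 - b := by linear_combination hsum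
  obtain rfl : c = a - a ^ 2 := by linear_combination e0
  -- Equating the values of `c` from the fixed point and from the 2-cycle gives a conic, on which `t
  -- = a + b` is a coordinate.
  have hta : (a + b) * (a - b - 1) = 1 := by linear_combination -e6
  obtain ⟨t, rfl⟩ : ∃ t, b = t - a := ⟨a + b, by ring⟩
  have ht : t ≠ 0 := by
    rintro rfl
    simp at hta
  have hat : 2 * a * t = t ^ 2 + t + 1 := by linear_combination hta
  -- At `t = -1` the 2-cycle collapses to `b = b' = -1/2`.
  have ht1 : 1 + t ≠ 0 := by
    intro h
    refine h67 ?_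
    obtain rfl : t = -1 := by linear_combination h
    linear_combination hat
  have hu : 4 * u ^ 2 * t ^ 2 = (t ^ 2 + t + 1) * (t ^ 2 - 3 * t + 1) := by
    linear_combination 4 * t ^ 2 * e2 + (2 * a * t + t ^ 2 + t + 1 - 4 * t) * hat
  have hv : 4 * v ^ 2 * t ^ 2 = t ^ 4 - 2 * t ^ 3 + 3 * t ^ 2 + 2 * t + 1 := by
    linear_combination 4 * t ^ 2 * e10 + (2 * a * t + t ^ 2 + t + 1) * hat
  -- The change of variable from `t` to `q` turns `(t² + t + 1)(t² - 3t + 1)` and `t⁴ - 2t³ + 3t² +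
  -- 2t + 1` into `F` and `G`, up to the square factor `(1 + t)⁴/16`.
  have hq := sq_eq_one_of_points (L := K) hK.le (q := (1 - t) / (1 + t))
    (y := 8 * u * t / (1 + t) ^ 2) (z := 8 * v * t / (1 + t) ^ 2)
    (by field_simp; linear_combination 16 * hu) (by field_simp; linear_combination 16 * hv)
  rw [div_pow, div_eq_one_iff_eq (pow_ne_zero 2 ht1)] at hq
  refine ht (mul_left_cancel₀ (show (4 : K) ≠ 0 by norm_num) ?_)
  linear_combination -hq

/-! ### The field `k((t))`, its derivation and its valuation ring. -/

section LaurentDerivation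

open HahnSeries LaurentSeries

variable {k : Type*} [Field k]

theorem LaurentSeries.coeff_derivative_eq (f : LaurentSeries k) (n : ℤ) :
    (LaurentSeries.derivative k f).coeff n = (n + 1 : ℤ) • f.coeff (n + 1) := by
  rw [LaurentSeries.derivative_apply, LaurentSeries.hasseDeriv_coeff]
  simp

theorem LaurentSeries.derivative_coe (p : PowerSeries k) :
    LaurentSeries.derivative k (p : LaurentSeries k) =
      ((PowerSeries.derivative k p : PowerSeries k) : LaurentSeries k) := by
  ext n
  rw [LaurentSeries.coeff_derivative_eq]
  rcases le_or_gt 0 n with hn | hn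
  · obtain ⟨m, rfl⟩ := Int.eq_ofNat_of_zero_le hn
    rw [LaurentSeries.coeff_coe_powerSeries, PowerSeries.coeff_derivative,
      show (m : ℤ) + 1 = ((m + 1 : ℕ) : ℤ) by push_cast; rfl, LaurentSeries.coeff_coe_powerSeries]
    rw [zsmul_eq_mul, mul_comm]
    push_cast
    rfl
  · rw [PowerSeries.coeff_coe, PowerSeries.coeff_coe, if_pos hn]
    rcases eq_or_ne n (-1) with rfl | h
    · simp
    · rw [if_pos (by omega), smul_zero]

theorem LaurentSeries.derivative_single_mul (n : ℤ) (f : LaurentSeries k) :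
    LaurentSeries.derivative k (single n (1 : k) * f) =
      n • (single (n - 1) (1 : k) * f) + single n (1 : k) * LaurentSeries.derivative k f := by
  ext m
  have h₁ : ∀ (i : ℤ) (f : LaurentSeries k) (j : ℤ),
      (single i (1 : k) * f).coeff j = f.coeff (j - i) := by
    intro i f j
    have := coeff_single_mul_add (r := (1 : k)) (x := f) (a := j - i) (b := i)
    rwa [sub_add_cancel, one_mul] at this
  rw [LaurentSeries.coeff_derivative_eq, h₁, HahnSeries.coeff_add, HahnSeries.coeff_smul, h₁, h₁,
    LaurentSeries.coeff_derivative_eq, show m + 1 - n = m - n + 1 by ring,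
    show m - (n - 1) = m - n + 1 by ring, ← add_smul]
  congr 1
  ring

theorem LaurentSeries.algebraMap_mul_eq_smul (r : k) (f : LaurentSeries k) :
    algebraMap k (LaurentSeries k) r * f = HahnSeries.C r * f := by
  rw [HahnSeries.algebraMap_apply', PowerSeries.algebraMap_apply, Algebra.algebraMap_self_apply,
    HahnSeries.ofPowerSeries_C]

theorem LaurentSeries.derivative_algebraMap_mul (r : k) (f : LaurentSeries k) :
    LaurentSeries.derivative k (algebraMap k (LaurentSeries k) r * f) =
      algebraMap k (LaurentSeries k) r * LaurentSeries.derivative k f := by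
  rw [LaurentSeries.algebraMap_mul_eq_smul, LaurentSeries.algebraMap_mul_eq_smul,
    HahnSeries.C_mul_eq_smul, HahnSeries.C_mul_eq_smul]
  exact map_smul _ _ _

/-- Each series is a power of `t` times a power series, which reduces the Leibniz rule to the one
for power series. -/
theorem LaurentSeries.derivative_mul (x y : LaurentSeries k) :
    LaurentSeries.derivative k (x * y) =
      x * LaurentSeries.derivative k y + y * LaurentSeries.derivative k x := by
  rw [← single_order_mul_powerSeriesPart x, ← single_order_mul_powerSeriesPart y]
  generalize x.order = a
  generalize y.order = b
  generalize x.powerSeriesPart = p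
  generalize y.powerSeriesPart = q
  have h : single a (1 : k) * (p : LaurentSeries k) * (single b (1 : k) * (q : LaurentSeries k)) =
      single (a + b) (1 : k) * ((p * q : PowerSeries k) : LaurentSeries k) := by
    rw [PowerSeries.coe_mul, ← mul_one (1 : k), ← single_mul_single, mul_one]
    ring
  have e₁ : single (a + b - 1) (1 : k) = single (a - 1) 1 * single b 1 := by
    rw [single_mul_single, mul_one, show a - 1 + b = a + b - 1 by ring]
  have e₂ : single (a + b - 1) (1 : k) = single a 1 * single (b - 1) 1 := by
    rw [single_mul_single, mul_one, show a + (b - 1) = a + b - 1 by ring]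
  have e₃ : single (a + b) (1 : k) = single a 1 * single b 1 := by
    rw [single_mul_single, mul_one]
  rw [h, LaurentSeries.derivative_single_mul, LaurentSeries.derivative_single_mul,
    LaurentSeries.derivative_single_mul, LaurentSeries.derivative_coe,
    LaurentSeries.derivative_coe, LaurentSeries.derivative_coe, Derivation.leibniz]
  simp only [smul_eq_mul, PowerSeries.coe_add, PowerSeries.coe_mul, add_smul]
  nth_rewrite 1 [e₁]
  rw [e₂, e₃]
  simp only [zsmul_eq_mul]
  ring

/-- The field of Laurent series over `k`, with the `k`-algebra structure it has as an algebra over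
the ring of power series. -/
def LaurentField (k : Type*) [Field k] : Type _ := LaurentSeries k

namespace LaurentField

noncomputable instance : Field (LaurentField k) := inferInstanceAs (Field (LaurentSeries k))

noncomputable instance : Algebra k (LaurentField k) := inferInstanceAs (Algebra k (LaurentSeries k))

/-- The inclusion of power series. -/
noncomputable def ofPowerSeries (k : Type*) [Field k] : PowerSeries k →ₐ[k] LaurentField k :=
  { HahnSeries.ofPowerSeries ℤ k with commutes' := fun _ => rfl }

theorem ofPowerSeries_injective : Function.Injective (ofPowerSeries k) :=
  HahnSeries.ofPowerSeries_injective

/-- The formal derivative. -/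
noncomputable def derivation (k : Type*) [Field k] :
    Derivation k (LaurentField k) (LaurentField k) :=
  Derivation.mk'
    { toFun := LaurentSeries.derivative k
      map_add' := map_add (LaurentSeries.derivative k)
      map_smul' := fun r f => LaurentSeries.derivative_algebraMap_mul r f }
    (LaurentSeries.derivative_mul (k := k))

theorem derivation_ofPowerSeries (p : PowerSeries k) :
    derivation k (ofPowerSeries k p) = ofPowerSeries k (PowerSeries.derivative k p) :=
  LaurentSeries.derivative_coe p

/-- The subalgebra of power series. -/
noncomputable def integers (k : Type*) [Field k] : Subalgebra k (LaurentField k) :=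
  (ofPowerSeries k).range

theorem mem_integers {x : LaurentField k} :
    x ∈ integers k ↔ ∃ p : PowerSeries k, ofPowerSeries k p = x := Iff.rfl

theorem ofPowerSeries_mem_integers (p : PowerSeries k) : ofPowerSeries k p ∈ integers k :=
  ⟨p, rfl⟩

theorem mem_or_inv_mem_integers (x : LaurentField k) :
    x ∈ integers k ∨ x⁻¹ ∈ integers k := by
  have h : ∀ y : LaurentSeries k, Valued.v y ≤ (1 : WithZero (Multiplicative ℤ)) →
      (show LaurentField k from y) ∈ integers k := fun y hy =>
    (LaurentSeries.val_le_one_iff_eq_coe k y).1 hy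
  rcases le_total (Valued.v (show LaurentSeries k from x)) (1 : WithZero (Multiplicative ℤ))
    with hx | hx
  · exact Or.inl (h _ hx)
  · refine Or.inr (h (show LaurentSeries k from x)⁻¹ ?_)
    rw [map_inv₀]
    exact inv_le_one_of_one_le₀ hx

theorem derivation_mem_integers {x : LaurentField k} (hx : x ∈ integers k) :
    derivation k x ∈ integers k := by
  obtain ⟨p, rfl⟩ := hx
  exact ⟨_, (derivation_ofPowerSeries p).symm⟩

end LaurentField

end LaurentDerivation

/-! ### Square roots of power series. -/

section Sqrt

open PowerSeries

/-- Hensel's lemma for `T² - p`: a square root `s` of the constant term lifts because `2s` is a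
unit. -/
theorem PowerSeries.exists_sq_eq {k : Type*} [Field k] [IsAlgClosed k] [CharZero k]
    {p : PowerSeries k} (hp : constantCoeff p ≠ 0) : ∃ w : PowerSeries k, w ^ 2 = p := by
  obtain ⟨s, hs⟩ := IsAlgClosed.exists_pow_nat_eq (constantCoeff p) two_pos
  have hmem : ∀ x : PowerSeries k, x ∈ Ideal.span {(X : PowerSeries k)} ↔ constantCoeff x = 0 := by
    intro x
    rw [Ideal.mem_span_singleton, X_dvd_iff]
  obtain ⟨w, hw, -⟩ := HenselianRing.is_henselian (I := Ideal.span {(X : PowerSeries k)})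
    (Polynomial.X ^ 2 - Polynomial.C p) (Polynomial.monic_X_pow_sub_C p two_ne_zero) (C s)
    (by rw [hmem]; simp [hs]) (by
      have hs0 : (2 : k) * s ≠ 0 := by
        refine mul_ne_zero two_ne_zero ?_
        rintro rfl
        exact hp (by rw [← hs]; simp)
      have : IsUnit (C (2 * s) : PowerSeries k) := (IsUnit.mk0 _ hs0).map C
      convert this.map (Ideal.Quotient.mk (Ideal.span {(X : PowerSeries k)})) using 2
      rw [Polynomial.derivative_sub, Polynomial.derivative_X_pow, Polynomial.derivative_C]
      simp only [map_mul, map_ofNat, Nat.cast_ofNat, sub_zero, Polynomial.eval_mul,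
        Polynomial.eval_pow, Polynomial.eval_X]
      simp)
  exact ⟨w, by simpa [sub_eq_zero] using hw⟩

end Sqrt

/-! ### The ring and the ideal of `y² = f(q)`, `z² = g(q)`. -/

section Biquadratic

open Polynomial

/-- At a root of `f`, which is simple, the two sides would have multiplicities of opposite parity.
-/
theorem eq_zero_of_sq_mul_eq_sq {k : Type*} [Field k] [IsAlgClosed k] {f : k[X]}
    (hf : f.Separable) (hdeg : f.degree ≠ 0) {r p : k[X]} (h : r ^ 2 * f = p ^ 2) : r = 0 := by
  by_contra hr
  have hf0 : f ≠ 0 := hf.ne_zero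
  obtain ⟨α, hα⟩ := IsAlgClosed.exists_root f hdeg
  have hp : p ≠ 0 := by
    rintro rfl
    rw [zero_pow two_ne_zero] at h
    exact mul_ne_zero (pow_ne_zero 2 hr) hf0 h
  have h1 : f.rootMultiplicity α = 1 :=
    le_antisymm (rootMultiplicity_le_one_of_separable hf α) ((rootMultiplicity_pos hf0).2 hα)
  have h2 := congrArg (rootMultiplicity α) h
  rw [sq, sq, rootMultiplicity_mul (mul_ne_zero (mul_ne_zero hr hr) hf0),
    rootMultiplicity_mul (mul_ne_zero hr hr), rootMultiplicity_mul (mul_ne_zero hp hp), h1] at h2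
  omega

/-- Elements `(q, y, z)` with `q` transcendental over `k`, `y² = f(q)` and `z² = g(q)`. -/
structure IsBiquadraticTriple {k : Type*} [Field k] (f g : k[X]) {L : Type*} [CommRing L]
    [Algebra k L] (v : Fin 3 → L) : Prop where
  injective : Function.Injective (aeval (R := k) (v 0))
  first : v 1 ^ 2 = aeval (v 0) f
  second : v 2 ^ 2 = aeval (v 0) g

/-- Neither of `f`, `g`, `fg` becomes a square in `k(X)`. -/
structure IsIndependentPair {k : Type*} [Field k] (f g : k[X]) : Prop where
  first : ∀ {r p : k[X]}, r ^ 2 * f = p ^ 2 → r = 0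
  second : ∀ {r p : k[X]}, r ^ 2 * g = p ^ 2 → r = 0
  mul : ∀ {r p : k[X]}, r ^ 2 * (f * g) = p ^ 2 → r = 0

variable {k : Type*} [Field k] {f g : k[X]}

theorem IsBiquadraticTriple.map {L M : Type*} [CommRing L] [Algebra k L] [CommRing M] [Algebra k M]
    {v : Fin 3 → L} (hv : IsBiquadraticTriple f g v) (φ : L →ₐ[k] M) (hφ : Function.Injective φ) :
    IsBiquadraticTriple f g (φ ∘ v) where
  injective p p' h := by
    simp only [Function.comp_apply, aeval_algHom_apply] at h
    exact hv.injective (hφ h)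
  first := by
    rw [Function.comp_apply, Function.comp_apply, ← map_pow, hv.first, aeval_algHom_apply]
  second := by
    rw [Function.comp_apply, Function.comp_apply, ← map_pow, hv.second, aeval_algHom_apply]

/-- The element `a(q) + b(q) y + c(q) z + d(q) yz`. -/
noncomputable def combination {L : Type*} [CommRing L] [Algebra k L] (v : Fin 3 → L)
    (a b c d : k[X]) : L :=
  aeval (v 0) a + aeval (v 0) b * v 1 + aeval (v 0) c * v 2 + aeval (v 0) d * (v 1 * v 2)

section Independence

variable {L : Type*} [CommRing L] [Algebra k L] {v : Fin 3 → L}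

theorem eq_zero_of_aeval_mul_eq (hinj : Function.Injective (aeval (R := k) (v 0))) {w : L}
    {h : k[X]} (hw : w ^ 2 = aeval (v 0) h) (hh : ∀ {r p : k[X]}, r ^ 2 * h = p ^ 2 → r = 0)
    {r p : k[X]} (H : aeval (v 0) p = aeval (v 0) r * w) : p = 0 ∧ r = 0 := by
  have hr : r = 0 := by
    refine hh (p := p) (hinj ?_)
    rw [map_mul, map_pow, map_pow, ← hw, H]
    ring
  refine ⟨hinj ?_, hr⟩
  rw [H, hr, map_zero, zero_mul]

/-- Linear independence of `1, y, z, yz` over `k(q)`. Vanishing of the norm to `k(q, y)` gives `(a +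
by)² = (c + dy)²g`; its conjugate under `y ↦ -y` lets one extract a square root, and each choice of
sign reduces to the independence of `1` and a single square root. -/
theorem IsBiquadraticTriple.combination_eq_zero [CharZero k] [IsDomain L] (hfg : IsIndependentPair f g)
    (hv : IsBiquadraticTriple f g v) {a b c d : k[X]} (h : combination v a b c d = 0) :
    a = 0 ∧ b = 0 ∧ c = 0 ∧ d = 0 := by
  have hy := hv.first
  have hz := hv.second
  have hyz : (v 1 * v 2) ^ 2 = aeval (v 0) (f * g) := by rw [mul_pow, hy, hz, map_mul]
  have key₁ {r p : k[X]} (H : aeval (v 0) p = aeval (v 0) r * v 1) :=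
    eq_zero_of_aeval_mul_eq hv.injective hy hfg.first H
  have key₂ {r p : k[X]} (H : aeval (v 0) p = aeval (v 0) r * v 2) :=
    eq_zero_of_aeval_mul_eq hv.injective hz hfg.second H
  have key₃ {r p : k[X]} (H : aeval (v 0) p = aeval (v 0) r * (v 1 * v 2)) :=
    eq_zero_of_aeval_mul_eq hv.injective hyz hfg.mul H
  rw [combination] at h
  -- the norm to `k(q, y)`
  have h₁ : aeval (v 0) (a ^ 2 + b ^ 2 * f - g * (c ^ 2 + d ^ 2 * f)) =
      aeval (v 0) (2 * (g * (c * d) - a * b)) * v 1 := by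
    simp only [map_add, map_sub, map_mul, map_pow, map_ofNat]
    rw [← hy, ← hz]
    linear_combination (aeval (v 0) a + aeval (v 0) b * v 1 - aeval (v 0) c * v 2 -
      aeval (v 0) d * (v 1 * v 2)) * h
  obtain ⟨h₂, h₃⟩ := key₁ h₁
  have h₄ : (aeval (v 0) a - aeval (v 0) b * v 1) ^ 2 =
      ((aeval (v 0) c - aeval (v 0) d * v 1) * v 2) ^ 2 := by
    have h₂' := congrArg (aeval (v 0)) h₂
    have h₃' := congrArg (aeval (v 0)) h₃
    simp only [map_add, map_sub, map_mul, map_pow, map_ofNat, map_zero] at h₂' h₃'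
    rw [← hy, ← hz] at h₂'
    rw [← hz] at h₃'
    linear_combination h₂' + v 1 * h₃'
  have h2 : (2 : k[X]) ≠ 0 := two_ne_zero
  have hcancel : ∀ {p : k[X]}, 2 * p = 0 → p = 0 := fun hp => (mul_eq_zero.1 hp).resolve_left h2
  rcases sq_eq_sq_iff_eq_or_eq_neg.1 h₄ with h₅ | h₅
  · have e₁ := key₃ (p := 2 * a) (r := -2 * d) (by
      simp only [map_mul, map_neg, map_ofNat]; linear_combination h + h₅)
    have e₂ : a = 0 := hcancel e₁.1
    have e₃ : d = 0 := neg_eq_zero.1 (hcancel (by linear_combination e₁.2))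
    rw [e₂, e₃, map_zero] at h
    have e₄ := eq_zero_of_aeval_mul_eq hv.injective hyz hfg.mul (p := b * f) (r := -c) (by
      rw [map_mul, ← hy, map_neg]; linear_combination v 1 * h)
    have e₅ : c = 0 := neg_eq_zero.1 e₄.2
    rw [e₅, map_zero] at h
    have e₆ := key₁ (p := 0) (r := b) (by rw [map_zero]; linear_combination -h)
    exact ⟨e₂, e₆.2, e₅, e₃⟩
  · have e₁ := key₂ (p := 2 * a) (r := -2 * c) (by
      simp only [map_mul, map_neg, map_ofNat]; linear_combination h + h₅)
    have e₂ : a = 0 := hcancel e₁.1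
    have e₃ : c = 0 := neg_eq_zero.1 (hcancel (by linear_combination e₁.2))
    rw [e₂, e₃, map_zero] at h
    have e₄ := key₂ (p := b * f) (r := -(d * f)) (by
      rw [map_mul, ← hy, map_neg, map_mul, ← hy]; linear_combination v 1 * h)
    have hf : f ≠ 0 := by
      rintro rfl
      exact one_ne_zero (hfg.first (r := 1) (p := 0) (by ring))
    have e₅ : b = 0 := (mul_eq_zero.1 e₄.1).resolve_right hf
    have e₆ : d = 0 := (mul_eq_zero.1 (neg_eq_zero.1 e₄.2)).resolve_right hf
    exact ⟨e₂, e₅, e₃, e₆⟩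

end Independence

/-- The ideal of the curve `y² = f(q)`, `z² = g(q)`. -/
noncomputable def biquadraticIdeal (f g : k[X]) : Ideal (MvPolynomial (Fin 3) k) :=
  Ideal.span {MvPolynomial.X 1 ^ 2 - aeval (MvPolynomial.X 0) f,
    MvPolynomial.X 2 ^ 2 - aeval (MvPolynomial.X 0) g}

theorem exists_combination_sub_mem (F : MvPolynomial (Fin 3) k) :
    ∃ a b c d : k[X], F - combination MvPolynomial.X a b c d ∈ biquadraticIdeal f g := by
  have hy : (MvPolynomial.X 1 ^ 2 - aeval (MvPolynomial.X 0) f : MvPolynomial (Fin 3) k) ∈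
    biquadraticIdeal f g := Ideal.subset_span (Or.inl rfl)
  have hz : (MvPolynomial.X 2 ^ 2 - aeval (MvPolynomial.X 0) g : MvPolynomial (Fin 3) k) ∈
    biquadraticIdeal f g := Ideal.subset_span (Or.inr rfl)
  induction F using MvPolynomial.induction_on with
  | C r =>
    refine ⟨C r, 0, 0, 0, ?_⟩
    simp [combination, MvPolynomial.algebraMap_eq]
  | add F G hF hG =>
    obtain ⟨a, b, c, d, h⟩ := hF
    obtain ⟨a', b', c', d', h'⟩ := hG
    refine ⟨a + a', b + b', c + c', d + d', ?_⟩
    convert add_mem h h' using 1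
    simp only [combination, map_add]
    ring
  | mul_X F i hF =>
    obtain ⟨a, b, c, d, h⟩ := hF
    fin_cases i
    · refine ⟨a * X, b * X, c * X, d * X, ?_⟩
      change F * MvPolynomial.X 0 - _ ∈ _
      convert Ideal.mul_mem_right (MvPolynomial.X 0) _ h using 1
      simp only [combination, map_mul, aeval_X]
      ring
    · refine ⟨b * f, a, d * f, c, ?_⟩
      change F * MvPolynomial.X 1 - _ ∈ _
      convert add_mem (Ideal.mul_mem_right (MvPolynomial.X 1) _ h) (Ideal.mul_mem_left _
        (aeval (MvPolynomial.X 0) b + aeval (MvPolynomial.X 0) d * MvPolynomial.X 2) hy) using 1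
      simp only [combination, map_mul]
      ring
    · refine ⟨c * g, d * g, a, b, ?_⟩
      change F * MvPolynomial.X 2 - _ ∈ _
      convert add_mem (Ideal.mul_mem_right (MvPolynomial.X 2) _ h) (Ideal.mul_mem_left _
        (aeval (MvPolynomial.X 0) c + aeval (MvPolynomial.X 0) d * MvPolynomial.X 1) hz) using 1
      simp only [combination, map_mul]
      ring

theorem map_combination {L M : Type*} [CommRing L] [Algebra k L] [CommRing M] [Algebra k M]
    (φ : L →ₐ[k] M) (v : Fin 3 → L) (a b c d : k[X]) :
    φ (combination v a b c d) = combination (φ ∘ v) a b c d := by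
  simp [combination, aeval_algHom_apply]

/-- Modulo the ideal every polynomial is a combination of `1, y, z, yz`, and those are independent
at the given triple. Since the target is a domain, the ideal is prime. -/
theorem IsBiquadraticTriple.ker_eq [CharZero k] {L : Type*} [CommRing L] [IsDomain L] [Algebra k L]
    {v : Fin 3 → L} (hfg : IsIndependentPair f g) (hv : IsBiquadraticTriple f g v) :
    RingHom.ker (MvPolynomial.aeval (R := k) v) = biquadraticIdeal f g := by
  have hle : biquadraticIdeal f g ≤ RingHom.ker (MvPolynomial.aeval (R := k) v) := by
    rw [biquadraticIdeal, Ideal.span_le]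
    rintro F (rfl | rfl)
    · simp [RingHom.mem_ker, hv.first, ← aeval_algHom_apply]
    · simp [RingHom.mem_ker, hv.second, ← aeval_algHom_apply]
  refine le_antisymm (fun F hF => ?_) hle
  obtain ⟨a, b, c, d, h⟩ := exists_combination_sub_mem (f := f) (g := g) F
  have h' := hle h
  rw [RingHom.mem_ker] at hF h'
  rw [map_sub, hF, zero_sub, neg_eq_zero, map_combination] at h'
  have hX : (MvPolynomial.aeval (R := k) v) ∘ MvPolynomial.X = v := by ext i; simp
  rw [hX] at h'
  obtain ⟨rfl, rfl, rfl, rfl⟩ := hv.combination_eq_zero hfg h'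
  simpa [combination] using h

theorem exists_isBiquadraticTriple (f g : k[X]) :
    ∃ v : Fin 3 → AlgebraicClosure (RatFunc k), IsBiquadraticTriple f g v := by
  let q : AlgebraicClosure (RatFunc k) := algebraMap (RatFunc k) _ RatFunc.X
  obtain ⟨y, hy⟩ := IsAlgClosed.exists_pow_nat_eq (aeval q f) two_pos
  obtain ⟨z, hz⟩ := IsAlgClosed.exists_pow_nat_eq (aeval q g) two_pos
  refine ⟨![q, y, z], ?_, hy, hz⟩
  have : Transcendental k q := by
    rw [transcendental_algebraMap_iff (algebraMap (RatFunc k) _).injective]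
    exact RatFunc.transcendental_X
  exact transcendental_iff_injective.1 this

end Biquadratic

/-! ### The function field of a biquadratic curve. -/

section BiquadraticField

open Polynomial

variable {k : Type*} [Field k] {f g : k[X]}

/-- Rationalizing denominators: multiply by the conjugate in `z`, then by the conjugate in `y`. -/
theorem IsBiquadraticTriple.exists_mul_eq_aeval [CharZero k] {L : Type*} [CommRing L] [IsDomain L]
    [Algebra k L] {v : Fin 3 → L} (hfg : IsIndependentPair f g) (hv : IsBiquadraticTriple f g v)
    {a b c d : k[X]} (h : combination v a b c d ≠ 0) :
    ∃ (m : L) (s : k[X]), s ≠ 0 ∧ m * combination v a b c d = aeval (v 0) s := by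
  have hne {a' b' c' d' : k[X]} (h' : ¬(a' = 0 ∧ b' = 0 ∧ c' = 0 ∧ d' = 0)) :
      combination v a' b' c' d' ≠ 0 := fun h'' => h' (hv.combination_eq_zero hfg h'')
  have h₁ : combination v a b (-c) (-d) ≠ 0 := hne (by
    rintro ⟨rfl, rfl, hc, hd⟩
    rw [neg_eq_zero.1 hc, neg_eq_zero.1 hd] at h
    exact h (by simp [combination]))
  have h₂ : combination v a b (-c) (-d) * combination v a b c d =
      combination v (a ^ 2 + b ^ 2 * f - g * (c ^ 2 + d ^ 2 * f)) (2 * (a * b - g * (c * d)))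
        0 0 := by
    simp only [combination, map_add, map_sub, map_mul, map_pow, map_neg, map_zero, map_ofNat]
    rw [← hv.first, ← hv.second]
    ring
  have h₃ := mul_ne_zero h₁ h
  rw [h₂] at h₃
  set p := a ^ 2 + b ^ 2 * f - g * (c ^ 2 + d ^ 2 * f)
  set r := 2 * (a * b - g * (c * d))
  have h₄ : combination v p (-r) 0 0 ≠ 0 := hne (by
    rintro ⟨hp, hr, -, -⟩
    rw [hp, neg_eq_zero.1 hr] at h₃
    exact h₃ (by simp [combination]))
  have h₅ : combination v p (-r) 0 0 * combination v p r 0 0 =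
      aeval (v 0) (p ^ 2 - r ^ 2 * f) := by
    simp only [combination, map_sub, map_mul, map_pow, map_neg, map_zero]
    rw [← hv.first]
    ring
  refine ⟨combination v p (-r) 0 0 * combination v a b (-c) (-d), p ^ 2 - r ^ 2 * f, ?_, ?_⟩
  · intro h₆
    rw [h₆, map_zero] at h₅
    exact mul_ne_zero h₄ h₃ h₅
  · rw [mul_assoc, h₂, h₅]

/-- `F` behaves as the field `k(q, y, z)`: every element is of the form
`(a(q) + b(q) y + c(q) z + d(q) yz) / s(q)`, and every triple in `k((t))` that satisfies the same
equations is the image of `(q, y, z)` under an embedding of `F`. -/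
structure IsBiquadraticField (f g : k[X]) {F : Type*} [Field F] [Algebra k F] (v : Fin 3 → F) :
    Prop extends IsBiquadraticTriple f g v where
  exists_combination (h : F) : ∃ a b c d s : k[X], s ≠ 0 ∧
    aeval (v 0) s * h = combination v a b c d
  exists_algHom (v' : Fin 3 → LaurentField k) (hv' : IsBiquadraticTriple f g v') :
    ∃ φ : F →ₐ[k] LaurentField k, φ ∘ v = v'

theorem isPrime_biquadraticIdeal [CharZero k] (hfg : IsIndependentPair f g) :
    (biquadraticIdeal f g).IsPrime := by
  obtain ⟨v, hv⟩ := exists_isBiquadraticTriple f g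
  rw [← hv.ker_eq hfg]
  exact RingHom.ker_isPrime _

/-- The coordinates on the curve `y² = f(q)`, `z² = g(q)`. -/
noncomputable def biquadraticCoord (f g : k[X]) (i : Fin 3) :
    MvPolynomial (Fin 3) k ⧸ biquadraticIdeal f g :=
  Ideal.Quotient.mk _ (MvPolynomial.X i)

theorem exists_lift_of_isBiquadraticTriple [CharZero k] (hfg : IsIndependentPair f g) {L : Type*}
    [CommRing L] [IsDomain L] [Algebra k L] {v : Fin 3 → L} (hv : IsBiquadraticTriple f g v) :
    ∃ ψ : (MvPolynomial (Fin 3) k ⧸ biquadraticIdeal f g) →ₐ[k] L,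
      Function.Injective ψ ∧ ψ ∘ biquadraticCoord f g = v := by
  have hker := hv.ker_eq hfg
  refine ⟨Ideal.Quotient.liftₐ _ (MvPolynomial.aeval v) fun a ha => ?_, ?_, ?_⟩
  · rwa [← hker] at ha
  · rw [injective_iff_map_eq_zero]
    intro x hx
    obtain ⟨x, rfl⟩ := Ideal.Quotient.mk_surjective x
    rw [Ideal.Quotient.eq_zero_iff_mem, ← hker]
    exact hx
  · ext i
    exact MvPolynomial.aeval_X v i

theorem isBiquadraticTriple_biquadraticCoord [CharZero k] (hfg : IsIndependentPair f g) :
    IsBiquadraticTriple f g (biquadraticCoord f g) := by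
  obtain ⟨v, hv⟩ := exists_isBiquadraticTriple f g
  obtain ⟨ψ, hψ, rfl⟩ := exists_lift_of_isBiquadraticTriple hfg hv
  refine ⟨fun p p' h => hv.injective ?_, hψ ?_, hψ ?_⟩
  · simp only [Function.comp_apply, aeval_algHom_apply]
    rw [h]
  · rw [map_pow, ← aeval_algHom_apply]; exact hv.first
  · rw [map_pow, ← aeval_algHom_apply]; exact hv.second

theorem exists_eq_combination (x : MvPolynomial (Fin 3) k ⧸ biquadraticIdeal f g) :
    ∃ a b c d : k[X], x = combination (biquadraticCoord f g) a b c d := by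
  obtain ⟨x, rfl⟩ := Ideal.Quotient.mk_surjective x
  obtain ⟨a, b, c, d, h⟩ := exists_combination_sub_mem (f := f) (g := g) x
  refine ⟨a, b, c, d, ?_⟩
  rw [Ideal.Quotient.mk_eq_mk_iff_sub_mem _ _ |>.2 h]
  exact map_combination (Ideal.Quotient.mkₐ k (biquadraticIdeal f g)) _ _ _ _ _

theorem isBiquadraticField_fractionRing [CharZero k] (hfg : IsIndependentPair f g)
    [(biquadraticIdeal f g).IsPrime] :
    IsBiquadraticField f g (algebraMap (MvPolynomial (Fin 3) k ⧸ biquadraticIdeal f g)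
      (FractionRing (MvPolynomial (Fin 3) k ⧸ biquadraticIdeal f g)) ∘ biquadraticCoord f g) where
  toIsBiquadraticTriple := (isBiquadraticTriple_biquadraticCoord hfg).map
    (IsScalarTower.toAlgHom k _ _) (IsFractionRing.injective _ _)
  exists_combination h := by
    obtain ⟨n, m, hm, rfl⟩ :=
      IsFractionRing.div_surjective (A := MvPolynomial (Fin 3) k ⧸ biquadraticIdeal f g) h
    have hm0 : m ≠ 0 := nonZeroDivisors.ne_zero hm
    obtain ⟨a, b, c, d, rfl⟩ := exists_eq_combination m
    obtain ⟨m', s, hs, hs'⟩ :=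
      (isBiquadraticTriple_biquadraticCoord hfg).exists_mul_eq_aeval hfg hm0
    obtain ⟨a', b', c', d', hn⟩ := exists_eq_combination (n * m')
    refine ⟨a', b', c', d', s, hs, ?_⟩
    let φ := IsScalarTower.toAlgHom k (MvPolynomial (Fin 3) k ⧸ biquadraticIdeal f g)
      (FractionRing (MvPolynomial (Fin 3) k ⧸ biquadraticIdeal f g))
    have hφm : φ (combination (biquadraticCoord f g) a b c d) ≠ 0 := by
      rw [Ne, map_eq_zero_iff φ (IsFractionRing.injective _ _)]
      exact hm0
    change aeval (φ _) s * (φ n / φ _) = combination (φ ∘ _) _ _ _ _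
    rw [← map_combination, ← hn, aeval_algHom_apply, ← hs', map_mul, map_mul]
    field_simp
  exists_algHom v' hv' := by
    obtain ⟨ψ, hψ, rfl⟩ := exists_lift_of_isBiquadraticTriple hfg hv'
    refine ⟨IsFractionRing.liftAlgHom hψ, ?_⟩
    ext i
    exact IsFractionRing.lift_algebraMap hψ _

theorem IsBiquadraticField.trdeg_eq_one {F : Type*} [Field F] [Algebra k F]
    {v : Fin 3 → F} (hv : IsBiquadraticField f g v) : Algebra.trdeg k F = 1 := by
  have hb : IsTranscendenceBasis k fun _ : Unit => v 0 := by
    rw [isTranscendenceBasis_iff_algebraicIndependent_isAlgebraic]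
    refine ⟨algebraicIndependent_unique_type_iff.2 (transcendental_iff_injective.2 hv.injective),
      ⟨fun h => ?_⟩⟩
    set A := Algebra.adjoin k (Set.range fun _ : Unit => v 0)
    have hq (p : k[X]) : IsAlgebraic A (aeval (v 0) p) := by
      have hmem : v 0 ∈ A := Algebra.subset_adjoin ⟨(), rfl⟩
      have := isAlgebraic_algebraMap (A := F) (aeval (⟨v 0, hmem⟩ : A) p)
      rwa [← aeval_algebraMap_apply] at this
    have hy : IsAlgebraic A (v 1) := IsAlgebraic.of_pow two_pos (hv.first ▸ hq f)
    have hz : IsAlgebraic A (v 2) := IsAlgebraic.of_pow two_pos (hv.second ▸ hq g)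
    obtain ⟨a, b, c, d, s, hs, h'⟩ := hv.exists_combination h
    have hs0 : aeval (v 0) s ≠ 0 := fun h0 => hs (hv.injective (h0.trans (map_zero _).symm))
    rw [(eq_inv_mul_iff_mul_eq₀ hs0).2 h', combination]
    exact (hq s).inv.mul ((((hq a).add ((hq b).mul hy)).add ((hq c).mul hz)).add
      ((hq d).mul (hy.mul hz)))
  have := hb.lift_cardinalMk_eq_trdeg
  simpa using this.symm

end BiquadraticField

/-! ### Differentials evaluated along an embedding in `k((t))`. -/

section KaehlerAlongHom

open KaehlerDifferential

variable {k F : Type*} [Field k] [Field F] [Algebra k F]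

/-- An embedding of `F` into `k((t))` induces an additive map on differentials. -/
theorem exists_evalDifferential (φ : F →ₐ[k] LaurentField k) :
    ∃ ℓ : Ω[F⁄k] →+ LaurentField k, (∀ (r : F) (ω : Ω[F⁄k]), ℓ (r • ω) = φ r * ℓ ω) ∧
      ∀ x : F, ℓ (D k F x) = LaurentField.derivation k (φ x) := by
  let : Algebra F (LaurentField k) := φ.toRingHom.toAlgebra
  have : IsScalarTower k F (LaurentField k) :=
    IsScalarTower.of_algebraMap_eq fun r => (φ.commutes r).symm
  let δ : Derivation k F (LaurentField k) := (LaurentField.derivation k).compAlgebraMap F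
  refine ⟨δ.liftKaehlerDifferential.toAddMonoidHom, fun r ω => ?_, fun x => ?_⟩
  · exact δ.liftKaehlerDifferential.map_smul r ω
  · exact δ.liftKaehlerDifferential_comp_D x

/-- The preimage of `k[[t]]` under `φ` is a valuation ring of `F`, and differentiation preserves
`k[[t]]`. -/
theorem mem_integers_of_mem_regularDifferentials {φ : F →ₐ[k] LaurentField k}
    {ℓ : Ω[F⁄k] →+ LaurentField k} (hℓ : ∀ (r : F) (ω : Ω[F⁄k]), ℓ (r • ω) = φ r * ℓ ω)
    (hD : ∀ x : F, ℓ (D k F x) = LaurentField.derivation k (φ x)) {ω : Ω[F⁄k]}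
    (hω : ω ∈ regularDifferentials k F) : ℓ ω ∈ LaurentField.integers k := by
  let A := (LaurentField.integers k).comap φ
  have hA : ∀ x : F, x ∈ A ∨ x⁻¹ ∈ A := fun x => by
    have := LaurentField.mem_or_inv_mem_integers (φ x)
    rwa [← map_inv₀] at this
  have hmem : ω ∈ Submodule.span A (D k F '' (A : Set F)) := by
    have := (Submodule.mem_iInf _).1 ((Submodule.mem_iInf _).1 hω A) hA
    exact this
  clear hω
  induction hmem using Submodule.span_induction with
  | mem _ h =>
    obtain ⟨x, hx, rfl⟩ := h
    rw [hD]
    exact LaurentField.derivation_mem_integers hx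
  | zero => rw [map_zero]; exact zero_mem _
  | add _ _ _ _ h₁ h₂ => rw [map_add]; exact add_mem h₁ h₂
  | smul a _ _ h =>
    rw [Subalgebra.smul_def, hℓ]
    exact mul_mem a.2 h

end KaehlerAlongHom

/-! ### Five regular differentials. -/

section RegularDifferentials

open Polynomial KaehlerDifferential

variable {k F : Type*} [Field k] [Field F] [Algebra k F]

theorem Subalgebra.mem_of_sq_mem {A : Subalgebra k F} (hA : ∀ x : F, x ∈ A ∨ x⁻¹ ∈ A) {x : F}
    (hx : x ^ 2 ∈ A) : x ∈ A := by
  rcases hA x with h | h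
  · exact h
  · rcases eq_or_ne x 0 with rfl | h0
    · exact zero_mem A
    · have := mul_mem hx h
      rwa [sq, mul_inv_cancel_right₀ h0] at this

/-- From `uh + vh' = 1` and `h'(x) dx = 2w dw` one gets `dx/w = u(x) w dx + 2v(x) dw`, which is
regular also where `w` vanishes. -/
theorem inv_smul_D_mem_span {A : Subalgebra k F} {x w : F} (hx : x ∈ A) (hw : w ∈ A) {h : k[X]}
    (hh : h.Separable) (hwh : w ^ 2 = aeval x h) :
    w⁻¹ • D k F x ∈ Submodule.span A (D k F '' (A : Set F)) := by
  rcases eq_or_ne w 0 with rfl | hw0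
  · rw [inv_zero, zero_smul]; exact zero_mem _
  obtain ⟨u, v, huv⟩ := hh
  have huv' : aeval x u * w ^ 2 + aeval x v * aeval x (derivative h) = 1 := by
    rw [hwh, ← map_mul, ← map_mul, ← map_add, huv, map_one]
  have hD : aeval x (derivative h) • D k F x = (2 * w) • D k F w := by
    rw [← Derivation.map_aeval, ← hwh, Derivation.leibniz_pow, ← Nat.cast_smul_eq_nsmul F, smul_smul]
    simp
  have key : w⁻¹ • D k F x =
      (aeval x u * w) • D k F x + (2 * aeval x v) • D k F w := by
    calc w⁻¹ • D k F x
        = (w⁻¹ * (aeval x u * w ^ 2 + aeval x v * aeval x (derivative h))) • D k F x := by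
          rw [huv', mul_one]
      _ = (aeval x u * w) • D k F x +
          (w⁻¹ * aeval x v) • aeval x (derivative h) • D k F x := by
          rw [smul_smul, ← add_smul]
          congr 1
          field_simp
      _ = _ := by
          rw [hD, smul_smul]
          congr 2
          field_simp
  have haeval (p : k[X]) : aeval x p ∈ A := by
    have := (aeval (⟨x, hx⟩ : A) p).2
    rwa [← Subalgebra.coe_val, ← aeval_algHom_apply] at this
  rw [key]
  refine add_mem ?_ ?_
  · exact Submodule.smul_mem _ (⟨_, mul_mem (haeval u) hw⟩ : A) (Submodule.subset_span ⟨x, hx, rfl⟩)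
  · exact Submodule.smul_mem _ (⟨_, mul_mem (ofNat_mem A 2) (haeval v)⟩ : A)
      (Submodule.subset_span ⟨w, hw, rfl⟩)

theorem aeval_inv_reverse_mul_pow (x : F) (hx : x ≠ 0) (p : k[X]) :
    aeval x⁻¹ p.reverse * x ^ p.natDegree = aeval x p := by
  let := invertibleOfNonzero hx
  have := eval₂_reverse_mul_pow (algebraMap k F) x p
  rwa [invOf_eq_inv] at this

/-- Quartics `f`, `g` such that `fg` is separable of degree eight, also at infinity. -/
structure IsQuarticPair (f g : k[X]) : Prop where
  natDegree_first : f.natDegree = 4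
  natDegree_second : g.natDegree = 4
  separable : (f * g).Separable
  separable_reverse : (f.reverse * g.reverse).Separable

variable {f g : k[X]} {v : Fin 3 → F}

theorem IsBiquadraticTriple.mul_sq (hv : IsBiquadraticTriple f g v) :
    (v 1 * v 2) ^ 2 = aeval (v 0) (f * g) := by
  rw [mul_pow, hv.first, hv.second, map_mul]

/-- The coefficients of `dq` in the five basic differentials
`dq/yz`, `q dq/yz`, `q² dq/yz`, `dq/y`, `dq/z`. -/
def basicCoeff (v : Fin 3 → F) : Fin 5 → F :=
  ![(v 1 * v 2)⁻¹, v 0 * (v 1 * v 2)⁻¹, v 0 ^ 2 * (v 1 * v 2)⁻¹, (v 1)⁻¹, (v 2)⁻¹]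

theorem basicCoeff_smul_D_mem_regularDifferentials (hfg : IsQuarticPair f g)
    (hv : IsBiquadraticTriple f g v) (i : Fin 5) :
    basicCoeff v i • D k F (v 0) ∈ regularDifferentials k F := by
  refine (Submodule.mem_iInf _).2 fun A => (Submodule.mem_iInf _).2 fun hA => ?_
  change basicCoeff v i • D k F (v 0) ∈ Submodule.span A (D k F '' (A : Set F))
  have hmem {x w : F} {h : k[X]} (hx : x ∈ A) (hwh : w ^ 2 = aeval x h) : w ∈ A := by
    refine Subalgebra.mem_of_sq_mem hA ?_
    have := (aeval (⟨x, hx⟩ : A) h).2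
    rwa [← Subalgebra.coe_val, ← aeval_algHom_apply, Subalgebra.coe_val, ← hwh] at this
  have key {x w r : F} {h : k[X]} (hx : x ∈ A) (hh : h.Separable) (hwh : w ^ 2 = aeval x h)
      (hr : r ∈ A) : (r * w⁻¹) • D k F x ∈ Submodule.span A (D k F '' (A : Set F)) := by
    rw [mul_smul]
    exact Submodule.smul_mem _ (⟨r, hr⟩ : A) (inv_smul_D_mem_span hx (hmem hx hwh) hh hwh)
  by_cases hq : v 0 ∈ A
  · have h₁ {r : F} (hr : r ∈ A) := key hq hfg.separable hv.mul_sq hr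
    have h₂ := key hq hfg.separable.of_mul_left hv.first (one_mem A)
    have h₃ := key hq hfg.separable.of_mul_right hv.second (one_mem A)
    rw [one_mul] at h₂ h₃
    fin_cases i
    · have := h₁ (one_mem A)
      rwa [one_mul] at this
    · exact h₁ hq
    · exact h₁ (pow_mem hq 2)
    · exact h₂
    · exact h₃
  -- At a pole of `q` the chart `s = 1/q`, `ys²`, `zs²` satisfies the reversed equations, and `dq =
  -- -s⁻² ds`.
  · have hs : (v 0)⁻¹ ∈ A := (hA _).resolve_left hq
    have hq0 : v 0 ≠ 0 := fun h => hq (h ▸ zero_mem A)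
    set s := (v 0)⁻¹ with hs_def
    have hs0 : s ≠ 0 := inv_ne_zero hq0
    have hqs : v 0 = s⁻¹ := by rw [hs_def, inv_inv]
    have hf : (v 1 * s ^ 2) ^ 2 = aeval s f.reverse := by
      rw [mul_pow, hv.first, ← aeval_inv_reverse_mul_pow _ hq0, hfg.natDegree_first, ← hs_def, hqs]
      field_simp
    have hg : (v 2 * s ^ 2) ^ 2 = aeval s g.reverse := by
      rw [mul_pow, hv.second, ← aeval_inv_reverse_mul_pow _ hq0, hfg.natDegree_second, ← hs_def,
        hqs]
      field_simp
    have hm : ((v 1 * s ^ 2) * (v 2 * s ^ 2)) ^ 2 = aeval s (f.reverse * g.reverse) := by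
      rw [mul_pow, hf, hg, map_mul]
    have hD (r : F) : r • D k F (v 0) = (-(r * s⁻¹ ^ 2)) • D k F s := by
      rw [hqs, Derivation.leibniz_inv, smul_smul, mul_neg]
    have hneg {r : F} (hr : r ∈ A) : -r ∈ A := neg_mem hr
    have h₁ {r : F} (hr : r ∈ A) := key hs hfg.separable_reverse hm hr
    have h₂ := key hs hfg.separable_reverse.of_mul_left hf (hneg (one_mem A))
    have h₃ := key hs hfg.separable_reverse.of_mul_right hg (hneg (one_mem A))
    rw [hD]
    fin_cases i
    · convert h₁ (hneg (pow_mem hs 2)) using 2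
      simp only [basicCoeff, Fin.zero_eta, Matrix.cons_val_zero, mul_inv]
      field_simp
    · convert h₁ (hneg hs) using 2
      simp only [basicCoeff, Fin.mk_one, Matrix.cons_val_one, Matrix.cons_val_zero, mul_inv, hqs]
      field_simp
    · convert h₁ (hneg (one_mem A)) using 2
      simp only [basicCoeff, Fin.reduceFinMk, Matrix.cons_val, mul_inv, hqs]
      field_simp
    · convert h₂ using 2
      simp only [basicCoeff, Fin.reduceFinMk, Matrix.cons_val, mul_inv]
      field_simp
    · convert h₃ using 2
      simp only [basicCoeff, Fin.reduceFinMk, Matrix.cons_val, mul_inv]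
      field_simp

/-- Differentiating `y² = f(q)`, `z² = g(q)` puts `dy` and `dz` in the span of `dq`, and every
element is rational in `q, y, z`. -/
theorem IsBiquadraticField.exists_smul_D_eq [CharZero k] (hv : IsBiquadraticField f g v)
    (hf : f ≠ 0) (hg : g ≠ 0) (ω : Ω[F⁄k]) : ∃ r : F, r • D k F (v 0) = ω := by
  have : CharZero F := charZero_of_injective_algebraMap (algebraMap k F).injective
  set N := Submodule.span F {D k F (v 0)} with hN
  have hq : D k F (v 0) ∈ N := Submodule.mem_span_singleton_self _
  have hp (p : k[X]) : D k F (aeval (v 0) p) ∈ N := by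
    rw [Derivation.map_aeval]
    exact N.smul_mem _ hq
  have hmul {x y : F} (hx : D k F x ∈ N) (hy : D k F y ∈ N) : D k F (x * y) ∈ N := by
    rw [Derivation.leibniz]
    exact N.add_mem (N.smul_mem _ hy) (N.smul_mem _ hx)
  have hsqrt {w : F} {h : k[X]} (hh : h ≠ 0) (hw : w ^ 2 = aeval (v 0) h) : D k F w ∈ N := by
    have hw0 : w ≠ 0 := by
      rintro rfl
      refine hh (hv.injective ?_)
      rw [← hw, map_zero, zero_pow two_ne_zero]
    have h1 := hp h
    rw [← hw, Derivation.leibniz_pow, ← Nat.cast_smul_eq_nsmul F, smul_smul] at h1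
    exact (N.smul_mem_iff (mul_ne_zero (by norm_num) (pow_ne_zero _ hw0))).1 h1
  have hy := hsqrt hf hv.first
  have hz := hsqrt hg hv.second
  have hall (h : F) : D k F h ∈ N := by
    obtain ⟨a, b, c, d, s, hs, h'⟩ := hv.exists_combination h
    have hs0 : aeval (v 0) s ≠ 0 := fun h0 => hs (hv.injective (h0.trans (map_zero _).symm))
    have h1 : D k F (aeval (v 0) s * h) ∈ N := by
      rw [h', combination, map_add, map_add, map_add]
      exact N.add_mem (N.add_mem (N.add_mem (hp a) (hmul (hp b) hy)) (hmul (hp c) hz))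
        (hmul (hp d) (hmul hy hz))
    rw [Derivation.leibniz] at h1
    exact (N.smul_mem_iff hs0).1 ((N.add_mem_iff_left (N.smul_mem _ (hp s))).1 h1)
  have htop : N = ⊤ := by
    rw [eq_top_iff, ← KaehlerDifferential.span_range_derivation, Submodule.span_le]
    rintro _ ⟨x, rfl⟩
    exact hall x
  have : ω ∈ N := htop ▸ Submodule.mem_top
  exact Submodule.mem_span_singleton.1 this

end RegularDifferentials

/-! ### Local parametrizations at finite points and at infinity. -/

section LaurentTriples

open Polynomial

variable {k : Type*} [Field k]

/-- If `p(x) = 0`, differentiating gives `p'(x) = 0`, and the degree drops until `p` is constant. -/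
theorem LaurentField.aeval_injective_of_derivation_ne_zero [CharZero k] {x : LaurentField k}
    (hx : LaurentField.derivation k x ≠ 0) : Function.Injective (aeval (R := k) x) := by
  rw [injective_iff_map_eq_zero]
  intro p
  induction hn : p.natDegree using Nat.strong_induction_on generalizing p with
  | _ n ih =>
    intro hp
    have h0 : p.natDegree = 0 := by
      by_contra h0
      have hp' : aeval x (derivative p) = 0 := by
        have := Derivation.map_aeval (LaurentField.derivation k) p x
        rw [hp, map_zero, smul_eq_mul] at this
        exact (mul_eq_zero.1 this.symm).resolve_right hx
      exact h0 (derivative_eq_zero.1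
        (ih _ (hn ▸ natDegree_derivative_lt h0) _ rfl hp'))
    rw [eq_C_of_natDegree_eq_zero h0, aeval_C, map_eq_zero] at hp
    rw [eq_C_of_natDegree_eq_zero h0, hp, C_0]

theorem LaurentField.aeval_ofPowerSeries (x : PowerSeries k) (p : k[X]) :
    aeval (ofPowerSeries k x) p = ofPowerSeries k (aeval x p) :=
  aeval_algHom_apply _ _ _

theorem constantCoeff_aeval_powerSeries (x : PowerSeries k) (p : k[X]) :
    PowerSeries.constantCoeff (aeval x p) = p.eval (PowerSeries.constantCoeff x) := by
  change PowerSeries.constantCoeff (eval₂ (algebraMap k (PowerSeries k)) x p) = _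
  rw [hom_eval₂]
  have : (PowerSeries.constantCoeff (R := k)).comp (algebraMap k (PowerSeries k)) =
    RingHom.id k := by ext; simp
  rw [this]
  rfl

namespace LaurentField

/-- The uniformizer `t`. -/
noncomputable def t (k : Type*) [Field k] : LaurentField k := ofPowerSeries k PowerSeries.X

theorem t_ne_zero : t k ≠ 0 := by
  rw [t, Ne, map_eq_zero_iff _ ofPowerSeries_injective]
  exact PowerSeries.X_ne_zero

theorem derivation_t : derivation k (t k) = 1 := by
  rw [t, derivation_ofPowerSeries, PowerSeries.derivative_X, map_one]

theorem derivation_C_add_X_sq (α : k) :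
    derivation k (ofPowerSeries k (PowerSeries.C α + PowerSeries.X ^ 2)) = 2 * t k := by
  rw [derivation_ofPowerSeries, map_add, PowerSeries.derivative_C, zero_add, Derivation.leibniz_pow,
    PowerSeries.derivative_X, t, ← map_ofNat (ofPowerSeries k), ← map_mul]
  congr 1
  simp [two_mul]

end LaurentField

/-- After division by the gcd, a root `α` of the remaining denominator contributes at least `t²`,
while the numerator, nonzero at `α`, contributes only the single explicit `t`. That factor comes
from `dq = 2t dt`. -/
theorem dvd_of_forall_X_mul_aeval [IsAlgClosed k] [CharZero k] {e s : k[X]} (hs : s ≠ 0)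
    (h : ∀ α : k, ∃ o : PowerSeries k, PowerSeries.X * aeval (PowerSeries.C α + PowerSeries.X ^ 2) e
      = aeval (PowerSeries.C α + PowerSeries.X ^ 2) s * o) : s ∣ e := by
  classical
  obtain ⟨e', he'⟩ := EuclideanDomain.gcd_dvd_left e s
  obtain ⟨s', hs'⟩ := EuclideanDomain.gcd_dvd_right e s
  set d := EuclideanDomain.gcd e s with hd
  have hd0 : d ≠ 0 := by rintro h0; rw [h0, zero_mul] at hs'; exact hs hs'
  have hcop : IsCoprime e' s' := by
    obtain ⟨a, b, hab⟩ : ∃ a b, a * e + b * s = d :=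
      ⟨EuclideanDomain.gcdA e s,
      EuclideanDomain.gcdB e s, by rw [hd, EuclideanDomain.gcd_eq_gcd_ab e s]; ring⟩
    refine ⟨a, b, mul_left_cancel₀ hd0 ?_⟩
    linear_combination hab - a * he' - b * hs'
  by_cases hunit : IsUnit s'
  · rw [hs', hunit.mul_right_dvd]
    exact Dvd.intro _ he'.symm
  exfalso
  have hdeg : s'.degree ≠ 0 := fun h0 => hunit (isUnit_iff_degree_eq_zero.2 h0)
  obtain ⟨α, hα⟩ := IsAlgClosed.exists_root s' hdeg
  obtain ⟨o, ho⟩ := h α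
  obtain ⟨s'', hs''⟩ := dvd_iff_isRoot.2 hα
  set x : PowerSeries k := PowerSeries.C α + PowerSeries.X ^ 2 with hx
  have hdx : aeval x d ≠ 0 := by
    rw [← map_ne_zero_iff _ LaurentField.ofPowerSeries_injective,
      ← LaurentField.aeval_ofPowerSeries,
      map_ne_zero_iff _ (LaurentField.aeval_injective_of_derivation_ne_zero ?_)]
    · exact hd0
    · rw [LaurentField.derivation_C_add_X_sq]
      have := charZero_of_injective_algebraMap (algebraMap k (LaurentField k)).injective
      exact mul_ne_zero two_ne_zero LaurentField.t_ne_zero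
  have h₁ : PowerSeries.X * aeval x e' = PowerSeries.X ^ 2 * (aeval x s'' * o) := by
    refine mul_left_cancel₀ hdx ?_
    have hX : aeval x (X - C α) = PowerSeries.X ^ 2 := by
      simp [hx, PowerSeries.algebraMap_eq]
    have e₁ := congrArg (aeval x) he'
    have e₂ := congrArg (aeval x) hs'
    have e₃ := congrArg (aeval x) hs''
    rw [map_mul] at e₁ e₂ e₃
    rw [hX] at e₃
    linear_combination ho - PowerSeries.X * e₁ + o * e₂ + aeval x d * o * e₃
  have h₂ : aeval x e' = PowerSeries.X * (aeval x s'' * o) := by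
    refine mul_left_cancel₀ PowerSeries.X_ne_zero ?_
    rw [h₁]; ring
  have h₃ := congrArg PowerSeries.constantCoeff h₂
  rw [constantCoeff_aeval_powerSeries] at h₃
  have h₄ : e'.IsRoot α := by simpa [hx] using h₃
  obtain ⟨a, b, hab⟩ := hcop
  have := congrArg (eval α) hab
  rw [eval_add, eval_mul, eval_mul, h₄, hα] at this
  simp at this

namespace LaurentField

theorem derivation_inv_t : derivation k (t k)⁻¹ = -(t k)⁻¹ ^ 2 := by
  rw [Derivation.leibniz_inv, derivation_t, smul_eq_mul, mul_one]

theorem natDegree_le_of_aeval_inv_t_mul_mem {p : k[X]} {n : ℕ}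
    (h : aeval (t k)⁻¹ p * t k ^ n ∈ integers k) : p.natDegree ≤ n := by
  by_contra! hlt
  obtain ⟨o, ho⟩ := h
  have h₁ := aeval_inv_reverse_mul_pow (t k)⁻¹ (inv_ne_zero t_ne_zero) p
  rw [inv_inv] at h₁
  have h₂ : aeval (t k) p.reverse = t k ^ (p.natDegree - n) * ofPowerSeries k o := by
    have ht : (t k)⁻¹ ^ p.natDegree * t k ^ p.natDegree = 1 := by
      rw [← mul_pow, inv_mul_cancel₀ t_ne_zero, one_pow]
    have hpow : t k ^ (p.natDegree - n) * t k ^ n = t k ^ p.natDegree := by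
      rw [← pow_add, Nat.sub_add_cancel hlt.le]
    change ofPowerSeries k o = _ at ho
    rw [ho]
    linear_combination -(aeval (t k) p.reverse) * ht + t k ^ p.natDegree * h₁ -
      aeval (t k)⁻¹ p * hpow
  rw [t, aeval_ofPowerSeries, ← map_pow, ← map_mul] at h₂
  have h₃ := congrArg PowerSeries.constantCoeff (ofPowerSeries_injective h₂)
  rw [constantCoeff_aeval_powerSeries, map_mul, map_pow, PowerSeries.constantCoeff_X,
    zero_pow (Nat.sub_ne_zero_of_lt hlt), zero_mul, ← coeff_zero_eq_eval_zero,
    coeff_zero_reverse, leadingCoeff_eq_zero] at h₃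
  rw [h₃] at hlt
  simp at hlt

/-- At infinity, `y` is a unit times `t⁻²`. -/
theorem exists_sq_eq_aeval_inv_t [IsAlgClosed k] [CharZero k] {f : k[X]} (hf : f.natDegree = 4) :
    ∃ u : LaurentField k, (u * (t k)⁻¹ ^ 2) ^ 2 = aeval (t k)⁻¹ f ∧ u ∈ integers k ∧ u ≠ 0 := by
  have hc : PowerSeries.constantCoeff (aeval (PowerSeries.X : PowerSeries k) f.reverse) ≠ 0 := by
    rw [constantCoeff_aeval_powerSeries, PowerSeries.constantCoeff_X, ← coeff_zero_eq_eval_zero,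
      coeff_zero_reverse, Ne, leadingCoeff_eq_zero]
    rintro rfl
    simp at hf
  obtain ⟨w, hw⟩ := PowerSeries.exists_sq_eq hc
  refine ⟨ofPowerSeries k w, ?_, ofPowerSeries_mem_integers w, ?_⟩
  · rw [mul_pow, ← map_pow, hw, ← aeval_inv_reverse_mul_pow _ (inv_ne_zero t_ne_zero), hf, inv_inv,
      ← aeval_ofPowerSeries]
    change aeval (t k) f.reverse * _ = _
    ring
  · rw [Ne, map_eq_zero_iff _ ofPowerSeries_injective]
    rintro rfl
    exact hc (by rw [← hw]; simp)

/-- At a finite point, `√h(α + t²)` exists for separable `h`. -/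
theorem exists_sq_eq_aeval [IsAlgClosed k] [CharZero k] {h : k[X]} (hh : h.Separable) (α : k) :
    ∃ w : PowerSeries k, w ^ 2 = aeval (PowerSeries.C α + PowerSeries.X ^ 2) h := by
  set x : PowerSeries k := PowerSeries.C α + PowerSeries.X ^ 2 with hx
  have hx0 : PowerSeries.constantCoeff x = α := by simp [hx]
  by_cases hα : h.IsRoot α
  · obtain ⟨p, hp⟩ := dvd_iff_isRoot.2 hα
    have hpα : PowerSeries.constantCoeff (aeval x p) ≠ 0 := by
      rw [constantCoeff_aeval_powerSeries, hx0]
      obtain ⟨u, v, huv⟩ := hh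
      intro h0
      have := congrArg (eval α) huv
      rw [hp, derivative_mul] at this
      simp [h0] at this
    obtain ⟨w, hw⟩ := PowerSeries.exists_sq_eq hpα
    refine ⟨PowerSeries.X * w, ?_⟩
    rw [mul_pow, hw, hp, map_mul]
    simp [hx, PowerSeries.algebraMap_eq]
  · refine PowerSeries.exists_sq_eq ?_
    rw [constantCoeff_aeval_powerSeries, hx0]
    exact hα

end LaurentField

end LaurentTriples

/-! ### The space of regular differentials has dimension five. -/

section Genus

open Polynomial KaehlerDifferential LaurentField

variable {k F : Type*} [Field k] [Field F] [Algebra k F] {f g : k[X]}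

theorem IsBiquadraticTriple.ne_zero {v : Fin 3 → F} (hv : IsBiquadraticTriple f g v) (hf : f ≠ 0)
    (hg : g ≠ 0) : v 1 ≠ 0 ∧ v 2 ≠ 0 := by
  constructor
  · intro h
    refine hf (hv.injective ?_)
    rw [← hv.first, h, map_zero, zero_pow two_ne_zero]
  · intro h
    refine hg (hv.injective ?_)
    rw [← hv.second, h, map_zero, zero_pow two_ne_zero]

theorem LaurentField.mem_integers_of_natCast_mul_mem [CharZero k] {x : LaurentField k} {n : ℕ}
    (hn : n ≠ 0) (h : (n : LaurentField k) * x ∈ integers k) : x ∈ integers k := by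
  have h0 : (n : LaurentField k) ≠ 0 := by
    rw [← map_natCast (algebraMap k (LaurentField k)), _root_.map_ne_zero]
    exact_mod_cast hn
  have hinv : (n : LaurentField k)⁻¹ ∈ integers k := by
    rw [← map_natCast (algebraMap k (LaurentField k)), ← map_inv₀]
    exact (integers k).algebraMap_mem _
  have := mul_mem hinv h
  rwa [inv_mul_cancel_left₀ h0] at this

/-- The components of a regular differential are separately integral along any parametrization:
changing the signs of `y` and `z` gives four integrality conditions. -/
theorem IsBiquadraticField.components_mem_integers [CharZero k] {v : Fin 3 → F}
    (hv : IsBiquadraticField f g v) (hf : f ≠ 0) (hg : g ≠ 0) {r : F} {a b c d s : k[X]}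
    (hs : s ≠ 0) (hr : aeval (v 0) s * (r * (v 1 * v 2)) = combination v a b c d)
    (hω : r • D k F (v 0) ∈ regularDifferentials k F) {q y z : LaurentField k}
    (hv' : IsBiquadraticTriple f g ![q, y, z]) :
    aeval q a * (derivation k q / aeval q s) * (y * z)⁻¹ ∈ integers k ∧
    aeval q b * (derivation k q / aeval q s) * z⁻¹ ∈ integers k ∧
    aeval q c * (derivation k q / aeval q s) * y⁻¹ ∈ integers k ∧
    aeval q d * (derivation k q / aeval q s) ∈ integers k := by
  obtain ⟨hy0, hz0⟩ := hv'.ne_zero hf hg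
  change y ≠ 0 at hy0
  change z ≠ 0 at hz0
  have hs0 : aeval q s ≠ 0 := fun h => hs (hv'.injective (h.trans (map_zero _).symm))
  set τ := derivation k q / aeval q s with hτ
  -- `(q, ε₁y, ε₂z)` satisfies the same equations, so it defines another embedding of `F`. The four
  -- sign choices then isolate each component up to the factor 4.
  have key (ε₁ ε₂ : LaurentField k) (h₁ : ε₁ ^ 2 = 1) (h₂ : ε₂ ^ 2 = 1) :
      aeval q a * τ * (y * z)⁻¹ * (ε₁ * ε₂) + aeval q b * τ * z⁻¹ * ε₂ +
        aeval q c * τ * y⁻¹ * ε₁ + aeval q d * τ ∈ integers k := by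
    have hε₁ : ε₁ ≠ 0 := by rintro rfl; simp at h₁
    have hε₂ : ε₂ ≠ 0 := by rintro rfl; simp at h₂
    have htriple : IsBiquadraticTriple f g ![q, ε₁ * y, ε₂ * z] := by
      refine ⟨hv'.injective, ?_, ?_⟩
      · change (ε₁ * y) ^ 2 = _
        rw [mul_pow, h₁, one_mul]
        exact hv'.first
      · change (ε₂ * z) ^ 2 = _
        rw [mul_pow, h₂, one_mul]
        exact hv'.second
    obtain ⟨φ, hφ⟩ := hv.exists_algHom _ htriple
    have hφq : φ (v 0) = q := congrFun hφ 0
    have hφy : φ (v 1) = ε₁ * y := congrFun hφ 1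
    have hφz : φ (v 2) = ε₂ * z := congrFun hφ 2
    obtain ⟨ℓ, hℓ, hD⟩ := exists_evalDifferential φ
    have hmem := mem_integers_of_mem_regularDifferentials hℓ hD hω
    rw [hℓ, hD, hφq] at hmem
    have hr' := congrArg φ hr
    rw [map_combination, hφ, map_mul, map_mul, map_mul, ← aeval_algHom_apply, hφq, hφy, hφz] at hr'
    simp only [combination, Matrix.cons_val_zero, Matrix.cons_val_one, Matrix.cons_val] at hr'
    convert hmem using 1
    rw [hτ]
    have hφr : φ r = (aeval q a + aeval q b * (ε₁ * y) + aeval q c * (ε₂ * z) +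
        aeval q d * (ε₁ * y * (ε₂ * z))) / (aeval q s * (ε₁ * y * (ε₂ * z))) := by
      rw [← hr']
      field_simp
    rw [hφr]
    field_simp
    ring_nf
    rw [h₁, h₂]
    ring
  have hpp := key 1 1 (by ring) (by ring)
  have hpm := key 1 (-1) (by ring) (by ring)
  have hmp := key (-1) 1 (by ring) (by ring)
  have hmm := key (-1) (-1) (by ring) (by ring)
  refine ⟨?_, ?_, ?_, ?_⟩ <;> refine mem_integers_of_natCast_mul_mem four_ne_zero ?_
  · convert sub_mem (add_mem hpp hmm) (add_mem hpm hmp) using 1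
    push_cast; ring
  · convert sub_mem (add_mem hpp hmp) (add_mem hpm hmm) using 1
    push_cast; ring
  · convert sub_mem (add_mem hpp hpm) (add_mem hmp hmm) using 1
    push_cast; ring
  · convert add_mem (add_mem hpp hmm) (add_mem hpm hmp) using 1
    push_cast; ring

theorem IsQuarticPair.ne_zero (h : IsQuarticPair f g) : f ≠ 0 ∧ g ≠ 0 :=
  ⟨left_ne_zero_of_mul h.separable.ne_zero, right_ne_zero_of_mul h.separable.ne_zero⟩

theorem IsQuarticPair.isIndependentPair [IsAlgClosed k] (h : IsQuarticPair f g) :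
    IsIndependentPair f g := by
  obtain ⟨hf, hg⟩ := h.ne_zero
  have hdeg {p : k[X]} (hp : p.natDegree ≠ 0) : p.degree ≠ 0 := fun h0 =>
    hp (natDegree_eq_of_degree_eq_some h0)
  have h₁ := h.natDegree_first
  have h₂ := h.natDegree_second
  exact ⟨eq_zero_of_sq_mul_eq_sq h.separable.of_mul_left (hdeg (by omega)),
    eq_zero_of_sq_mul_eq_sq h.separable.of_mul_right (hdeg (by omega)),
    eq_zero_of_sq_mul_eq_sq h.separable (hdeg (by rw [natDegree_mul hf hg]; omega))⟩

/-- A parametrization of the curve at infinity. -/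
theorem IsQuarticPair.exists_triple_infinity [IsAlgClosed k] [CharZero k]
    (h : IsQuarticPair f g) : ∃ u w : LaurentField k, u ∈ integers k ∧ w ∈ integers k ∧ u ≠ 0 ∧
      w ≠ 0 ∧ IsBiquadraticTriple f g ![(t k)⁻¹, u * (t k)⁻¹ ^ 2, w * (t k)⁻¹ ^ 2] := by
  obtain ⟨u, hu, hu', hu0⟩ := exists_sq_eq_aeval_inv_t h.natDegree_first
  obtain ⟨w, hw, hw', hw0⟩ := exists_sq_eq_aeval_inv_t h.natDegree_second
  refine ⟨u, w, hu', hw', hu0, hw0, aeval_injective_of_derivation_ne_zero ?_, hu, hw⟩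
  change derivation k (t k)⁻¹ ≠ 0
  rw [derivation_inv_t]
  exact neg_ne_zero.2 (pow_ne_zero _ (inv_ne_zero t_ne_zero))

theorem IsBiquadraticField.dvd_of_mem_regularDifferentials [IsAlgClosed k] [CharZero k]
    {v : Fin 3 → F} (hv : IsBiquadraticField f g v) (hfg : IsQuarticPair f g) {r : F}
    {a b c d s : k[X]} (hs : s ≠ 0)
    (hr : aeval (v 0) s * (r * (v 1 * v 2)) = combination v a b c d)
    (hω : r • D k F (v 0) ∈ regularDifferentials k F) : s ∣ a ∧ s ∣ b ∧ s ∣ c ∧ s ∣ d := by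
  obtain ⟨hf, hg⟩ := hfg.ne_zero
  have key (α : k) : ∀ e ∈ ({a, b, c, d} : Set k[X]), ∃ o : PowerSeries k,
      PowerSeries.X * aeval (PowerSeries.C α + PowerSeries.X ^ 2) e =
        aeval (PowerSeries.C α + PowerSeries.X ^ 2) s * o := by
    set x : PowerSeries k := PowerSeries.C α + PowerSeries.X ^ 2 with hx
    obtain ⟨y, hy⟩ := exists_sq_eq_aeval hfg.separable.of_mul_left α
    obtain ⟨z, hz⟩ := exists_sq_eq_aeval hfg.separable.of_mul_right α
    have hdx : derivation k (ofPowerSeries k x) = 2 * t k := derivation_C_add_X_sq α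
    have h2 : (2 : LaurentField k) ≠ 0 :=
      have := charZero_of_injective_algebraMap (algebraMap k (LaurentField k)).injective
      two_ne_zero
    have hv' : IsBiquadraticTriple f g
        ![ofPowerSeries k x, ofPowerSeries k y, ofPowerSeries k z] := by
      refine ⟨aeval_injective_of_derivation_ne_zero ?_, ?_, ?_⟩
      · change derivation k (ofPowerSeries k x) ≠ 0
        rw [hdx]
        exact mul_ne_zero h2 t_ne_zero
      · change ofPowerSeries k y ^ 2 = aeval (ofPowerSeries k x) f
        rw [aeval_ofPowerSeries, ← map_pow, hy]
      · change ofPowerSeries k z ^ 2 = aeval (ofPowerSeries k x) g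
        rw [aeval_ofPowerSeries, ← map_pow, hz]
    have hs0 : aeval (ofPowerSeries k x) s ≠ 0 :=
      fun h => hs (hv'.injective (h.trans (map_zero _).symm))
    obtain ⟨hy0, hz0⟩ := hv'.ne_zero hf hg
    change ofPowerSeries k y ≠ 0 at hy0
    change ofPowerSeries k z ≠ 0 at hz0
    obtain ⟨h₁, h₂, h₃, h₄⟩ := hv.components_mem_integers hf hg hs hr hω hv'
    have h₁' := mul_mem h₁ (mul_mem (ofPowerSeries_mem_integers y) (ofPowerSeries_mem_integers z))
    rw [inv_mul_cancel_right₀ (mul_ne_zero hy0 hz0)] at h₁'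
    have h₂' := mul_mem h₂ (ofPowerSeries_mem_integers z)
    rw [inv_mul_cancel_right₀ hz0] at h₂'
    have h₃' := mul_mem h₃ (ofPowerSeries_mem_integers y)
    rw [inv_mul_cancel_right₀ hy0] at h₃'
    have conclude {e : k[X]} (he : aeval (ofPowerSeries k x) e * (derivation k (ofPowerSeries k x) /
        aeval (ofPowerSeries k x) s) ∈ integers k) :
        ∃ o : PowerSeries k, PowerSeries.X * aeval x e = aeval x s * o := by
      rw [hdx, mul_div_assoc, mul_left_comm] at he
      obtain ⟨o, ho⟩ := mem_integers.1 (mem_integers_of_natCast_mul_mem two_ne_zero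
        (by exact_mod_cast he))
      refine ⟨o, ofPowerSeries_injective ?_⟩
      rw [map_mul, map_mul, ho, ← aeval_ofPowerSeries, ← aeval_ofPowerSeries]
      change t k * _ = _
      field_simp
    rintro e (rfl | rfl | rfl | rfl)
    · exact conclude h₁'
    · exact conclude h₂'
    · exact conclude h₃'
    · exact conclude h₄
  refine ⟨?_, ?_, ?_, ?_⟩ <;> exact dvd_of_forall_X_mul_aeval hs fun α => key α _ (by simp)

theorem IsBiquadraticField.exists_combination_of_mem_regularDifferentials [IsAlgClosed k]
    [CharZero k] {v : Fin 3 → F} (hv : IsBiquadraticField f g v) (hfg : IsQuarticPair f g) {r : F}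
    (hω : r • D k F (v 0) ∈ regularDifferentials k F) :
    ∃ a b c : k[X], a.natDegree ≤ 2 ∧ b.natDegree = 0 ∧ c.natDegree = 0 ∧
      r * (v 1 * v 2) = combination v a b c 0 := by
  obtain ⟨hf, hg⟩ := hfg.ne_zero
  obtain ⟨a, b, c, d, s, hs, hr⟩ := hv.exists_combination (r * (v 1 * v 2))
  obtain ⟨⟨a, rfl⟩, ⟨b, rfl⟩, ⟨c, rfl⟩, ⟨d, rfl⟩⟩ := hv.dvd_of_mem_regularDifferentials hfg hs hr hω
  have hs0 : aeval (v 0) s ≠ 0 := fun h => hs (hv.injective (h.trans (map_zero _).symm))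
  have hr' : r * (v 1 * v 2) = combination v a b c d := by
    refine mul_left_cancel₀ hs0 (hr.trans ?_)
    simp only [combination, map_mul]
    ring
  obtain ⟨u, w, hu, hw, hu0, hw0, hv'⟩ := hfg.exists_triple_infinity
  obtain ⟨h₁, h₂, h₃, h₄⟩ := hv.components_mem_integers hf hg one_ne_zero
    (by rw [map_one, one_mul, hr']) hω hv'
  rw [map_one, div_one, derivation_inv_t] at h₁ h₂ h₃ h₄
  have ht : t k ≠ 0 := t_ne_zero
  -- At infinity `dq = -t⁻² dt`, while `y` and `z` are integral multiples of `t⁻²`: the components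
  -- are bounded by degrees 2, 0 and 0, and the last leaves `t⁻² d(1/t)` integral, so `d = 0`.
  have ha : a.natDegree ≤ 2 := by
    refine natDegree_le_of_aeval_inv_t_mul_mem ?_
    convert neg_mem (mul_mem h₁ (mul_mem hu hw)) using 1
    field_simp
  have hb : b.natDegree ≤ 0 := by
    refine natDegree_le_of_aeval_inv_t_mul_mem ?_
    convert neg_mem (mul_mem h₂ hw) using 1
    field_simp
  have hc : c.natDegree ≤ 0 := by
    refine natDegree_le_of_aeval_inv_t_mul_mem ?_
    convert neg_mem (mul_mem h₃ hu) using 1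
    field_simp
  have hd : d = 0 := by
    by_contra hd
    have : (X ^ 2 * d).natDegree ≤ 0 := by
      refine natDegree_le_of_aeval_inv_t_mul_mem ?_
      convert neg_mem h₄ using 1
      rw [map_mul, map_pow, aeval_X]
      ring
    rw [natDegree_X_pow_mul _ hd] at this
    omega
  exact ⟨a, b, c, ha, Nat.le_zero.1 hb, Nat.le_zero.1 hc, hd ▸ hr'⟩

theorem IsBiquadraticField.rank_regularDifferentials [IsAlgClosed k] [CharZero k]
    {v : Fin 3 → F} (hv : IsBiquadraticField f g v) (hfg : IsQuarticPair f g) :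
    Module.rank k (regularDifferentials k F) = 5 := by
  obtain ⟨hf, hg⟩ := hfg.ne_zero
  obtain ⟨hy0, hz0⟩ := hv.ne_zero hf hg
  have hD0 : D k F (v 0) ≠ 0 := by
    obtain ⟨u, w, -, -, -, -, hv'⟩ := hfg.exists_triple_infinity
    obtain ⟨φ, hφ⟩ := hv.exists_algHom _ hv'
    obtain ⟨ℓ, -, hD⟩ := exists_evalDifferential φ
    intro h0
    have h1 := hD (v 0)
    have hφq : φ (v 0) = (t k)⁻¹ := congrFun hφ 0
    rw [h0, map_zero, hφq, derivation_inv_t, eq_comm, neg_eq_zero] at h1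
    exact pow_ne_zero 2 (inv_ne_zero t_ne_zero) h1
  have hli : LinearIndependent k fun i => basicCoeff v i • D k F (v 0) := by
    rw [Fintype.linearIndependent_iff]
    intro e he
    simp_rw [← smul_assoc, ← Finset.sum_smul] at he
    have h0 := (smul_eq_zero.1 he).resolve_right hD0
    have hcomb : combination v (C (e 0) + C (e 1) * X + C (e 2) * X ^ 2) (C (e 4)) (C (e 3)) 0 =
        0 := by
      simp only [Fin.sum_univ_five, basicCoeff, Matrix.cons_val, Algebra.smul_def] at h0
      simp only [combination, map_add, map_mul, map_pow, map_zero, aeval_C, aeval_X]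
      field_simp at h0
      linear_combination h0
    obtain ⟨ha, hb, hc, -⟩ := hv.combination_eq_zero hfg.isIndependentPair hcomb
    have h₀ : e 0 = 0 := by simpa [coeff_X, coeff_C] using congrArg (coeff · 0) ha
    have h₁ : e 1 = 0 := by simpa [coeff_X, coeff_C] using congrArg (coeff · 1) ha
    have h₂ : e 2 = 0 := by simpa [coeff_X, coeff_C] using congrArg (coeff · 2) ha
    have h₃ : e 3 = 0 := C_eq_zero.1 hc
    have h₄ : e 4 = 0 := C_eq_zero.1 hb
    intro i
    fin_cases i <;> assumption
  have hspan : regularDifferentials k F =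
      Submodule.span k (Set.range fun i => basicCoeff v i • D k F (v 0)) := by
    refine le_antisymm (fun ω hω => ?_) ?_
    · obtain ⟨r, rfl⟩ := hv.exists_smul_D_eq hf hg ω
      obtain ⟨a, b, c, ha, hb, hc, hr⟩ := hv.exists_combination_of_mem_regularDifferentials hfg hω
      have hr' : r = a.coeff 0 • basicCoeff v 0 + a.coeff 1 • basicCoeff v 1 +
          a.coeff 2 • basicCoeff v 2 + c.coeff 0 • basicCoeff v 3 + b.coeff 0 • basicCoeff v 4 := by
        rw [combination, aeval_eq_sum_range' (Nat.lt_succ_of_le ha), eq_C_of_natDegree_eq_zero hb,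
          eq_C_of_natDegree_eq_zero hc] at hr
        simp only [Finset.sum_range_succ, Finset.sum_range_zero, aeval_C, map_zero,
          Algebra.smul_def] at hr
        simp only [basicCoeff, Matrix.cons_val, Algebra.smul_def]
        field_simp
        linear_combination hr
      have hmem (x : k) (i : Fin 5) : x • basicCoeff v i • D k F (v 0) ∈
          Submodule.span k (Set.range fun i => basicCoeff v i • D k F (v 0)) :=
        Submodule.smul_mem _ _ (Submodule.subset_span ⟨i, rfl⟩)
      rw [hr']
      simp only [add_smul, smul_assoc]
      exact add_mem (add_mem (add_mem (add_mem (hmem _ _) (hmem _ _)) (hmem _ _)) (hmem _ _))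
        (hmem _ _)
    · rw [Submodule.span_le]
      rintro _ ⟨i, rfl⟩
      exact basicCoeff_smul_D_mem_regularDifferentials hfg hv.toIsBiquadraticTriple i
  rw [hspan, rank_eq_card_basis (Module.Basis.span hli), Fintype.card_fin]
  rfl

end Genus

/-! ### Separability of the two quartics of `Y`. -/

section GenusOfCurveY

open Polynomial

theorem Polynomial.isCoprime_of_add_eq_natCast {k : Type*} [Field k] [CharZero k] {f g a b : k[X]}
    {n : ℕ} (hn : n ≠ 0) (h : a * f + b * g = n) : IsCoprime f g := by
  have hn' : (C (n : k)⁻¹ : k[X]) * n = 1 := by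
    rw [← C_eq_natCast, ← C_mul, inv_mul_cancel₀ (Nat.cast_ne_zero.2 hn), C_1]
  exact ⟨C (n : k)⁻¹ * a, C (n : k)⁻¹ * b, by linear_combination C (n : k)⁻¹ * h + hn'⟩

/-- The polynomial `(5q² - 1)(q² + 3)`. -/
noncomputable def curveYFirst (k : Type*) [Field k] : k[X] := 5 * X ^ 4 + 14 * X ^ 2 - 3

/-- The polynomial `5q⁴ - 8q³ + 6q² + 8q + 5`. -/
noncomputable def curveYSecond (k : Type*) [Field k] : k[X] :=
  5 * X ^ 4 - 8 * X ^ 3 + 6 * X ^ 2 + 8 * X + 5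

variable (k : Type*) [Field k] [CharZero k]

theorem natDegree_curveYFirst : (curveYFirst k).natDegree = 4 := by
  rw [curveYFirst]; compute_degree!

theorem natDegree_curveYSecond : (curveYSecond k).natDegree = 4 := by
  rw [curveYSecond]; compute_degree!

theorem reverse_curveYFirst : (curveYFirst k).reverse = -3 * X ^ 4 + 14 * X ^ 2 + 5 := by
  rw [reverse, natDegree_curveYFirst, curveYFirst]
  have : (5 * X ^ 4 + 14 * X ^ 2 - 3 : k[X]) = C 5 * X ^ 4 + C 14 * X ^ 2 + C (-3) * X ^ 0 := by
    simp [sub_eq_add_neg, ← C_ofNat]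
  rw [this, reflect_add, reflect_add, reflect_C_mul_X_pow, reflect_C_mul_X_pow, reflect_C_mul_X_pow,
    revAt_le (by norm_num), revAt_le (by norm_num), revAt_le (by norm_num)]
  simp only [map_neg, C_ofNat]
  norm_num
  ring

theorem reverse_curveYSecond :
    (curveYSecond k).reverse = 5 * X ^ 4 + 8 * X ^ 3 + 6 * X ^ 2 - 8 * X + 5 := by
  rw [reverse, natDegree_curveYSecond, curveYSecond]
  have : (5 * X ^ 4 - 8 * X ^ 3 + 6 * X ^ 2 + 8 * X + 5 : k[X]) =
      C 5 * X ^ 4 + C (-8) * X ^ 3 + C 6 * X ^ 2 + C 8 * X ^ 1 + C 5 * X ^ 0 := by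
    simp [sub_eq_add_neg, ← C_ofNat]
  rw [this]
  simp only [reflect_add, reflect_C_mul_X_pow]
  rw [revAt_le (by norm_num), revAt_le (by norm_num), revAt_le (by norm_num),
    revAt_le (by norm_num), revAt_le (by norm_num)]
  simp only [map_neg, C_ofNat]
  norm_num
  ring

theorem isQuarticPair_curveY : IsQuarticPair (curveYFirst k) (curveYSecond k) where
  natDegree_first := natDegree_curveYFirst k
  natDegree_second := natDegree_curveYSecond k
  separable := by
    refine Separable.mul ?_ ?_ ?_
    -- The constants here and below are Bézout identities with denominators cleared: each quartic
    -- with its derivative, then the two quartics with each other, and likewise for the reversed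
    -- quartics.
    · refine isCoprime_of_add_eq_natCast (n := 768) (a := -256 - 140 * X ^ 2)
        (b := 113 * X + 35 * X ^ 3) (by norm_num) ?_
      simp only [curveYFirst, derivative_add, derivative_sub, derivative_mul,
        derivative_X_pow, derivative_ofNat, C_eq_natCast]; push_cast; ring
    · refine isCoprime_of_add_eq_natCast (n := 4352) (a := 944 - 864 * X + 420 * X ^ 2)
        (b := -46 - 335 * X + 258 * X ^ 2 - 105 * X ^ 3) (by norm_num) ?_
      simp only [curveYSecond, derivative_add, derivative_sub, derivative_mul,
        derivative_X_pow, derivative_X, derivative_ofNat, C_eq_natCast]; push_cast; ring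
    · refine isCoprime_of_add_eq_natCast (n := 256) (a := -7 + 47 * X - 39 * X ^ 2 + 15 * X ^ 3)
        (b := 47 - 47 * X + 15 * X ^ 2 - 15 * X ^ 3) (by norm_num) ?_
      simp [curveYFirst, curveYSecond]; ring
  separable_reverse := by
    rw [reverse_curveYFirst, reverse_curveYSecond]
    refine Separable.mul ?_ ?_ ?_
    · refine isCoprime_of_add_eq_natCast (n := 1280) (a := 256 - 84 * X ^ 2)
        (b := -113 * X + 21 * X ^ 3) (by norm_num) ?_
      simp only [derivative_add, derivative_mul, derivative_X_pow, derivative_ofNat,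
        derivative_neg, C_eq_natCast]; push_cast; ring
    · refine isCoprime_of_add_eq_natCast (n := 4352) (a := 944 + 864 * X + 420 * X ^ 2)
        (b := 46 - 335 * X - 258 * X ^ 2 - 105 * X ^ 3) (by norm_num) ?_
      simp only [derivative_add, derivative_sub, derivative_mul, derivative_X_pow, derivative_X,
        derivative_ofNat, C_eq_natCast]; push_cast; ring
    · refine isCoprime_of_add_eq_natCast (n := 1280)
        (a := 171 - 117 * X - 161 * X ^ 2 - 85 * X ^ 3)
        (b := 85 + 253 * X - 15 * X ^ 2 - 51 * X ^ 3) (by norm_num) ?_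
      push_cast; ring

theorem geometricIdeal_curveY : geometricIdeal curveY =
    biquadraticIdeal (curveYFirst (AlgebraicClosure ℚ)) (curveYSecond (AlgebraicClosure ℚ)) := by
  rw [geometricIdeal, biquadraticIdeal, curveY, Set.image_pair]
  congr 2
  · simp only [curveYFirst, map_add, map_sub, map_mul, map_pow, map_ofNat, map_one, aeval_X,
      MvPolynomial.map_X]
    ring
  · simp only [curveYSecond, map_add, map_sub, map_mul, map_pow, map_ofNat, aeval_X,
      MvPolynomial.map_X]

theorem trdeg_and_rank_of_eq_biquadraticIdeal {k : Type*} [Field k] [CharZero k] [IsAlgClosed k]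
    {f g : k[X]} (hfg : IsQuarticPair f g) {I : Ideal (MvPolynomial (Fin 3) k)} [I.IsPrime]
    (hI : I = biquadraticIdeal f g) :
    Algebra.trdeg k (FractionRing (MvPolynomial (Fin 3) k ⧸ I)) = 1 ∧
      Module.rank k (regularDifferentials k (FractionRing (MvPolynomial (Fin 3) k ⧸ I))) =
        (5 : ℕ) := by
  subst hI
  have hv := isBiquadraticField_fractionRing hfg.isIndependentPair
  exact ⟨hv.trdeg_eq_one, by exact_mod_cast hv.rank_regularDifferentials hfg⟩

theorem isAffineCurveOfGenus_curveY : IsAffineCurveOfGenus curveY 5 := by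
  have hfg := isQuarticPair_curveY (AlgebraicClosure ℚ)
  have hprime : (geometricIdeal curveY).IsPrime :=
    geometricIdeal_curveY ▸ isPrime_biquadraticIdeal hfg.isIndependentPair
  exact ⟨hprime, trdeg_and_rank_of_eq_biquadraticIdeal hfg geometricIdeal_curveY⟩

end GenusOfCurveY

theorem mainTheorem10 :
    (∀ (K : Type*) [Field K] [NumberField K], Module.finrank ℚ K = 2 → ∀ c : K,
      ¬ ContainsGraph (preperiodicGraph (quadMap c)) G6) ∧
    IsAffineCurveOfGenus curveY 5 ∧
    quadraticPoints curveY = rationalPoints curveY ∧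
    rationalPoints curveY =
      {P | (P 0 = 1 ∨ P 0 = -1) ∧ (P 1 = 4 ∨ P 1 = -4) ∧ (P 2 = 4 ∨ P 2 = -4)} := by
  exact ⟨fun K _ _ hK c => not_containsGraph_G6 K hK c, isAffineCurveOfGenus_curveY,
    quadraticPoints_curveY, rationalPoints_curveY⟩
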